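/- Let $\Bbbk=\mathbb R$ or $\mathbb C$, let $U\subseteq\mathbb R^d$ be open with coordinates $(x^i)$, and let $(x^i,p_i)$ be the induced coordinates on $T^*U$, with $\partial_i=\partial/\partial x^i$. Functions are smooth and $\Bbbk$-valued, and repeated indices are summed. Let $\theta=\frac12\theta^{ij}\partial_i\wedge\partial_j$ be an almost Poisson structure (an arbitrary bivector field) on $U$, with bracket $\{f,g\}_\theta=\theta^{ij}\partial_if\,\partial_jg$ and Jacobiator components $\Pi^{ijk}=\frac13\big(\theta^{il}\partial_l\theta^{jk}+\theta^{kl}\partial_l\theta^{ij}+\theta^{jl}\partial_l\theta^{ki}\big)$. A *local symplectic embedding* of $(U,\theta)$ is a formal power series $\omega=\sum_{n\ge0}t^n\omega_n$ of closed two-forms on $T^*U$, polynomial on the fibres, with $\omega_0=dp_i\wedge dx^i$, for which the zero section is Lagrangian and $\{\pi^*f,\pi^*g\}_{\omega^{-1}}|_{p=0}=t\{f,g\}_\theta$ for all functions $f,g$ on $U$ (with $\pi:T^*U\to U$), and whose inverse bivector $\omega^{-1}$ has brackets of the form $$\{x^i,x^j\}=t\,\underline\theta^{ij},\qquad \{x^j,p_i\}=\delta^j_i+t\,\gamma_i^j,\qquad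 \{p_i,p_j\}=0,$$ $$\gamma_i^j=\sum_{n\ge1}t^{n-1}\gamma_i^{j|i_1\cdots i_n}(x)\,p_{i_1}\cdots p_{i_n},\qquad \underline\theta^{ij}=\sum_{n\ge0}t^{n}\,\theta^{ij|i_1\cdots i_n}(x)\,p_{i_1}\cdots p_{i_n},$$ with coefficients symmetric in $i_1,\dots,i_n$, where the $n=0$ coefficient of $\underline\theta^{ij}$ is $\theta^{ij}$ and $\theta^{ij|k}=-\Pi^{ijk}$. For one-forms $\lambda,\mu,\beta,\beta',\alpha_1,\dots,\alpha_n$ on $U$ write $L_j=L_{\partial_j}$ for the Lie derivative, $\alpha_I=\alpha_{1,i_1}\cdots\alpha_{n,i_n}$ for $I=(i_1,\dots,i_n)$, and $$\gamma^{(n)}(\lambda,\alpha_1,\dots,\alpha_n)=n!\,\gamma_i^{j|I}\lambda_j\alpha_I\,dx^i,\qquad \gamma^{(n)\otimes}(D\beta,\alpha_1,\dots,\alpha_n)=n!\,\gamma_i^{j|I}\alpha_I\,L_j\beta\wedge dx^i,$$ $$\theta^{(n)}(\lambda,\mu,\alpha_1,\dots,\alpha_n)=n!\,\theta^{ij|I}\lambda_i\mu_j\alpha_I,\qquad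 \theta^{(n)\otimes}(\lambda,D\beta,\alpha_1,\dots,\alpha_n)=n!\,\theta^{ij|I}\lambda_i\alpha_I\,L_j\beta,$$ $$\theta^{(n)\otimes}(D\beta,D\beta',\alpha_1,\dots,\alpha_n)=n!\,\theta^{ij|I}\alpha_I\,L_i\beta\wedge L_j\beta',$$ $$\{f,\alpha\}_\theta=\theta^{ij}\partial_if\,L_j\alpha,\qquad \{\alpha,\beta\}_\theta=\theta^{ij}L_i\alpha\wedge L_j\beta,\qquad \Pi(\lambda,\mu,\alpha)=\Pi^{ijk}\lambda_i\mu_j\alpha_k.$$ A *(flat) $L_\infty$-structure* on a graded vector space $V$ is a sequence of graded skew-symmetric multilinear maps $\ell_n:V^{\otimes n}\to V$ ($n\ge1$) of degree $2-n$ such that for all $n\ge1$ and homogeneous $v_1,\dots,v_n$ $$\sum_{k=1}^n\frac{(-1)^{k(n-k)}}{k!\,(n-k)!}\sum_{\sigma\in S_n}\mathrm{sgn}(\sigma)\,\varepsilon(\sigma;v)\,\ell_{n-k+1}\big(\ell_k(v_{\sigma(1)},\dots,v_{\sigma(k)}),v_{\sigma(k+1)},\dots,v_{\sigma(n)}\big)=0,$$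 with $\varepsilon$ the Koszul sign. A *$P_\infty$-structure* on a graded commutative algebra is an $L_\infty$-structure such that every map $a\mapsto\ell_n(a_1,\dots,a_{n-1},a)$, with $a_1,\dots,a_{n-1}$ homogeneous, is a graded derivation of degree $2-n+\sum_i|a_i|$. **Proposition 5.6.** Let $\omega$ be a local symplectic embedding of $(U,\theta)$. Then there is a unique $P_\infty$-structure $\{\varrho_n\}_{n\ge1}$ on the exterior algebra $\Omega^\bullet(U)$ of differential forms which takes the following values on functions $f,g$ and one-forms $\alpha,\beta,\alpha_1,\dots,\alpha_n$: $$\varrho_1(f)=df,\qquad \varrho_1(\alpha)=d\alpha,\qquad \varrho_2(f,g)=\{f,g\}_\theta,\qquad \varrho_2(f,\alpha)=\{f,\alpha\}_\theta-\gamma^{(1)}(df,\alpha),$$ $$\varrho_2(\alpha,\beta)=\{\alpha,\beta\}_\theta-\gamma^{(1)\otimes}(D\alpha,\beta)-\gamma^{(1)\otimes}(D\beta,\alpha),\qquad \varrho_3(f,g,\alpha)=\Pi(df,dg,\alpha),$$ and, for $n\ge2$ (a hat denotes omission), $$\varrho_n(\alpha_1,\dots,\alpha_n)=(-1)^{\frac{n(n+1)}2}\Big(\sum_{i}\gamma^{(n-1)\otimes}(D\alpha_i,\alpha_1,\dots,\widehat{\alpha_i},\dots,\alpha_n)-\sum_{i<j}\theta^{(n-2)\otimes}(D\alpha_i,D\alpha_j,\alpha_1,\dots,\widehat{\alpha_i},\dots,\widehat{\alpha_j},\dots,\alpha_n)\Big),$$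 $$\varrho_{n+1}(f,\alpha_1,\dots,\alpha_n)=(-1)^{\frac{n(n+1)}2}\Big(\gamma^{(n)}(df,\alpha_1,\dots,\alpha_n)-\sum_i\theta^{(n-1)\otimes}(df,D\alpha_i,\alpha_1,\dots,\widehat{\alpha_i},\dots,\alpha_n)\Big),$$ $$\varrho_{n+2}(f,g,\alpha_1,\dots,\alpha_n)=(-1)^{\frac{n(n+1)}2}\,\theta^{(n)}(df,dg,\alpha_1,\dots,\alpha_n).$$ -/

import Mathlib

open scoped ContDiff

noncomputable section

namespace PInftyForms

/-! ### Smooth functions and differential forms on an open subset of `ℝ^d` -/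

/-- The algebra `C^∞(U)` of smooth functions on an open set `U ⊆ ℝ^d` with values in the ground
field `𝕜` (which is `ℝ` or `ℂ`).  Smoothness is real smoothness on `U` of the function extended by
zero; as `U` is open, the values off `U` play no role. -/
def smoothSubalgebra (𝕜 : Type) [RCLike 𝕜] {d : ℕ} (U : TopologicalSpace.Opens (Fin d → ℝ)) :
    Subalgebra 𝕜 (U → 𝕜) where
  carrier := {f | ContDiffOn ℝ ∞ (Function.extend Subtype.val f 0) (U : Set (Fin d → ℝ))}
  mul_mem' := by
    intro f g hf hg
    refine (ContDiffOn.mul hf hg).congr fun x hx => ?_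
    have h : ∀ k : U → 𝕜, Function.extend Subtype.val k 0 x = k ⟨x, hx⟩ := fun k =>
      Subtype.val_injective.extend_apply k 0 (⟨x, hx⟩ : U)
    simp [h]
  add_mem' := by
    intro f g hf hg
    refine (ContDiffOn.add hf hg).congr fun x hx => ?_
    have h : ∀ k : U → 𝕜, Function.extend Subtype.val k 0 x = k ⟨x, hx⟩ := fun k =>
      Subtype.val_injective.extend_apply k 0 (⟨x, hx⟩ : U)
    simp [h]
  algebraMap_mem' := by
    intro c
    refine (contDiffOn_const (c := c)).congr fun x hx => ?_
    have h : ∀ k : U → 𝕜, Function.extend Subtype.val k 0 x = k ⟨x, hx⟩ := fun k =>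
      Subtype.val_injective.extend_apply k 0 (⟨x, hx⟩ : U)
    simp [h]

/-- The commutative `𝕜`-algebra `C^∞(U)`. -/
def SmoothFun (𝕜 : Type) [RCLike 𝕜] {d : ℕ} (U : TopologicalSpace.Opens (Fin d → ℝ)) : Type :=
  smoothSubalgebra 𝕜 U

instance {𝕜 : Type} [RCLike 𝕜] {d : ℕ} {U : TopologicalSpace.Opens (Fin d → ℝ)} :
    CommRing (SmoothFun 𝕜 U) :=
  inferInstanceAs (CommRing (smoothSubalgebra 𝕜 U))

instance {𝕜 : Type} [RCLike 𝕜] {d : ℕ} {U : TopologicalSpace.Opens (Fin d → ℝ)} :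
    Algebra 𝕜 (SmoothFun 𝕜 U) :=
  inferInstanceAs (Algebra 𝕜 (smoothSubalgebra 𝕜 U))

/-- The partial derivative `∂_i f = ∂f/∂x^i` of a smooth function on `U`. -/
def partialX {𝕜 : Type} [RCLike 𝕜] {d : ℕ} {U : TopologicalSpace.Opens (Fin d → ℝ)} (i : Fin d)
    (f : SmoothFun 𝕜 U) : SmoothFun 𝕜 U :=
  ⟨fun x => fderiv ℝ (Function.extend Subtype.val f.1 (0 : (Fin d → ℝ) → 𝕜)) x (Pi.single i 1), by
    have hf : ContDiffOn ℝ ∞ (Function.extend Subtype.val f.1 (0 : (Fin d → ℝ) → 𝕜))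
        (U : Set (Fin d → ℝ)) := f.2
    have h1 := hf.fderiv_of_isOpen (m := ∞) U.isOpen (by simp)
    refine (h1.clm_apply (contDiffOn_const (c := (Pi.single i 1 : Fin d → ℝ)))).congr
      fun x hx => ?_
    have h : ∀ k : U → 𝕜, Function.extend Subtype.val k 0 x = k ⟨x, hx⟩ := fun k =>
      Subtype.val_injective.extend_apply k 0 (⟨x, hx⟩ : U)
    exact h _⟩

/-- One-forms `α = α_i dx^i` on `U`, given by their components. -/
abbrev OneForm (𝕜 : Type) [RCLike 𝕜] {d : ℕ} (U : TopologicalSpace.Opens (Fin d → ℝ)) : Type :=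
  Fin d → SmoothFun 𝕜 U

/-- The exterior algebra `Ω^•(U)` of differential forms on `U`: the exterior algebra over
`C^∞(U)` of the module of one-forms. -/
abbrev Forms (𝕜 : Type) [RCLike 𝕜] {d : ℕ} (U : TopologicalSpace.Opens (Fin d → ℝ)) : Type :=
  ExteriorAlgebra (SmoothFun 𝕜 U) (OneForm 𝕜 U)

instance {𝕜 : Type} [RCLike 𝕜] {d : ℕ} {U : TopologicalSpace.Opens (Fin d → ℝ)} :
    Algebra (SmoothFun 𝕜 U) (Forms 𝕜 U) :=
  CliffordAlgebra.instAlgebra _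

instance {𝕜 : Type} [RCLike 𝕜] {d : ℕ} {U : TopologicalSpace.Opens (Fin d → ℝ)} :
    Algebra 𝕜 (Forms 𝕜 U) :=
  CliffordAlgebra.instAlgebra' _

/-- The `𝕜`-subspace `Ω^k(U)`, for `k : ℤ`; it is zero for negative `k`. -/
def formsOfDegree (𝕜 : Type) [RCLike 𝕜] {d : ℕ} (U : TopologicalSpace.Opens (Fin d → ℝ)) (k : ℤ) :
    Submodule 𝕜 (Forms 𝕜 U) :=
  if 0 ≤ k then (⋀[SmoothFun 𝕜 U]^k.toNat (OneForm 𝕜 U)).restrictScalars 𝕜 else ⊥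

section Calculus

variable {𝕜 : Type} [RCLike 𝕜] {d : ℕ} {U : TopologicalSpace.Opens (Fin d → ℝ)}

/-- A function regarded as a form of degree zero. -/
def ofFun (f : SmoothFun 𝕜 U) : Forms 𝕜 U := algebraMap (SmoothFun 𝕜 U) (Forms 𝕜 U) f

/-- A one-form regarded as an element of the exterior algebra. -/
def ofOne (α : OneForm 𝕜 U) : Forms 𝕜 U := ExteriorAlgebra.ι (SmoothFun 𝕜 U) α

/-- The coordinate one-form `dx^i`. -/
def dx (i : Fin d) : OneForm 𝕜 U := Pi.single i 1

/-- The exterior derivative `df = ∂_i f dx^i` of a function. -/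
def dFun (f : SmoothFun 𝕜 U) : OneForm 𝕜 U := fun i => partialX i f

/-- The Lie derivative `L_{∂_j} α` of a one-form along a coordinate vector field, so that
`D α = L_{∂_j} α ⊗ dx^j`. -/
def lieX (j : Fin d) (α : OneForm 𝕜 U) : OneForm 𝕜 U := fun k => partialX j (α k)

/-- The exterior derivative `dα = dx^j ∧ L_{∂_j} α` of a one-form. -/
def dOne (α : OneForm 𝕜 U) : Forms 𝕜 U := ∑ j, ofOne (dx j) * ofOne (lieX j α)

end Calculus

/-! ### Almost Poisson structures and their local symplectic embeddings -/

/-- An almost Poisson structure on `U`: a bivector field `θ = ½ θ^{ij} ∂_i ∧ ∂_j`, given by its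
skew-symmetric matrix of components. -/
structure AlmostPoisson (𝕜 : Type) [RCLike 𝕜] {d : ℕ}
    (U : TopologicalSpace.Opens (Fin d → ℝ)) where
  /-- The components `θ^{ij}`. -/
  comp : Fin d → Fin d → SmoothFun 𝕜 U
  skew : ∀ i j, comp i j = -comp j i

section Embedding

variable {𝕜 : Type} [RCLike 𝕜] {d : ℕ} {U : TopologicalSpace.Opens (Fin d → ℝ)}

/-- The almost Poisson bracket `{f, g}_θ = θ^{ij} ∂_i f ∂_j g`. -/
def AlmostPoisson.bracket (θ : AlmostPoisson 𝕜 U) (f g : SmoothFun 𝕜 U) : SmoothFun 𝕜 U :=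
  ∑ i, ∑ j, θ.comp i j * partialX i f * partialX j g

/-- The components
`Π^{ijk} = ⅓ (θ^{il} ∂_l θ^{jk} + θ^{kl} ∂_l θ^{ij} + θ^{jl} ∂_l θ^{ki})` of the Jacobiator. -/
def AlmostPoisson.jacobiator (θ : AlmostPoisson 𝕜 U) (i j k : Fin d) : SmoothFun 𝕜 U :=
  (3⁻¹ : 𝕜) • ∑ l, (θ.comp i l * partialX l (θ.comp j k) + θ.comp k l * partialX l (θ.comp i j)
    + θ.comp j l * partialX l (θ.comp k i))

/-- `Π(λ, μ, α) = Π^{ijk} λ_i μ_j α_k`. -/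
def AlmostPoisson.jacobiatorEval (θ : AlmostPoisson 𝕜 U) (lam mu α : OneForm 𝕜 U) :
    SmoothFun 𝕜 U :=
  ∑ i, ∑ j, ∑ k, θ.jacobiator i j k * lam i * mu j * α k

/-- The ring `C^∞_pol(T^*U)[[t]]`: formal power series in `t` whose coefficients are polynomials
in the fibre coordinates `p_1, …, p_d` over `C^∞(U)`. -/
abbrev FormalFun (𝕜 : Type) [RCLike 𝕜] {d : ℕ} (U : TopologicalSpace.Opens (Fin d → ℝ)) : Type :=
  PowerSeries (MvPolynomial (Fin d) (SmoothFun 𝕜 U))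

/-- The derivative `∂_i` of a fibrewise polynomial function, acting on its coefficients. -/
def polyPartialX (i : Fin d) (P : MvPolynomial (Fin d) (SmoothFun 𝕜 U)) :
    MvPolynomial (Fin d) (SmoothFun 𝕜 U) :=
  ∑ m ∈ P.support, MvPolynomial.monomial m (partialX i (P.coeff m))

/-- The derivatives along the coordinates `(x^i, p_i)` of `T^*U`: the index `Sum.inl i` stands
for `x^i` and `Sum.inr i` for `p_i`.  They act on each power of `t` separately. -/
def partialT (a : Fin d ⊕ Fin d) (F : FormalFun 𝕜 U) : FormalFun 𝕜 U :=
  PowerSeries.mk fun n =>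
    match a with
    | Sum.inl i => polyPartialX i (PowerSeries.coeff n F)
    | Sum.inr i => MvPolynomial.pderiv i (PowerSeries.coeff n F)

/-- The pullback `π^* f` of a function along `π : T^*U → U`. -/
def pullback (f : SmoothFun 𝕜 U) : FormalFun 𝕜 U := PowerSeries.C (MvPolynomial.C f)

/-- Restriction to the zero section `p = 0`. -/
def zeroSection (F : FormalFun 𝕜 U) : PowerSeries (SmoothFun 𝕜 U) :=
  PowerSeries.map MvPolynomial.constantCoeff F

/-- A symplectic embedding of `(U, θ)` in the coordinates `z = (x, p)` of `T^*U`: a formal power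
series `ω = ½ ω_{ab} dz^a ∧ dz^b` of closed two-forms on `T^*U`, polynomial on the fibres, which
deforms the canonical form `ω_0 = dp_i ∧ dx^i`, together with its inverse
`ω⁻¹ = ½ W^{ab} ∂_a ∧ ∂_b`. -/
structure SymplecticEmbedding (θ : AlmostPoisson 𝕜 U) where
  /-- The components `ω_{ab}`. -/
  form : Matrix (Fin d ⊕ Fin d) (Fin d ⊕ Fin d) (FormalFun 𝕜 U)
  /-- The components `W^{ab}` of the cosymplectic bivector. -/
  cosymp : Matrix (Fin d ⊕ Fin d) (Fin d ⊕ Fin d) (FormalFun 𝕜 U)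
  skew : ∀ a b, form a b = -form b a
  closed : ∀ a b c,
    partialT a (form b c) + partialT b (form c a) + partialT c (form a b) = 0
  inverse : form * cosymp = 1
  /-- `ω` at `t = 0` is `dp_i ∧ dx^i`. -/
  deformation : form.map PowerSeries.constantCoeff = Matrix.fromBlocks 0 (-1) 1 0
  /-- The bracket `{F, G} = W^{ab} ∂_a F ∂_b G` satisfies
  `{π^* f, π^* g} = t {f, g}_θ` on the zero section. -/
  restrict : ∀ f g : SmoothFun 𝕜 U,
    zeroSection (∑ a, ∑ b, cosymp a b * partialT a (pullback f) * partialT b (pullback g)) =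
      PowerSeries.X * PowerSeries.C (θ.bracket f g)
  /-- The zero section is Lagrangian. -/
  lagrangian : ∀ i j, zeroSection (form (Sum.inl i) (Sum.inl j)) = 0

/-- A local symplectic embedding of `(U, θ)`: a symplectic embedding whose cosymplectic bivector
has the local form
`ω⁻¹ = (t/2) θ̲^{ij}(x,p) ∂_i ∧ ∂_j + (δ^i_j + t γ^i_j(x,p)) ∂_i ∧ ∂/∂p_j`, where
`θ̲^{ij} = θ^{ij} - t Π^{ijk} p_k + ∑_{n ≥ 2} t^n θ^{ij|i_1⋯i_n}(x) p_{i_1} ⋯ p_{i_n}` and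
`γ_i^j = ∑_{n ≥ 1} t^{n-1} γ_i^{j|i_1⋯i_n}(x) p_{i_1} ⋯ p_{i_n}`. -/
structure LocalSymplecticEmbedding (θ : AlmostPoisson 𝕜 U) extends SymplecticEmbedding θ where
  /-- `gam n i j I` is `γ_i^{j|i_1⋯i_n}`, for `n ≥ 1` (the value at `n = 0` is not used). -/
  gam : (n : ℕ) → Fin d → Fin d → (Fin n → Fin d) → SmoothFun 𝕜 U
  /-- `the n i j I` is `θ^{ij|i_1⋯i_n}`. -/
  the : (n : ℕ) → Fin d → Fin d → (Fin n → Fin d) → SmoothFun 𝕜 U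
  gam_symm : ∀ n i j (I : Fin n → Fin d) (σ : Equiv.Perm (Fin n)), gam n i j (I ∘ σ) = gam n i j I
  the_symm : ∀ n i j (I : Fin n → Fin d) (σ : Equiv.Perm (Fin n)), the n i j (I ∘ σ) = the n i j I
  the_zero : ∀ i j (I : Fin 0 → Fin d), the 0 i j I = θ.comp i j
  the_one : ∀ i j (I : Fin 1 → Fin d), the 1 i j I = -θ.jacobiator i j (I 0)
  /-- `{p_i, p_j} = 0`. -/
  cosymp_pp : ∀ i j, cosymp (Sum.inr i) (Sum.inr j) = 0
  /-- The coefficient of `t^n` in `{x^j, p_i} = δ^j_i + t γ_i^j`, for `n ≥ 1`. -/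
  cosymp_xp : ∀ n i j, 1 ≤ n → PowerSeries.coeff n (cosymp (Sum.inl j) (Sum.inr i)) =
    ∑ I : Fin n → Fin d, MvPolynomial.C (gam n i j I) * ∏ k, MvPolynomial.X (I k)
  /-- The coefficient of `t^{n+1}` in `{x^i, x^j} = t θ̲^{ij}`. -/
  cosymp_xx : ∀ n i j, PowerSeries.coeff (n + 1) (cosymp (Sum.inl i) (Sum.inl j)) =
    ∑ I : Fin n → Fin d, MvPolynomial.C (the n i j I) * ∏ k, MvPolynomial.X (I k)

/-! ### The tensors of a local symplectic embedding -/

namespace LocalSymplecticEmbedding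

variable {θ : AlmostPoisson 𝕜 U} (E : LocalSymplecticEmbedding θ)

/-- `γ^{(n)}(λ, α_1, …, α_n) = n! γ_i^{j|i_1⋯i_n} λ_j α_{1,i_1} ⋯ α_{n,i_n} dx^i`. -/
def gammaEval (n : ℕ) (lam : OneForm 𝕜 U) (α : Fin n → OneForm 𝕜 U) : OneForm 𝕜 U := fun i =>
  n.factorial • ∑ j, ∑ I : Fin n → Fin d, E.gam n i j I * lam j * ∏ k, α k (I k)

/-- `γ^{(n)⊗}(Dβ, α_1, …, α_n) = n! γ_i^{j|i_1⋯i_n} α_{1,i_1} ⋯ α_{n,i_n} L_{∂_j} β ∧ dx^i`. -/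
def gammaTensor (n : ℕ) (β : OneForm 𝕜 U) (α : Fin n → OneForm 𝕜 U) : Forms 𝕜 U :=
  n.factorial • ∑ i, ∑ j, ∑ I : Fin n → Fin d,
    (E.gam n i j I * ∏ k, α k (I k)) • (ofOne (lieX j β) * ofOne (dx i))

/-- `θ^{(n)}(λ, μ, α_1, …, α_n) = n! θ^{ij|i_1⋯i_n} λ_i μ_j α_{1,i_1} ⋯ α_{n,i_n}`. -/
def thetaEval (n : ℕ) (lam mu : OneForm 𝕜 U) (α : Fin n → OneForm 𝕜 U) : SmoothFun 𝕜 U :=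
  n.factorial • ∑ i, ∑ j, ∑ I : Fin n → Fin d, E.the n i j I * lam i * mu j * ∏ k, α k (I k)

/-- `θ^{(n)⊗}(λ, Dβ, α_1, …, α_n) = n! θ^{ij|i_1⋯i_n} λ_i α_{1,i_1} ⋯ α_{n,i_n} L_{∂_j} β`. -/
def thetaTensorOne (n : ℕ) (lam β : OneForm 𝕜 U) (α : Fin n → OneForm 𝕜 U) : OneForm 𝕜 U :=
  n.factorial • ∑ i, ∑ j, ∑ I : Fin n → Fin d,
    (E.the n i j I * lam i * ∏ k, α k (I k)) • lieX j β

/-- `θ^{(n)⊗}(Dβ, Dβ', α_1, …, α_n)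
  = n! θ^{ij|i_1⋯i_n} α_{1,i_1} ⋯ α_{n,i_n} L_{∂_i} β ∧ L_{∂_j} β'`. -/
def thetaTensorTwo (n : ℕ) (β β' : OneForm 𝕜 U) (α : Fin n → OneForm 𝕜 U) : Forms 𝕜 U :=
  n.factorial • ∑ i, ∑ j, ∑ I : Fin n → Fin d,
    (E.the n i j I * ∏ k, α k (I k)) • (ofOne (lieX i β) * ofOne (lieX j β'))

end LocalSymplecticEmbedding

/-- `{f, α}_θ = θ^{ij} ∂_i f L_{∂_j} α`. -/
def AlmostPoisson.bracketFunOne (θ : AlmostPoisson 𝕜 U) (f : SmoothFun 𝕜 U) (α : OneForm 𝕜 U) :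
    OneForm 𝕜 U :=
  ∑ i, ∑ j, (θ.comp i j * partialX i f) • lieX j α

/-- `{α, β}_θ = θ^{ij} L_{∂_i} α ∧ L_{∂_j} β`. -/
def AlmostPoisson.bracketOneOne (θ : AlmostPoisson 𝕜 U) (α β : OneForm 𝕜 U) : Forms 𝕜 U :=
  ∑ i, ∑ j, θ.comp i j • (ofOne (lieX i α) * ofOne (lieX j β))

end Embedding

/-! ### Homotopy algebras -/

section Homotopy

variable {𝕜 : Type} [Field 𝕜] {V : Type} [Ring V] [Algebra 𝕜 V]

/-- The Koszul sign of rearranging homogeneous elements of degrees `a` into the order given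
by `σ`: a factor `(-1)^{a_i a_j}` for every pair that is exchanged. -/
def koszulSign {n : ℕ} (a : Fin n → ℤ) (σ : Equiv.Perm (Fin n)) : ℤˣ :=
  ∏ i, ∏ j, if i < j ∧ σ j < σ i then (a (σ i) * a (σ j)).negOnePow else 1

/-- The left-hand side
`∑_{k=1}^n ∑_σ (-1)^{k(n-k)} / (k! (n-k)!) sgn(σ) ε(σ) ℓ_{n-k+1}(ℓ_k(v_{σ(1)}, …, v_{σ(k)}),
v_{σ(k+1)}, …, v_{σ(n)})` of the `n`-th homotopy Jacobi identity on elements of degrees `a`, where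
`ε` is the Koszul sign.  The summation index `k` is shifted by one. -/
def homotopyJacobi (ℓ : (n : ℕ) → MultilinearMap 𝕜 (fun _ : Fin n => V) V) (n : ℕ)
    (a : Fin n → ℤ) (v : Fin n → V) : V :=
  ∑ k : Fin n,
    ((-1 : 𝕜) ^ ((k.val + 1) * (n - (k.val + 1))) *
      (((k.val + 1).factorial * (n - (k.val + 1)).factorial : ℕ) : 𝕜)⁻¹) •
    ∑ σ : Equiv.Perm (Fin n),
      ((Equiv.Perm.sign σ * koszulSign a σ : ℤˣ) : ℤ) •
        ℓ (n - (k.val + 1) + 1)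
          (Fin.cons
            (ℓ (k.val + 1) fun i => v (σ (Fin.cast (by omega)
              (Fin.castAdd (n - (k.val + 1)) i))))
            (fun j => v (σ (Fin.cast (by omega) (Fin.natAdd (k.val + 1) j)))))

/-- A flat `L_∞`-structure on the vector space `V` graded by `𝒢`. -/
structure IsLInfinity (𝒢 : ℤ → Submodule 𝕜 V)
    (ℓ : (n : ℕ) → MultilinearMap 𝕜 (fun _ : Fin n => V) V) : Prop where
  /-- There is no curving. -/
  flat : ℓ 0 = 0
  /-- `ℓ_n` has degree `2 - n`. -/
  degree : ∀ (n : ℕ) (a : Fin n → ℤ) (v : Fin n → V), (∀ i, v i ∈ 𝒢 (a i)) →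
    ℓ n v ∈ 𝒢 (2 - n + ∑ i, a i)
  /-- `ℓ_n` is graded skew-symmetric. -/
  skew : ∀ (n : ℕ) (a : Fin n → ℤ) (v : Fin n → V), (∀ i, v i ∈ 𝒢 (a i)) →
    ∀ i j : Fin n, j.val = i.val + 1 →
      ℓ n (v ∘ Equiv.swap i j) = -(((a i * a j).negOnePow : ℤ) • ℓ n v)
  jacobi : ∀ n : ℕ, 1 ≤ n → ∀ (a : Fin n → ℤ) (v : Fin n → V), (∀ i, v i ∈ 𝒢 (a i)) →
    homotopyJacobi ℓ n a v = 0

/-- `V` is a graded commutative algebra with homogeneous components `𝒢 k`. -/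
structure IsGradedCommutative (𝒢 : ℤ → Submodule 𝕜 V) : Prop where
  internal : DirectSum.IsInternal 𝒢
  one_mem : (1 : V) ∈ 𝒢 0
  mul_mem : ∀ (k l : ℤ) (v w : V), v ∈ 𝒢 k → w ∈ 𝒢 l → v * w ∈ 𝒢 (k + l)
  comm : ∀ (k l : ℤ) (v w : V), v ∈ 𝒢 k → w ∈ 𝒢 l →
    v * w = ((k * l).negOnePow : ℤ) • (w * v)

/-- A `P_∞`-structure: an `L_∞`-structure on a graded commutative algebra such that every
`v ↦ ℓ_{n+1}(v_1, …, v_n, v)` is a derivation of degree `2 - (n+1) + |v_1| + ⋯ + |v_n|`. -/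
structure IsPInfinity (𝒢 : ℤ → Submodule 𝕜 V)
    (ℓ : (n : ℕ) → MultilinearMap 𝕜 (fun _ : Fin n => V) V) : Prop where
  gradedCommutative : IsGradedCommutative 𝒢
  lInfinity : IsLInfinity 𝒢 ℓ
  derivation : ∀ (n : ℕ) (a : Fin n → ℤ) (v : Fin n → V), (∀ i, v i ∈ 𝒢 (a i)) →
    ∀ (p : ℤ) (b c : V), b ∈ 𝒢 p →
      ℓ (n + 1) (Fin.snoc v (b * c)) = ℓ (n + 1) (Fin.snoc v b) * c +
        ((p * (2 - (n + 1 : ℤ) + ∑ i, a i)).negOnePow : ℤ) • (b * ℓ (n + 1) (Fin.snoc v c))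

end Homotopy

/-! ### The brackets on functions and one-forms -/

section Brackets

variable {𝕜 : Type} [RCLike 𝕜] {d : ℕ} {U : TopologicalSpace.Opens (Fin d → ℝ)}

/-- The sign `(-1)^{n(n+1)/2}`. -/
def sgnTri (n : ℕ) : ℤ := (-1) ^ (n * (n + 1) / 2)

/-- The values of the brackets `ϱ_n` on functions and one-forms.  For `α : Fin (n + 1) → _` the
family with `α_i` omitted is `α ∘ i.succAbove`; a pair `i < j` of indices in `Fin (n + 2)` is
written with `j = i.succAbove k`, and the family with `α_i` and `α_j` omitted is
`α ∘ i.succAbove ∘ k.succAbove`. -/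
structure HasGeneratorBrackets {θ : AlmostPoisson 𝕜 U} (E : LocalSymplecticEmbedding θ)
    (ϱ : (n : ℕ) → MultilinearMap 𝕜 (fun _ : Fin n => Forms 𝕜 U) (Forms 𝕜 U)) : Prop where
  one_fun : ∀ f : SmoothFun 𝕜 U, ϱ 1 ![ofFun f] = ofOne (dFun f)
  one_one : ∀ α : OneForm 𝕜 U, ϱ 1 ![ofOne α] = dOne α
  two_fun_fun : ∀ f g : SmoothFun 𝕜 U, ϱ 2 ![ofFun f, ofFun g] = ofFun (θ.bracket f g)
  two_fun_one : ∀ (f : SmoothFun 𝕜 U) (α : OneForm 𝕜 U),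
    ϱ 2 ![ofFun f, ofOne α] = ofOne (θ.bracketFunOne f α - E.gammaEval 1 (dFun f) ![α])
  two_one_one : ∀ α β : OneForm 𝕜 U,
    ϱ 2 ![ofOne α, ofOne β] =
      θ.bracketOneOne α β - E.gammaTensor 1 α ![β] - E.gammaTensor 1 β ![α]
  three_fun_fun_one : ∀ (f g : SmoothFun 𝕜 U) (α : OneForm 𝕜 U),
    ϱ 3 ![ofFun f, ofFun g, ofOne α] = ofFun (θ.jacobiatorEval (dFun f) (dFun g) α)
  /-- `ϱ_n(α_1, …, α_n)` for `n = m + 2 ≥ 2`. -/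
  ones : ∀ (m : ℕ) (α : Fin (m + 2) → OneForm 𝕜 U),
    ϱ (m + 2) (fun i => ofOne (α i)) =
      sgnTri (m + 2) •
        (∑ i, E.gammaTensor (m + 1) (α i) (α ∘ i.succAbove) -
          ∑ i : Fin (m + 2), ∑ k : Fin (m + 1),
            if i < i.succAbove k then
              E.thetaTensorTwo m (α i) (α (i.succAbove k)) (α ∘ i.succAbove ∘ k.succAbove)
            else 0)
  /-- `ϱ_{n+1}(f, α_1, …, α_n)` for `n = m + 2 ≥ 2`. -/
  fun_ones : ∀ (m : ℕ) (f : SmoothFun 𝕜 U) (α : Fin (m + 2) → OneForm 𝕜 U),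
    ϱ (m + 3) (Fin.cons (ofFun f) fun i => ofOne (α i)) =
      ofOne (sgnTri (m + 2) •
        (E.gammaEval (m + 2) (dFun f) α -
          ∑ i, E.thetaTensorOne (m + 1) (dFun f) (α i) (α ∘ i.succAbove)))
  /-- `ϱ_{n+2}(f, g, α_1, …, α_n)` for `n = m + 2 ≥ 2`. -/
  fun_fun_ones : ∀ (m : ℕ) (f g : SmoothFun 𝕜 U) (α : Fin (m + 2) → OneForm 𝕜 U),
    ϱ (m + 4) (Fin.cons (ofFun f) (Fin.cons (ofFun g) fun i => ofOne (α i))) =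
      ofFun (sgnTri (m + 2) • E.thetaEval (m + 2) (dFun f) (dFun g) α)

end Brackets

end PInftyForms

end

noncomputable section

namespace PInftyForms

/-! ### Signs and permutations -/

section Signs

/-! Existence. The de Rham algebra is the supercommutative algebra of functions of the even
coordinates x^i and the odd coordinates ξ^i = dx^i, with commuting even derivations D_i (Lie
derivatives along ∂_i) and anticommuting odd derivations I_i (contractions with ∂_i). Its
multiderivations have symbols: functions of x, ξ, odd momenta x_i attached to D_i and even momenta
p_i attached to I_i. All brackets come from one Hamiltonian H = x_j g_{ji} ξ^i + ½ x_j x_k w_{jk},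
with g_{ji} = {x^j, p_i} and w_{jk} = -{x^j, x^k} read off from the inverse of ω. The coefficient of
t^N in H is homogeneous of degree N+1 in the momenta, so it is the symbol of an (N+1)-ary
multiderivation, which up to the sign (-1)^{n(n+1)/2}, n = N+1, is the n-th bracket. The derivation
property and the degree are then a matter of signs and counting (`multi_snoc_mul`,
`multi_mem_extDegree`).

Since ω is closed, its inverse satisfies the Jacobi identity (`jacobi_of_closed`); as {p_i, p_j} =
0, this supplies the three families of equations of `isFormalPoisson`, which say that H commutes
with itself for the canonical bracket. To pass from there to the homotopy Jacobi identities without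
following signs through all permutations, an odd parameter is adjoined for every argument of even
degree (`isParameterExtension_oddParam`). All arguments become odd, and on odd arguments the
brackets are symmetric (`multi_swap_odd`). The signs that appear when the parameters are pulled out
again are exactly the graded skew-symmetric ones (`multi_mul`, `pullSign_smul_prod_perm`), and the
parameters can be cancelled.

A symmetrized multilinear expression vanishes once it vanishes on the diagonal over partial sums
(`sum_perm_eq_zero_of_diagonal`). On the diagonal at an odd φ, Euler's formula turns the n-th
bracket into n! times, up to sign, the value of H on the graph x_i = D_i φ, p_i = I_i φ
(`multi_symbolZero`), and the homotopy Jacobi expression into the self-bracket of H on that graph.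
There the terms with second derivatives of φ cancel by symmetry, and what remains is the Jacobi
identity of the inverse of ω contracted with odd elements (`jacobi_contraction`,
`IsGraphChain.master`, `brackets_jacobi_diagonal`).

On functions and one-forms the multiderivations reduce to polarizations of homogeneous polynomials
in p, which is where the factors n! of the stated formulas come from (`polar_sum_symm`,
`multi_symbolZero_ones`).

Uniqueness. Multilinearity, skew-symmetry and the derivation property reduce every bracket to
generators (`IsPInfinity.eq_of_generators`). The prescribed values cover all families of generators
with at most two functions; with three or more functions the degree is negative and the bracket is
zero (`IsPInfinity.eq_zero_of_three_fun`). -/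

/-- Induction on permutations of `Fin n` by right multiplication with adjacent transpositions. -/
theorem perm_adjacent_induction {n : ℕ} {P : Equiv.Perm (Fin n) → Prop} (one : P 1)
    (step : ∀ σ (i j : Fin n), j.val = i.val + 1 → P σ → P (σ * Equiv.swap i j))
    (σ : Equiv.Perm (Fin n)) : P σ := by
  cases n with
  | zero => rwa [Subsingleton.elim σ 1]
  | succ n =>
    have h : σ ∈ Submonoid.closure
        (Set.range fun i : Fin n => Equiv.swap i.castSucc i.succ) := by
      rw [Equiv.Perm.mclosure_swap_castSucc_succ]; trivial
    induction h using Submonoid.closure_induction_right with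
    | one => exact one
    | mul_right x hx y hy ih =>
      obtain ⟨i, rfl⟩ := hy
      exact step _ _ _ (by simp) ih

theorem swap_lt_swap_iff {n : ℕ} {i j : Fin n} (hij : j.val = i.val + 1) (p q : Fin n)
    (h1 : ¬(p = i ∧ q = j)) (h2 : ¬(p = j ∧ q = i)) :
    Equiv.swap i j p < Equiv.swap i j q ↔ p < q := by
  simp only [Equiv.swap_apply_def]
  simp only [Fin.ext_iff] at h1 h2 ⊢
  split_ifs <;> simp only [Fin.lt_def] <;> omega

/-- Reindexing the double product by the transposition fixes the factor of every pair except the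
exchanged one, whose inversion status flips. As signs are their own inverses, gaining and losing
that factor are the same correction. -/
theorem koszulSign_mul_swap {n : ℕ} (a : Fin n → ℤ) (σ : Equiv.Perm (Fin n)) (i j : Fin n)
    (hij : j.val = i.val + 1) :
    koszulSign a (σ * Equiv.swap i j) =
      koszulSign a σ * (a (σ i) * a (σ j)).negOnePow := by
  have hne : i ≠ j := by rintro rfl; omega
  have hlt : i < j := by rw [Fin.lt_def]; omega
  set s := Equiv.swap i j with hs
  let u := (a (σ i) * a (σ j)).negOnePow
  have h0 : koszulSign a (σ * s) =
      ∏ p, ∏ q, if s p < s q ∧ σ q < σ p then (a (σ p) * a (σ q)).negOnePow else 1 := by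
    rw [koszulSign, ← Equiv.prod_comp s]
    refine Finset.prod_congr rfl fun p _ => ?_
    rw [← Equiv.prod_comp s]
    refine Finset.prod_congr rfl fun q _ => ?_
    simp [hs]
  -- The first correction removes the factor of (i, j) when σ inverts this pair, the second inserts
  -- it when σ does not. Exactly one of them is active, so their product over all pairs is always
  -- `u`.
  have key : ∀ p q : Fin n,
      (if s p < s q ∧ σ q < σ p then (a (σ p) * a (σ q)).negOnePow else (1 : ℤˣ)) =
      (if p < q ∧ σ q < σ p then (a (σ p) * a (σ q)).negOnePow else 1) *
        (if p = i then if q = j then (if σ j < σ i then u else 1) else 1 else 1) *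
        (if p = j then if q = i then (if σ i < σ j then u else 1) else 1 else 1) := by
    intro p q
    by_cases h1 : p = i ∧ q = j
    · obtain ⟨rfl, rfl⟩ := h1
      simp only [hs, Equiv.swap_apply_left, Equiv.swap_apply_right, hlt, not_lt_of_gt hlt,
        false_and, true_and, if_true, if_false, hne]
      split_ifs <;> simp [u]
    · by_cases h2 : p = j ∧ q = i
      · obtain ⟨rfl, rfl⟩ := h2
        simp only [hs, Equiv.swap_apply_left, Equiv.swap_apply_right, hlt, not_lt_of_gt hlt,
          false_and, true_and, if_true, if_false, hne.symm, u]
        rw [mul_comm (a (σ p))]; simp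
      · have := swap_lt_swap_iff hij p q h1 h2
        rw [← hs] at this
        simp only [this]
        have e1 : (if p = i then if q = j then (if σ j < σ i then u else 1) else 1 else 1) = 1 := by
          split_ifs <;> simp_all
        have e2 : (if p = j then if q = i then (if σ i < σ j then u else 1) else 1 else 1) = 1 := by
          split_ifs <;> simp_all
        rw [e1, e2, mul_one, mul_one]
  rw [h0]
  simp only [key, Finset.prod_mul_distrib]
  have p1 : (∏ p : Fin n, ∏ q : Fin n,
      if p = i then if q = j then (if σ j < σ i then u else 1) else 1 else 1) =
      if σ j < σ i then u else 1 := by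
    rw [Finset.prod_eq_single i] <;> simp +contextual
  have p2 : (∏ p : Fin n, ∏ q : Fin n,
      if p = j then if q = i then (if σ i < σ j then u else 1) else 1 else 1) =
      if σ i < σ j then u else 1 := by
    rw [Finset.prod_eq_single j] <;> simp +contextual
  rw [p1, p2, mul_assoc]
  congr 1
  rcases lt_or_gt_of_ne (σ.injective.ne hne) with h | h
  · simp [h, not_lt_of_gt h, u]
  · simp [h, not_lt_of_gt h, u]

theorem koszulSign_one {n : ℕ} (a : Fin n → ℤ) : koszulSign a 1 = 1 := by
  refine Finset.prod_eq_one fun i _ => Finset.prod_eq_one fun j _ => ?_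
  rw [if_neg]
  rintro ⟨h1, h2⟩
  exact lt_asymm h1 h2

/-- The symmetrization of a multilinear expression vanishes as soon as the expression vanishes
on the diagonal over all partial sums. -/
theorem sum_perm_eq_zero_of_diagonal {𝕜 V W : Type*} [CommRing 𝕜] [AddCommGroup V] [Module 𝕜 V]
    [AddCommGroup W] [Module 𝕜 W] {n : ℕ} (F : MultilinearMap 𝕜 (fun _ : Fin n => V) W)
    (w : Fin n → V) (h : ∀ S : Finset (Fin n), F (fun _ => ∑ i ∈ S, w i) = 0) :
    ∑ σ : Equiv.Perm (Fin n), F (w ∘ σ) = 0 := by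
  classical
  -- Inclusion-exclusion: the alternating sum over S of the diagonal values isolates the index maps
  -- that hit every index.
  have h1 : ∑ S : Finset (Fin n), (-1 : ℤ) ^ (Sᶜ).card • F (fun _ => ∑ i ∈ S, w i) = 0 := by
    simp [h]
  have h2 : ∀ S : Finset (Fin n), F (fun _ => ∑ i ∈ S, w i) =
      ∑ f : Fin n → Fin n, if ∀ k, f k ∈ S then F (w ∘ f) else 0 := by
    intro S
    rw [MultilinearMap.map_sum_finset F (fun _ i => w i) (fun _ => S), ← Finset.sum_filter]
    refine Finset.sum_congr ?_ fun _ _ => rfl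
    ext f; simp [Fintype.mem_piFinset]
  -- The map f contributes for all S containing its image. The alternating sum over such S vanishes
  -- unless the image is everything, that is, unless f is a permutation.
  have h3 : ∀ f : Fin n → Fin n,
      ∑ S : Finset (Fin n), (-1 : ℤ) ^ (Sᶜ).card • (if ∀ k, f k ∈ S then F (w ∘ f) else 0) =
      if Function.Bijective f then F (w ∘ f) else 0 := by
    intro f
    have e1 : ∀ S : Finset (Fin n), (∀ k, f k ∈ S) ↔ Sᶜ ⊆ (Finset.univ.image f)ᶜ := by
      intro S
      rw [Finset.compl_subset_compl]
      simp [Finset.subset_iff]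
    simp only [e1, smul_ite, smul_zero]
    rw [← Finset.sum_filter]
    have e2 : ∑ S ∈ Finset.univ.filter (fun S : Finset (Fin n) =>
          Sᶜ ⊆ (Finset.univ.image f)ᶜ), (-1 : ℤ) ^ (Sᶜ).card • F (w ∘ f) =
        ∑ S ∈ (Finset.univ.image f)ᶜ.powerset, (-1 : ℤ) ^ S.card • F (w ∘ f) := by
      refine Finset.sum_nbij' (fun S => Sᶜ) (fun S => Sᶜ) ?_ ?_ ?_ ?_ ?_ <;>
        simp only [Finset.mem_filter, Finset.mem_univ, true_and, Finset.mem_powerset, compl_compl,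
          imp_self, implies_true]
    rw [e2, ← Finset.sum_smul, Finset.sum_powerset_neg_one_pow_card]
    have e3 : (Finset.univ.image f)ᶜ = ∅ ↔ Function.Bijective f := by
      rw [Finset.compl_eq_empty_iff, ← Finite.surjective_iff_bijective, Finset.eq_univ_iff_forall]
      simp [Function.Surjective]
    by_cases hb : Function.Bijective f
    · rw [if_pos (e3.2 hb), if_pos hb, one_smul]
    · rw [if_neg (fun h => hb (e3.1 h)), if_neg hb, zero_smul]
  simp only [h2, Finset.smul_sum] at h1
  rw [Finset.sum_comm] at h1
  simp only [h3] at h1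
  rw [← Finset.sum_filter] at h1
  rw [← h1]
  symm
  refine Finset.sum_bij' (fun f hf => Equiv.ofBijective f (by simpa using hf))
    (fun σ _ => σ) ?_ ?_ ?_ ?_ ?_
  · simp
  · intro σ _
    exact Finset.mem_filter.2 ⟨Finset.mem_univ _, σ.bijective⟩
  · intros; rfl
  · intros; ext; rfl
  · intros; rfl

end Signs

end PInftyForms

end

noncomputable section

namespace PInftyForms

/-! ### Superalgebras with a differential calculus -/

/-- A supercommutative algebra with parity involution `s`, commuting even derivations `D i`,
anticommuting odd derivations `I i`, and odd elements `ξ i` dual to the `I i`. -/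
structure SuperCalculus (𝕜 : Type*) [Field 𝕜] (d : ℕ) (B : Type*) [Ring B] [Algebra 𝕜 B] where
  s : B →ₗ[𝕜] B
  D : Fin d → B →ₗ[𝕜] B
  I : Fin d → B →ₗ[𝕜] B
  ξ : Fin d → B
  s_one : s 1 = 1
  s_mul : ∀ x y, s (x * y) = s x * s y
  s_s : ∀ x, s (s x) = x
  even_comm : ∀ b x, s b = b → b * x = x * b
  odd_comm : ∀ b x, s b = -b → b * x = s x * b
  D_mul : ∀ i x y, D i (x * y) = D i x * y + x * D i y
  D_s : ∀ i x, D i (s x) = s (D i x)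
  I_mul : ∀ i x y, I i (x * y) = I i x * y + s x * I i y
  I_s : ∀ i x, I i (s x) = -s (I i x)
  D_D : ∀ i j x, D i (D j x) = D j (D i x)
  D_I : ∀ i j x, D i (I j x) = I j (D i x)
  I_I : ∀ i j x, I i (I j x) = -I j (I i x)
  s_ξ : ∀ i, s (ξ i) = -ξ i
  D_ξ : ∀ i j, D i (ξ j) = 0
  I_ξ : ∀ i j, I i (ξ j) = if i = j then 1 else 0

/-- The degree of the operator attached to an index: `D i` is even, `I i` is odd. -/
def indexDeg {d : ℕ} : Fin d ⊕ Fin d → ℕ := Sum.elim (fun _ => 0) (fun _ => 1)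

namespace SuperCalculus

variable {𝕜 : Type*} [Field 𝕜] {d : ℕ} {B : Type*} [Ring B] [Algebra 𝕜 B]
  (C : SuperCalculus 𝕜 d B)

/-- The operators `D i` and `I i` as one family. -/
def dz : Fin d ⊕ Fin d → B →ₗ[𝕜] B := Sum.elim C.D C.I

/-- The element `b` has parity `a`. -/
def Par (a : ℤ) (b : B) : Prop := C.s b = (a.negOnePow : ℤ) • b

variable {C}

theorem Par.mul {a b : ℤ} {x y : B} (hx : C.Par a x) (hy : C.Par b y) : C.Par (a + b) (x * y) := by
  unfold Par at *
  rw [C.s_mul, hx, hy, Int.negOnePow_add, smul_mul_smul_comm]; simp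

theorem Par.add {a : ℤ} {x y : B} (hx : C.Par a x) (hy : C.Par a y) : C.Par a (x + y) := by
  unfold Par at *
  rw [map_add, hx, hy, smul_add]

theorem Par.zsmul {a : ℤ} {x : B} (hx : C.Par a x) (n : ℤ) : C.Par a (n • x) := by
  unfold Par at *
  rw [map_zsmul, hx, smul_comm]

theorem Par.sum {a : ℤ} {ι : Type*} {t : Finset ι} {f : ι → B} (h : ∀ i ∈ t, C.Par a (f i)) :
    C.Par a (∑ i ∈ t, f i) := by
  unfold Par at *
  rw [map_sum, Finset.smul_sum, Finset.sum_congr rfl h]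

theorem Par.zero (a : ℤ) : C.Par a 0 := by simp [Par]

theorem Par.one : C.Par 0 1 := by simp [Par, C.s_one]

theorem Par.congr {a b : ℤ} {x : B} (hx : C.Par a x) (h : Even (a - b)) : C.Par b x := by
  unfold Par at *
  have : a.negOnePow = b.negOnePow := (Int.negOnePow_eq_iff a b).2 h
  rw [hx, this]

theorem Par.s {a : ℤ} {x : B} (hx : C.Par a x) : C.Par a (C.s x) := by
  have h := hx.zsmul a.negOnePow
  unfold Par at hx h ⊢
  rw [hx]; exact h

theorem par_even {x : B} : C.Par 0 x ↔ C.s x = x := by simp [Par]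

theorem par_odd {x : B} : C.Par 1 x ↔ C.s x = -x := by simp [Par]

theorem Par.D {a : ℤ} {x : B} (hx : C.Par a x) (i : Fin d) : C.Par a (C.D i x) := by
  unfold Par at *
  rw [← C.D_s, hx, map_zsmul]

theorem Par.I {a : ℤ} {x : B} (hx : C.Par a x) (i : Fin d) : C.Par (a + 1) (C.I i x) := by
  unfold Par at *
  have := C.I_s i x
  rw [hx, map_zsmul] at this
  rw [Int.negOnePow_add]
  simp [this]

theorem Par.dz {a : ℤ} {x : B} (hx : C.Par a x) (z : Fin d ⊕ Fin d) :
    C.Par (a + indexDeg z) (C.dz z x) := by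
  rcases z with i | i
  · simpa [indexDeg, SuperCalculus.dz] using hx.D i
  · simpa [indexDeg, SuperCalculus.dz] using hx.I i

/-- Homogeneous elements supercommute. -/
theorem Par.comm {a b : ℤ} {x y : B} (hx : C.Par a x) (hy : C.Par b y) :
    x * y = ((a * b).negOnePow : ℤ) • (y * x) := by
  rcases Int.even_or_odd a with ha | ha
  · have : C.s x = x := by rw [← par_even]; exact hx.congr (by simpa using ha)
    rw [C.even_comm x y this, Int.negOnePow_even _ (ha.mul_right b)]; simp
  · have : C.s x = -x := by
      rw [← par_odd]; refine hx.congr ?_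
      exact Odd.sub_odd ha odd_one
    rw [C.odd_comm x y this, hy, smul_mul_assoc]
    congr 2
    rw [Int.negOnePow_eq_iff]
    have : b - a * b = (1 - a) * b := by ring
    rw [this]
    exact (Odd.sub_odd odd_one ha).mul_right b

theorem Par.dz_mul {a : ℤ} {x : B} (hx : C.Par a x) (z : Fin d ⊕ Fin d) (y : B) :
    C.dz z (x * y) = C.dz z x * y + ((a * indexDeg z).negOnePow : ℤ) • (x * C.dz z y) := by
  rcases z with i | i
  · simp [SuperCalculus.dz, indexDeg, C.D_mul]
  · simp only [SuperCalculus.dz, indexDeg, Sum.elim_inr, C.I_mul]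
    rw [hx, smul_mul_assoc]; simp

variable (C)

/-- The twist `(-s)^c`. -/
def tw (c : ℕ) : B →ₗ[𝕜] B := (-C.s : Module.End 𝕜 B) ^ c

theorem tw_zero (x : B) : C.tw 0 x = x := by simp [tw]

theorem tw_succ (c : ℕ) (x : B) : C.tw (c + 1) x = -C.s (C.tw c x) := by
  simp [tw, pow_succ']

variable {C}

/-- The operator -s is the sign of the shifted degree a + 1. It is trivial on odd elements, so the
twists disappear whenever all arguments are odd. -/
theorem Par.tw_eq {a : ℤ} {x : B} (hx : C.Par a x) (c : ℕ) :
    C.tw c x = ((c * (a + 1)).negOnePow : ℤ) • x := by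
  induction c with
  | zero => simp [tw_zero]
  | succ c ih =>
    rw [tw_succ, ih, map_zsmul, hx]
    have : ((c + 1 : ℕ) : ℤ) * (a + 1) = c * (a + 1) + a + 1 := by push_cast; ring
    rw [this, Int.negOnePow_succ, Int.negOnePow_add, Units.val_neg, Units.val_mul, neg_smul,
      mul_smul]

theorem Par.tw {a : ℤ} {x : B} (hx : C.Par a x) (c : ℕ) : C.Par a (C.tw c x) := by
  rw [hx.tw_eq]; exact hx.zsmul _

theorem tw_even (c : ℕ) (hc : Even c) (x : B) : C.tw c x = x := by
  obtain ⟨k, rfl⟩ := hc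
  induction k with
  | zero => exact tw_zero C x
  | succ k ih =>
    rw [show k + 1 + (k + 1) = (k + k) + 1 + 1 by ring, tw_succ, tw_succ, ih]
    simp [C.s_s]

theorem tw_odd (c : ℕ) (hc : Odd c) (x : B) : C.tw c x = -C.s x := by
  obtain ⟨k, rfl⟩ := hc
  rw [tw_succ, tw_even _ (even_two_mul k)]

/-- Ordered products of homogeneous elements change by the Koszul sign under an adjacent swap. -/
theorem prod_ofFn_swap {n : ℕ} {a : Fin n → ℤ} {x : Fin n → B} (hx : ∀ i, C.Par (a i) (x i))
    (i j : Fin n) (hij : j.val = i.val + 1) :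
    (List.ofFn (x ∘ Equiv.swap i j)).prod =
      ((a i * a j).negOnePow : ℤ) • (List.ofFn x).prod := by
  induction n with
  | zero => exact i.elim0
  | succ n ih =>
    rcases Fin.eq_zero_or_eq_succ i with rfl | ⟨i', rfl⟩
    · obtain ⟨m, rfl⟩ : ∃ m, n = m + 1 := ⟨n - 1, by have := j.2; simp at hij; omega⟩
      obtain rfl : j = Fin.succ 0 := by ext; simpa using hij
      have h2 : ∀ k : Fin m, Equiv.swap (0 : Fin (m + 2)) (Fin.succ 0) k.succ.succ = k.succ.succ :=
        fun k => Equiv.swap_apply_of_ne_of_ne (Fin.succ_ne_zero _)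
          (by simp [Fin.ext_iff])
      simp only [List.ofFn_succ, List.prod_cons, Function.comp_apply, h2, Equiv.swap_apply_left,
        Equiv.swap_apply_right]
      rw [← mul_assoc, ← mul_assoc, (hx (Fin.succ 0)).comm (hx 0), smul_mul_assoc, mul_comm (a _)]
    · obtain ⟨j', rfl⟩ : ∃ j', j = Fin.succ j' := ⟨j.pred (by rintro rfl; simp at hij),
        (Fin.succ_pred _ _).symm⟩
      have e : ∀ k : Fin n, Equiv.swap i'.succ j'.succ k.succ = (Equiv.swap i' j' k).succ := by
        intro k
        simp only [Equiv.swap_apply_def, Fin.succ_inj]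
        split_ifs <;> rfl
      have e0 : Equiv.swap i'.succ j'.succ 0 = 0 :=
        Equiv.swap_apply_of_ne_of_ne (Fin.succ_ne_zero _).symm (Fin.succ_ne_zero _).symm
      have := ih (a := a ∘ Fin.succ) (x := x ∘ Fin.succ) (fun k => hx _) i' j'
        (by simpa using hij)
      simp only [List.ofFn_succ, List.prod_cons, Function.comp_apply, e, e0]
      simp only [Function.comp_def] at this
      rw [this, mul_smul_comm]

theorem par_prod_ofFn {n : ℕ} {a : Fin n → ℤ} {x : Fin n → B} (hx : ∀ i, C.Par (a i) (x i)) :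
    C.Par (∑ i, a i) (List.ofFn x).prod := by
  induction n with
  | zero => simpa using Par.one
  | succ n ih =>
    rw [List.ofFn_succ, List.prod_cons, Fin.sum_univ_succ]
    exact (hx 0).mul (ih fun i => hx i.succ)

/-! ### Multiderivations from their symbols -/

variable (C)

/-- The multiderivation with symbol `h`: a sum over all assignments of the operators `D i`, `I i`
to the slots, with the values of `h` as coefficients. -/
def multi : (n : ℕ) → ℕ → (List (Fin d ⊕ Fin d) → B) → MultilinearMap 𝕜 (fun _ : Fin n => B) B
  | 0, _, h => MultilinearMap.constOfIsEmpty 𝕜 _ (h [])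
  | n + 1, c, h => LinearMap.uncurryLeft
      { toFun := fun b => ∑ z, (LinearMap.mulLeft 𝕜 (C.dz z (C.tw (c + indexDeg z) b))).compMultilinearMap
          (multi n (c + indexDeg z) fun l => h (z :: l))
        map_add' := fun x y => by
          ext v; simp [-Fintype.sum_sum_type, Finset.sum_add_distrib, add_mul]
        map_smul' := fun r x => by
          ext v; simp [-Fintype.sum_sum_type, Finset.smul_sum] }

theorem multi_zero (c : ℕ) (h : List (Fin d ⊕ Fin d) → B) (v : Fin 0 → B) :
    C.multi 0 c h v = h [] := rfl

theorem multi_succ (n c : ℕ) (h : List (Fin d ⊕ Fin d) → B) (v : Fin (n + 1) → B) :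
    C.multi (n + 1) c h v = ∑ z, C.dz z (C.tw (c + indexDeg z) (v 0)) *
      C.multi n (c + indexDeg z) (fun l => h (z :: l)) (Fin.tail v) := by
  simp [-Fintype.sum_sum_type, multi]

/-- The number of even indices in a list. -/
def evenCount (l : List (Fin d ⊕ Fin d)) : ℕ := (l.map fun z => 1 - indexDeg z).sum

theorem multi_add (n c : ℕ) (h h' : List (Fin d ⊕ Fin d) → B) (v : Fin n → B) :
    C.multi n c (fun l => h l + h' l) v = C.multi n c h v + C.multi n c h' v := by
  induction n generalizing c h h' with
  | zero => rfl
  | succ n ih => simp [-Fintype.sum_sum_type, multi_succ, ih, mul_add, Finset.sum_add_distrib]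

variable {C}

/-- Every slot contributes one unit of parity whichever operator it receives: an odd index through
the operator, an even index through the coefficient. -/
theorem par_multi {n : ℕ} (c : ℕ) (h : List (Fin d ⊕ Fin d) → B) (u : ℤ)
    (hh : ∀ l, l.length = n → C.Par (u + evenCount l) (h l)) {b : Fin n → ℤ} {v : Fin n → B}
    (hv : ∀ i, C.Par (b i) (v i)) : C.Par (u + n + ∑ i, b i) (C.multi n c h v) := by
  induction n generalizing c h u with
  | zero => simpa [multi_zero, evenCount] using hh [] rfl
  | succ n ih =>
    rw [multi_succ]
    refine Par.sum fun z _ => ?_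
    have h1 := ((hv 0).tw (c + indexDeg z)).dz z
    have h2 := ih (c + indexDeg z) (fun l => h (z :: l)) (u + (1 - indexDeg z : ℕ))
      (fun l hl => (hh (z :: l) (by simp [hl])).congr (by simp [evenCount]; ring_nf; simp))
      (b := fun i => b i.succ) (v := Fin.tail v) (fun i => hv i.succ)
    refine (h1.mul h2).congr ?_
    rw [Fin.sum_univ_succ]
    rcases z with z | z <;> simp [indexDeg] <;> ring_nf <;> simp

/-- The sign of pulling homogeneous coefficients out of the slots of a multiderivation. -/
def pullSign {n : ℕ} (c : ℤ) (e b : Fin n → ℤ) : ℤˣ :=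
  ∏ i, (e i * (c + ∑ r, if r < i then b r else 0)).negOnePow

theorem pullSign_succ {n : ℕ} (c : ℤ) (e b : Fin (n + 1) → ℤ) :
    pullSign c e b = (e 0 * c).negOnePow * pullSign (c + b 0) (Fin.tail e) (Fin.tail b) := by
  simp only [pullSign, Fin.prod_univ_succ, Fin.sum_univ_succ, Fin.tail]
  simp [add_assoc]

theorem pullSign_add {n : ℕ} (c c' : ℤ) (e b : Fin n → ℤ) :
    pullSign (c + c') e b = ((∑ i, e i) * c').negOnePow * pullSign c e b := by
  induction n generalizing c with
  | zero => simp [pullSign]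
  | succ n ih =>
    rw [pullSign_succ, pullSign_succ, add_right_comm, ih, Fin.sum_univ_succ, mul_add, add_mul,
      Int.negOnePow_add, Int.negOnePow_add]
    simp only [Fin.tail]
    ac_rfl

/-- The twists are designed so that the resulting sign depends on degrees only and not on the
assignment of operators to slots; hence it factors out of the whole sum. -/
theorem multi_mul {n : ℕ} (c : ℕ) (h : List (Fin d ⊕ Fin d) → B) {e b : Fin n → ℤ}
    {ε v : Fin n → B} (hε : ∀ i, C.Par (e i) (ε i)) (hdε : ∀ i z, C.dz z (ε i) = 0)
    (hv : ∀ i, C.Par (b i) (v i)) :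
    C.multi n c h (ε * v) = (pullSign c e b : ℤ) • ((List.ofFn ε).prod * C.multi n c h v) := by
  induction n generalizing c h with
  | zero => simp [multi_zero, pullSign]
  | succ n ih =>
    rw [multi_succ, multi_succ, Finset.mul_sum, Finset.smul_sum]
    refine Finset.sum_congr rfl fun z _ => ?_
    have h0 := ih (c + indexDeg z) (fun l => h (z :: l)) (e := Fin.tail e) (b := Fin.tail b)
      (ε := Fin.tail ε) (v := Fin.tail v) (fun i => hε _) (fun i => hdε _) (fun i => hv _)
    have ht : Fin.tail (ε * v) = Fin.tail ε * Fin.tail v := rfl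
    -- The twist costs e₀(c + deg z) and the passage of the operator across `ε 0` costs e₀ · deg z.
    -- Their sum is e₀ · c modulo 2, free of z.
    have h1 : C.dz z (C.tw (c + indexDeg z) ((ε * v) 0)) =
        ((e 0 * c).negOnePow : ℤ) • (ε 0 * C.dz z (C.tw (c + indexDeg z) (v 0))) := by
      rw [Pi.mul_apply, ((hε 0).mul (hv 0)).tw_eq, (hv 0).tw_eq, map_zsmul, map_zsmul,
        (hε 0).dz_mul, hdε, zero_mul, zero_add, smul_smul, mul_smul_comm, smul_smul,
        ← Units.val_mul, ← Units.val_mul, ← Int.negOnePow_add, ← Int.negOnePow_add]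
      congr 2
      rw [Int.negOnePow_eq_iff]
      push_cast
      ring_nf
      simp
    rw [ht, h0, h1, List.ofFn_succ, List.prod_cons]
    -- The later constants pass a factor of parity b₀ + deg z. The part deg z cancels against the
    -- shift of the counter in the inductive hypothesis.
    have h2 := (((hv 0).tw (c + indexDeg z)).dz z).comm
      (par_prod_ofFn (x := Fin.tail ε) (fun i => hε i.succ))
    simp only [smul_mul_assoc, mul_smul_comm, mul_assoc]
    rw [← mul_assoc (C.dz z _), h2]
    simp only [smul_mul_assoc, mul_smul_comm, mul_assoc, smul_smul]
    rw [pullSign_succ]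
    congr 1
    rw [show ((c + indexDeg z : ℕ) : ℤ) = c + indexDeg z by push_cast; rfl, pullSign_add,
      pullSign_add (c : ℤ) (b 0), ← Units.val_mul, ← Units.val_mul, add_mul, Int.negOnePow_add,
      mul_comm (b 0), mul_comm (indexDeg z : ℤ)]
    congr 1
    have := Int.units_mul_self ((∑ i, Fin.tail e i) * (indexDeg z : ℤ)).negOnePow
    set A := ((∑ i, Fin.tail e i) * (indexDeg z : ℤ)).negOnePow
    change A * _ * (_ * (((∑ i, Fin.tail e i) * b 0).negOnePow * A)) = _
    set P := pullSign (c : ℤ) (Fin.tail e) (Fin.tail b)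
    set X := ((∑ i, Fin.tail e i) * b 0).negOnePow
    set Y := (e 0 * (c : ℤ)).negOnePow
    calc A * P * (Y * (X * A)) = A * A * (Y * (X * P)) := by ac_rfl
      _ = _ := by rw [this, one_mul]

end SuperCalculus

end PInftyForms

end

noncomputable section

namespace PInftyForms

namespace SuperCalculus

variable {𝕜 : Type*} [Field 𝕜] {d : ℕ} {B : Type*} [Ring B] [Algebra 𝕜 B]
  {C : SuperCalculus 𝕜 d B}

/-! ### Symmetry and derivation property of multiderivations -/

theorem comp_swap_zero_tail {X : Type*} {n : ℕ} (x : Fin (n + 2) → X) :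
    (x ∘ Equiv.swap 0 1) 0 = x 1 ∧ Fin.tail (x ∘ Equiv.swap 0 1) 0 = x 0 ∧
      Fin.tail (Fin.tail (x ∘ Equiv.swap 0 1)) = Fin.tail (Fin.tail x) := by
  refine ⟨by simp, by simp [Fin.tail], ?_⟩
  ext k
  simp only [Fin.tail, Function.comp_apply]
  rw [Equiv.swap_apply_of_ne_of_ne (Fin.succ_ne_zero _) (by simp [Fin.ext_iff])]

theorem comp_swap_succ_tail {X : Type*} {n : ℕ} (x : Fin (n + 1) → X) (i j : Fin n) :
    (x ∘ Equiv.swap i.succ j.succ) 0 = x 0 ∧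
      Fin.tail (x ∘ Equiv.swap i.succ j.succ) = Fin.tail x ∘ Equiv.swap i j := by
  refine ⟨?_, ?_⟩
  · rw [Function.comp_apply, Equiv.swap_apply_of_ne_of_ne (Fin.succ_ne_zero _).symm
      (Fin.succ_ne_zero _).symm]
  · ext k
    simp only [Fin.tail, Function.comp_apply, Equiv.swap_apply_def, Fin.succ_inj]
    split_ifs <;> rfl

/-- Case distinction on the position of an adjacent pair of indices. -/
theorem adjacent_cases {n : ℕ} {P : (n : ℕ) → Fin n → Fin n → Prop}
    (zero : ∀ n, P (n + 2) 0 1) (succ : ∀ n i j, P n i j → P (n + 1) i.succ j.succ)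
    (i j : Fin n) (hij : j.val = i.val + 1) : P n i j := by
  induction n with
  | zero => exact i.elim0
  | succ n ih =>
    rcases Fin.eq_zero_or_eq_succ i with rfl | ⟨i', rfl⟩
    · obtain ⟨m, rfl⟩ : ∃ m, n = m + 1 := ⟨n - 1, by have := j.2; simp at hij; omega⟩
      obtain rfl : j = 1 := by ext; simpa using hij
      exact zero m
    · obtain ⟨j', rfl⟩ : ∃ j', j = Fin.succ j' := ⟨j.pred (by rintro rfl; simp at hij),
        (Fin.succ_pred _ _).symm⟩
      exact succ n i' j' (ih _ _ (by simpa using hij))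

/-- A symbol is graded symmetric. -/
def SymbolSymm (h : List (Fin d ⊕ Fin d) → B) : Prop :=
  ∀ l z w l', h (l ++ z :: w :: l') =
    (((1 + indexDeg z : ℤ) * (1 + indexDeg w)).negOnePow : ℤ) • h (l ++ w :: z :: l')

theorem SymbolSymm.cons {h : List (Fin d ⊕ Fin d) → B} (hh : SymbolSymm h) (z : Fin d ⊕ Fin d) :
    SymbolSymm fun l => h (z :: l) := fun l a b l' => hh (z :: l) a b l'

theorem multi_zsmul (n c : ℕ) (h : List (Fin d ⊕ Fin d) → B) (r : ℤ) (v : Fin n → B) :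
    C.multi n c (fun l => r • h l) v = r • C.multi n c h v := by
  induction n generalizing c h with
  | zero => rfl
  | succ n ih => simp only [multi_succ, ih, mul_smul_comm, Finset.smul_sum]

theorem tw_of_odd {x : B} (hx : C.Par 1 x) (c : ℕ) : C.tw c x = x := by
  rw [hx.tw_eq, Int.negOnePow_even]
  · simp
  · exact ⟨c, by ring⟩

theorem multi_odd_succ {n c : ℕ} {h : List (Fin d ⊕ Fin d) → B} {v : Fin (n + 1) → B}
    (hv : C.Par 1 (v 0)) : C.multi (n + 1) c h v =
      ∑ z, C.dz z (v 0) * C.multi n (c + indexDeg z) (fun l => h (z :: l)) (Fin.tail v) := by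
  simp only [multi_succ, tw_of_odd hv]

theorem multi_odd_indep {n : ℕ} (c c' : ℕ) (h : List (Fin d ⊕ Fin d) → B) {v : Fin n → B}
    (hv : ∀ i, C.Par 1 (v i)) : C.multi n c h v = C.multi n c' h v := by
  induction n generalizing c c' h with
  | zero => rfl
  | succ n ih =>
    rw [multi_odd_succ (hv 0), multi_odd_succ (hv 0)]
    exact Finset.sum_congr rfl fun z _ => by
      rw [ih _ _ _ (v := Fin.tail v) fun i => hv i.succ]

/-- On odd arguments the factor produced by an index z has parity 1 + deg z, the very degree for
which the symbol is graded symmetric. The sign from exchanging two factors therefore cancels the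
sign from exchanging two indices. -/
theorem multi_swap_odd {n : ℕ} (i j : Fin n) (hij : j.val = i.val + 1) (c : ℕ)
    (h : List (Fin d ⊕ Fin d) → B) (hh : SymbolSymm h) (v : Fin n → B)
    (hv : ∀ i, C.Par 1 (v i)) :
    C.multi n c h (v ∘ Equiv.swap i j) = C.multi n c h v := by
  revert c h v
  refine adjacent_cases (P := fun n i j => ∀ (c : ℕ) (h : List (Fin d ⊕ Fin d) → B),
    SymbolSymm h → ∀ v : Fin n → B, (∀ i, C.Par 1 (v i)) →
    C.multi n c h (v ∘ Equiv.swap i j) = C.multi n c h v) ?_ ?_ i j hij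
  · intro n c h hh v hv
    obtain ⟨e0, e1, e2⟩ := comp_swap_zero_tail v
    have hv' : ∀ i, C.Par 1 ((v ∘ Equiv.swap 0 1) i) := fun i => hv _
    have ht : ∀ i, C.Par 1 (Fin.tail (Fin.tail v) i) := fun i => hv _
    rw [multi_odd_succ (hv' 0), multi_odd_succ (hv 0)]
    simp only [multi_odd_succ (v := Fin.tail (v ∘ Equiv.swap 0 1)) (hv' 1),
      multi_odd_succ (v := Fin.tail v) (hv 1), e0, e1, e2, Finset.mul_sum]
    rw [Finset.sum_comm]
    refine Finset.sum_congr rfl fun z _ => Finset.sum_congr rfl fun w _ => ?_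
    have h1 := ((hv 1).dz w).comm ((hv 0).dz z)
    have h2 : (fun l => h (w :: z :: l)) =
        fun l => (((1 + indexDeg w : ℤ) * (1 + indexDeg z)).negOnePow : ℤ) • h (z :: w :: l) :=
      funext fun l => hh [] w z l
    rw [h2, multi_zsmul, ← mul_assoc, h1, smul_mul_smul_comm, ← Units.val_mul,
      Int.units_mul_self, Units.val_one, one_smul, mul_assoc, multi_odd_indep _ _ _ ht]
    rfl
  · intro n i j ih c h hh v hv
    obtain ⟨e0, e1⟩ := comp_swap_succ_tail v i j
    rw [multi_succ, multi_succ, e0, e1]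
    exact Finset.sum_congr rfl fun z _ => by
      rw [ih _ _ (hh.cons z) (Fin.tail v) fun i => hv i.succ]

/-- This is the décalage sign: the exponents e₀a₁ + e₁a₀ + e₀e₁ add up to 1 + a₀a₁ modulo 2 once
each e is a + 1. -/
theorem pullSign_comp_swap {n : ℕ} (i j : Fin n) (hij : j.val = i.val + 1) (c : ℤ)
    (a e : Fin n → ℤ) (he : ∀ i, e i = a i + 1) :
    pullSign c (e ∘ Equiv.swap i j) (a ∘ Equiv.swap i j) * (e i * e j).negOnePow =
      -(a i * a j).negOnePow * pullSign c e a := by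
  revert c a e
  refine adjacent_cases (P := fun n i j => ∀ (c : ℤ) (a e : Fin n → ℤ),
    (∀ i, e i = a i + 1) →
    pullSign c (e ∘ Equiv.swap i j) (a ∘ Equiv.swap i j) * (e i * e j).negOnePow =
      -(a i * a j).negOnePow * pullSign c e a) ?_ ?_ i j hij
  · intro n c a e he
    obtain ⟨e0, e1, e2⟩ := comp_swap_zero_tail e
    obtain ⟨a0, a1, a2⟩ := comp_swap_zero_tail a
    simp only [pullSign_succ, e0, e1, e2, a0, a1, a2]
    have h1 : Fin.tail e 0 = e 1 := rfl
    have h2 : Fin.tail a 0 = a 1 := rfl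
    rw [h1, h2, add_right_comm c (a 1) (a 0)]
    set P := pullSign (c + a 0 + a 1) (Fin.tail (Fin.tail e)) (Fin.tail (Fin.tail a))
    have key : (e 1 * c).negOnePow * (e 0 * (c + a 1)).negOnePow * (e 0 * e 1).negOnePow =
        -(a 0 * a 1).negOnePow * (e 0 * c).negOnePow * (e 1 * (c + a 0)).negOnePow := by
      rw [← Int.negOnePow_succ, ← Int.negOnePow_add, ← Int.negOnePow_add, ← Int.negOnePow_add,
        ← Int.negOnePow_add, Int.negOnePow_eq_iff, he, he]
      ring_nf
      simp
    calc _ = (e 1 * c).negOnePow * (e 0 * (c + a 1)).negOnePow * (e 0 * e 1).negOnePow * P := by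
          ac_rfl
      _ = _ := by rw [key]; simp only [mul_assoc]
  · intro n i j ih c a e he
    obtain ⟨e0, e1⟩ := comp_swap_succ_tail e i j
    obtain ⟨a0, a1⟩ := comp_swap_succ_tail a i j
    rw [pullSign_succ, pullSign_succ, e0, e1, a0, a1, mul_assoc]
    have := ih (c + a 0) (Fin.tail a) (Fin.tail e) fun i => he i.succ
    change _ * (_ * (Fin.tail e i * Fin.tail e j).negOnePow) = _
    rw [this]
    change _ = -(Fin.tail a i * Fin.tail a j).negOnePow * _
    ac_rfl

theorem pullSign_append {p q : ℕ} (c : ℤ) (e b : Fin (p + q) → ℤ) :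
    pullSign c e b = pullSign c (fun i => e (Fin.castAdd q i)) (fun i => b (Fin.castAdd q i)) *
      pullSign (c + ∑ i, b (Fin.castAdd q i)) (fun i => e (Fin.natAdd p i))
        (fun i => b (Fin.natAdd p i)) := by
  simp only [pullSign, Fin.prod_univ_add, Fin.sum_univ_add]
  congr 1
  · refine Finset.prod_congr rfl fun i _ => ?_
    have : ∀ r : Fin q, ¬ (Fin.natAdd p r < Fin.castAdd q i) := fun r => by
      rw [Fin.lt_def]; simp; omega
    have h2 : ∀ r : Fin p, Fin.castAdd q r < Fin.castAdd q i ↔ r < i := fun r => Iff.rfl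
    simp [this, h2]
  · refine Finset.prod_congr rfl fun i _ => ?_
    have : ∀ r : Fin p, Fin.castAdd q r < Fin.natAdd p i := fun r => by
      rw [Fin.lt_def]; simp; omega
    simp [this, add_assoc]

/-- The sign produced by a composition of two brackets does not depend on how the arguments
are distributed. -/
theorem pullSign_nested {p q : ℕ} (e b : Fin (p + q) → ℤ) :
    pullSign ((p + q + 1 : ℕ) : ℤ) e b =
      pullSign (p : ℤ) (fun i => e (Fin.castAdd q i)) (fun i => b (Fin.castAdd q i)) *
      pullSign ((q + 1 : ℕ) : ℤ)
        (Fin.cons (∑ i, e (Fin.castAdd q i)) fun i => e (Fin.natAdd p i))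
        (Fin.cons (p + ∑ i, b (Fin.castAdd q i)) fun i => b (Fin.natAdd p i)) := by
  rw [pullSign_append, pullSign_succ (n := q)]
  simp only [Fin.cons_zero, Fin.tail_cons]
  -- The inner bracket starts its counter at p and the outer one at q + 1; the splitting of p + q +
  -- 1 matches the two contributions.
  rw [show ((p + q + 1 : ℕ) : ℤ) = p + (q + 1 : ℕ) by push_cast; ring, pullSign_add]
  rw [show (p : ℤ) + ((q + 1 : ℕ) : ℤ) + ∑ i, b (Fin.castAdd q i) =
    ((q + 1 : ℕ) : ℤ) + (p + ∑ i, b (Fin.castAdd q i)) by ring]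
  ac_rfl

/-- Reordering homogeneous coefficients whose degrees are shifted by one produces the graded
skew-symmetric sign. -/
theorem pullSign_smul_prod_perm {n : ℕ} (c : ℤ) (a e : Fin n → ℤ) (he : ∀ i, e i = a i + 1)
    (ε : Fin n → B) (hε : ∀ i, C.Par (e i) (ε i)) (σ : Equiv.Perm (Fin n)) :
    (pullSign c (e ∘ σ) (a ∘ σ) : ℤ) • (List.ofFn (ε ∘ σ)).prod =
      ((Equiv.Perm.sign σ * koszulSign a σ : ℤˣ) : ℤ) •
        (pullSign c e a : ℤ) • (List.ofFn ε).prod := by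
  induction σ using perm_adjacent_induction with
  | one => simp [koszulSign_one]
  | step σ i j hij ih =>
    have hne : i ≠ j := by rintro rfl; omega
    have h1 := prod_ofFn_swap (C := C) (a := e ∘ σ) (x := ε ∘ σ) (fun k => hε _) i j hij
    have h2 := pullSign_comp_swap i j hij c (a ∘ σ) (e ∘ σ) (fun k => he _)
    rw [Equiv.Perm.coe_mul, ← Function.comp_assoc, ← Function.comp_assoc, ← Function.comp_assoc,
      h1, smul_smul, ← Units.val_mul, h2, Units.val_mul, mul_smul, ih, smul_smul,
      ← Units.val_mul, koszulSign_mul_swap a σ i j hij, Equiv.Perm.sign_mul,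
      Equiv.Perm.sign_swap hne]
    congr 2
    simp only [Function.comp_apply]
    rw [neg_mul, mul_neg, mul_one, neg_mul]
    congr 1
    ac_rfl

/-- In the last slot the twist has the parity of the coefficient standing to its right; this is what
`hc` arranges. It supplies exactly the sign needed to move the right factor of the product past the
coefficient. The earlier slots only contribute the sign of moving b to the front. -/
theorem multi_snoc_mul {n : ℕ} (c : ℕ) (h : List (Fin d ⊕ Fin d) → B) (u : ℤ)
    (hh : ∀ l, l.length = n + 1 → C.Par (u + evenCount l) (h l))
    (hc : Even ((c : ℤ) - (u + n + 1))) {a : Fin n → ℤ} {v : Fin n → B}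
    (hv : ∀ i, C.Par (a i) (v i)) {p : ℤ} {b : B} (hb : C.Par p b) (x : B) :
    C.multi (n + 1) c h (Fin.snoc v (b * x)) = C.multi (n + 1) c h (Fin.snoc v b) * x +
      ((p * (u + n + 1 + ∑ i, a i)).negOnePow : ℤ) •
        (b * C.multi (n + 1) c h (Fin.snoc v x)) := by
  induction n generalizing c h u with
  | zero =>
    have e : ∀ y : B, (Fin.snoc v y : Fin 1 → B) 0 = y := fun y => by simp [Fin.snoc]
    simp only [multi_succ, e, multi_zero, Finset.mul_sum, Finset.sum_mul, Finset.smul_sum,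
      ← Finset.sum_add_distrib]
    refine Finset.sum_congr rfl fun z _ => ?_
    have hz := hh [z] rfl
    -- An even twist goes with an even, hence central, coefficient; an odd twist with an odd
    -- coefficient, where the extra s is absorbed by `odd_comm`.
    rcases Nat.even_or_odd (c + indexDeg z) with hq | hq
    · have hq' : Even ((c : ℤ) + indexDeg z) := by exact_mod_cast hq
      have h1 : C.s (h [z]) = h [z] := by
        rw [← par_even]
        refine hz.congr ?_
        have : u + (evenCount [z] : ℤ) - 0 = (c + indexDeg z) - (c - (u + (0 : ℕ) + 1)) -
            2 * indexDeg z := by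
          rcases z with z | z <;> simp [evenCount, indexDeg] <;> ring
        rw [this]
        exact (hq'.sub hc).sub (even_two_mul _)
      rw [tw_even _ hq, tw_even _ hq, tw_even _ hq, hb.dz_mul, add_mul, mul_assoc, mul_assoc,
        C.even_comm _ _ h1, smul_mul_assoc, mul_assoc]
      congr 3
      rw [Int.negOnePow_eq_iff]
      have : p * indexDeg z - p * (u + (0 : ℕ) + 1 + ∑ i, a i) =
        p * ((c - (u + (0 : ℕ) + 1)) - (c + indexDeg z) + 2 * indexDeg z) := by
        simp; ring
      rw [this]
      exact ((hc.sub hq').add (even_two_mul _)).mul_left p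
    · have hq' : Odd ((c : ℤ) + indexDeg z) := by exact_mod_cast hq
      have h1 : C.s (h [z]) = -h [z] := by
        rw [← par_odd]
        refine hz.congr ?_
        have : u + (evenCount [z] : ℤ) - 1 = (c + indexDeg z) - 1 - (c - (u + (0 : ℕ) + 1)) -
            2 * indexDeg z := by
          rcases z with z | z <;> simp [evenCount, indexDeg] <;> ring
        rw [this]
        exact ((hq'.sub_odd odd_one).sub hc).sub (even_two_mul _)
      rw [tw_odd _ hq, tw_odd _ hq, tw_odd _ hq, C.s_mul, map_neg, map_neg, map_neg, hb.s.dz_mul,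
        neg_mul, add_mul, mul_assoc, mul_assoc, ← C.odd_comm _ x h1, neg_add, neg_mul,
        neg_mul, smul_mul_assoc, mul_neg, smul_neg]
      congr 2
      have hsb : C.s b = (p.negOnePow : ℤ) • b := hb
      rw [mul_assoc, hsb, smul_mul_assoc, smul_smul, ← Units.val_mul, ← Int.negOnePow_add]
      congr 2
      rw [Int.negOnePow_eq_iff]
      have : p * indexDeg z + p - p * (u + (0 : ℕ) + 1 + ∑ i, a i) =
        p * ((c - (u + (0 : ℕ) + 1)) - ((c + indexDeg z) - 1) + 2 * indexDeg z) := by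
        simp; ring
      rw [this]
      exact ((hc.sub (hq'.sub_odd odd_one)).add (even_two_mul _)).mul_left p
  | succ n ih =>
    have e0 : ∀ y : B, (Fin.snoc v y : Fin (n + 2) → B) 0 = v 0 := fun y => by
      rw [← Fin.castSucc_zero, Fin.snoc_castSucc]
    have e1 : ∀ y : B, Fin.tail (Fin.snoc v y : Fin (n + 2) → B) = Fin.snoc (Fin.tail v) y := by
      intro y
      conv_lhs => rw [← Fin.cons_self_tail v]
      rw [← Fin.cons_snoc_eq_snoc_cons, Fin.tail_cons]
    simp only [multi_succ C (n + 1), e0, e1, Finset.mul_sum, Finset.sum_mul, Finset.smul_sum,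
      ← Finset.sum_add_distrib]
    refine Finset.sum_congr rfl fun z _ => ?_
    have hz := ih (c + indexDeg z) (fun l => h (z :: l)) (u + (1 - indexDeg z : ℕ))
      (fun l hl => (hh (z :: l) (by simp [hl])).congr (by simp [evenCount]; ring_nf; simp))
      (by
        have : ((c + indexDeg z : ℕ) : ℤ) - (u + (1 - indexDeg z : ℕ) + n + 1) =
            (c - (u + (n + 1 : ℕ) + 1)) + 2 * indexDeg z := by
          rcases z with z | z <;> simp [indexDeg] <;> ring
        rw [this]
        exact hc.add (even_two_mul _))
      (a := fun i => a i.succ) (v := Fin.tail v) (fun i => hv i.succ)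
    rw [hz, mul_add, mul_assoc, mul_smul_comm, ← mul_assoc _ b,
      (((hv 0).tw (c + indexDeg z)).dz z).comm hb, smul_mul_assoc, smul_smul, mul_assoc,
      ← Units.val_mul, ← Int.negOnePow_add]
    congr 3
    rw [Int.negOnePow_eq_iff, Fin.sum_univ_succ]
    rcases z with z | z <;> simp [indexDeg] <;> ring_nf <;> simp

end SuperCalculus

end PInftyForms

end

noncomputable section

namespace PInftyForms

open MvPolynomial

namespace SuperCalculus

variable {𝕜 : Type*} [Field 𝕜] {d : ℕ} {B : Type*} [Ring B] [Algebra 𝕜 B]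
  {A : Type*} [CommRing A]

/-! ### Symbols polynomial in the momenta -/

section Symbols

variable (C : SuperCalculus 𝕜 d B) (ι : A →+* B)

/-- The symbol of a fibrewise polynomial function. -/
def symbolTwo : MvPolynomial (Fin d) A → List (Fin d ⊕ Fin d) → B
  -- A symbol differentiates along the momenta listed and then sets the rest to zero. The words Two,
  -- One and Zero in the three definitions count the odd momenta already consumed; an even index
  -- consumes one, and the Hamiltonian has at most two.
  | G, [] => ι (constantCoeff G)
  | _, Sum.inl _ :: _ => 0
  | G, Sum.inr l :: t => symbolTwo (pderiv l G) t

/-- The symbol of `∑ g_i ξ^i + ∑ x_k w_k`, where the `x_k` are the odd momenta. -/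
def symbolOne : (Fin d → MvPolynomial (Fin d) A) → (Fin d → MvPolynomial (Fin d) A) →
    List (Fin d ⊕ Fin d) → B
  | g, _, [] => ∑ i, ι (constantCoeff (g i)) * C.ξ i
  | _, w, Sum.inl k :: t => symbolTwo ι (w k) t
  | g, w, Sum.inr l :: t => symbolOne (fun i => pderiv l (g i)) (fun k => pderiv l (w k)) t

/-- The symbol of `∑ x_j g_{ji} ξ^i + ½ ∑ x_j x_k w_{jk}`. -/
def symbolZero : (Fin d → Fin d → MvPolynomial (Fin d) A) →
    (Fin d → Fin d → MvPolynomial (Fin d) A) → List (Fin d ⊕ Fin d) → B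
  | _, _, [] => 0
  | g, w, Sum.inl j :: t => symbolOne C ι (g j) (w j) t
  | g, w, Sum.inr l :: t =>
      symbolZero (fun j i => pderiv l (g j i)) (fun j k => pderiv l (w j k)) t

theorem symbolTwo_neg (G : MvPolynomial (Fin d) A) (t : List (Fin d ⊕ Fin d)) :
    symbolTwo ι (-G) t = -symbolTwo ι G t := by
  induction t generalizing G with
  | nil => simp [symbolTwo]
  | cons z t ih => rcases z with z | z <;> simp [symbolTwo, ih]

theorem pderiv_pderiv_comm (k l : Fin d) (G : MvPolynomial (Fin d) A) :
    pderiv k (pderiv l G) = pderiv l (pderiv k G) := by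
  induction G using MvPolynomial.induction_on with
  | C a => simp
  | add p q hp hq => simp [hp, hq]
  | mul_X p i hp =>
    simp only [Derivation.leibniz, map_add, pderiv_X, smul_eq_mul, hp]
    have : ∀ a b : Fin d, pderiv a
        ((Pi.single b 1 : Fin d → MvPolynomial (Fin d) A) i) = 0 := by
      intro a b
      rcases eq_or_ne i b with rfl | h <;> simp [*]
    rw [this, this]
    ring

variable {C ι}

theorem symbolTwo_symm (G : MvPolynomial (Fin d) A) : SymbolSymm (symbolTwo ι G) := by
  intro l
  induction l generalizing G with
  | nil =>
    rintro (z | z) (w | w) l'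
    · simp [symbolTwo]
    · simp [symbolTwo]
    · simp [symbolTwo]
    · rw [Int.negOnePow_even _ (by simp [indexDeg]; decide)]
      simp [symbolTwo, pderiv_pderiv_comm z w]
  | cons y l ih =>
    intro z w l'
    rcases y with y | y
    · simp [symbolTwo]
    · exact ih (pderiv y G) z w l'

theorem symbolOne_symm (g w : Fin d → MvPolynomial (Fin d) A) :
    SymbolSymm (symbolOne C ι g w) := by
  intro l
  induction l generalizing g w with
  | nil =>
    rintro (z | z) (y | y) l'
    · simp [symbolOne, symbolTwo]
    · rw [Int.negOnePow_even _ (by simp [indexDeg])]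
      simp [symbolOne, symbolTwo]
    · rw [Int.negOnePow_even _ (by simp [indexDeg])]
      simp [symbolOne, symbolTwo]
    · rw [Int.negOnePow_even _ (by simp [indexDeg]; decide)]
      simp [symbolOne, pderiv_pderiv_comm z y]
  | cons x l ih =>
    intro z y l'
    rcases x with x | x
    · exact symbolTwo_symm (w x) l z y l'
    · exact ih _ _ z y l'

/-- Two even indices anticommute because w is skew, two odd ones commute because partial derivatives
do, and an even and an odd one act on different variables. -/
theorem symbolZero_symm (g w : Fin d → Fin d → MvPolynomial (Fin d) A)
    (hw : ∀ i j, w i j = -w j i) : SymbolSymm (symbolZero C ι g w) := by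
  intro l
  induction l generalizing g w with
  | nil =>
    rintro (z | z) (y | y) l'
    · simp [symbolZero, symbolOne, indexDeg, hw z y, symbolTwo_neg]
    · rw [Int.negOnePow_even _ (by simp [indexDeg])]
      simp [symbolZero, symbolOne]
    · rw [Int.negOnePow_even _ (by simp [indexDeg])]
      simp [symbolZero, symbolOne]
    · rw [Int.negOnePow_even _ (by simp [indexDeg]; decide)]
      simp [symbolZero, pderiv_pderiv_comm z y]
  | cons x l ih =>
    intro z y l'
    rcases x with x | x
    · exact symbolOne_symm (g x) (w x) l z y l'
    · exact ih _ _ (fun i j => by rw [hw i j, map_neg]) z y l'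

theorem evenCount_inl (j : Fin d) (t : List (Fin d ⊕ Fin d)) :
    evenCount (Sum.inl j :: t) = evenCount t + 1 := by simp [evenCount, indexDeg]; ring

theorem evenCount_inr (j : Fin d) (t : List (Fin d ⊕ Fin d)) :
    evenCount (Sum.inr j :: t) = evenCount t := by simp [evenCount, indexDeg]

theorem par_symbolTwo (hι : ∀ a, C.s (ι a) = ι a) (G : MvPolynomial (Fin d) A)
    (t : List (Fin d ⊕ Fin d)) : C.Par (evenCount t) (symbolTwo ι G t) := by
  induction t generalizing G with
  | nil => exact par_even.2 (hι _)
  | cons z t ih =>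
    rcases z with z | z
    · exact Par.zero _
    · rw [evenCount_inr]; exact ih _

theorem par_symbolOne (hι : ∀ a, C.s (ι a) = ι a) (g w : Fin d → MvPolynomial (Fin d) A)
    (t : List (Fin d ⊕ Fin d)) : C.Par (1 + evenCount t) (symbolOne C ι g w t) := by
  induction t generalizing g w with
  | nil =>
    refine Par.sum fun i _ => ?_
    have h := (par_even.2 (hι (constantCoeff (g i)))).mul (par_odd.2 (C.s_ξ i))
    simpa [evenCount] using h
  | cons z t ih =>
    rcases z with z | z
    · refine (par_symbolTwo hι (w z) t).congr ?_
      rw [evenCount_inl]; push_cast; ring_nf; decide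
    · rw [evenCount_inr]; exact ih _ _

theorem par_symbolZero (hι : ∀ a, C.s (ι a) = ι a)
    (g w : Fin d → Fin d → MvPolynomial (Fin d) A)
    (t : List (Fin d ⊕ Fin d)) : C.Par (evenCount t) (symbolZero C ι g w t) := by
  induction t generalizing g w with
  | nil => exact Par.zero _
  | cons z t ih =>
    rcases z with z | z
    · refine (par_symbolOne hι (g z) (w z) t).congr ?_
      rw [evenCount_inl]; push_cast; ring_nf; decide
    · rw [evenCount_inr]; exact ih _ _

end Symbols

/-! ### Values on the diagonal -/

section Diagonal

/-- Homogeneity of integral degree: zero in negative degrees. -/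
def HomDeg (k : ℤ) (G : MvPolynomial (Fin d) A) : Prop :=
  (∀ m : ℕ, (m : ℤ) = k → G.IsHomogeneous m) ∧ (k < 0 → G = 0)

theorem HomDeg.eq_C {G : MvPolynomial (Fin d) A} (h : HomDeg 0 G) : G = C (constantCoeff G) := by
  have := (totalDegree_zero_iff_isHomogeneous (Fin d)).2 (h.1 0 rfl)
  rw [totalDegree_eq_zero_iff_eq_C] at this
  rw [this]; simp

theorem HomDeg.pderiv {k : ℤ} {G : MvPolynomial (Fin d) A} (h : HomDeg k G) (l : Fin d) :
    HomDeg (k - 1) (pderiv l G) := by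
  refine ⟨fun m hm => ?_, fun hk => ?_⟩
  · have := (h.1 (m + 1) (by push_cast; omega)).pderiv (i := l)
    simpa using this
  · rcases lt_or_ge k 0 with h0 | h0
    · rw [h.2 h0, map_zero]
    · obtain rfl : k = 0 := by omega
      rw [h.eq_C, MvPolynomial.pderiv_C]

theorem HomDeg.euler {k : ℤ} {G : MvPolynomial (Fin d) A} (h : HomDeg k G) :
    ∑ l, X l * MvPolynomial.pderiv l G = k • G := by
  rcases lt_or_ge k 0 with h0 | h0
  · simp [h.2 h0]
  · obtain ⟨m, rfl⟩ := Int.eq_ofNat_of_zero_le h0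
    rw [(h.1 m rfl).sum_X_mul_pderiv]
    simp

variable {C : SuperCalculus 𝕜 d B} {ι : A →+* B} {φ : B}

/-- Evaluation of fibrewise polynomial functions on the graph of `dφ`, for odd `φ`. -/
structure IsGraphEval (C : SuperCalculus 𝕜 d B) (ι : A →+* B) (φ : B)
    (ev : MvPolynomial (Fin d) A →+* B) : Prop where
  map_C : ∀ a, ev (MvPolynomial.C a) = ι a
  map_X : ∀ l, ev (X l) = C.I l φ
  even : ∀ P, C.s (ev P) = ev P

/-- Polynomial evaluation needs a commutative target. For odd φ the elements I_l φ are even, hence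
central, as are the scalars, so the evaluation can be made in the centre of B. -/
theorem exists_isGraphEval (hι : ∀ a, C.s (ι a) = ι a) (hφ : C.Par 1 φ) :
    ∃ ev, IsGraphEval C ι φ ev := by
  have hp : ∀ l, C.s (C.I l φ) = C.I l φ := fun l => par_even.1 ((hφ.I l).congr (by decide))
  let Z := Subring.center B
  have hc : ∀ b, C.s b = b → b ∈ Z := fun b hb =>
    Subring.mem_center_iff.2 fun x => (C.even_comm b x hb).symm
  let ev := Z.subtype.comp (eval₂Hom (ι.codRestrict Z fun a => hc _ (hι a))
    fun l => ⟨C.I l φ, hc _ (hp l)⟩)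
  have h1 : ∀ a, ev (MvPolynomial.C a) = ι a := fun a => by simp [ev]
  have h2 : ∀ l, ev (X l) = C.I l φ := fun a => by simp [ev]
  refine ⟨ev, h1, h2, fun P => ?_⟩
  induction P using MvPolynomial.induction_on with
  | C a => rw [h1, hι]
  | add p q hp hq => rw [map_add, map_add, hp, hq]
  | mul_X p i hq => rw [map_mul, C.s_mul, hq, h2, hp]

theorem multi_zero_symbol (n c : ℕ) (v : Fin n → B) : C.multi n c (fun _ => 0) v = 0 := by
  have := C.multi_add n c (fun _ => 0) (fun _ => 0) v
  simpa using this

variable {ev : MvPolynomial (Fin d) A →+* B} (hev : IsGraphEval C ι φ ev)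

include hev in
theorem IsGraphEval.commute (P : MvPolynomial (Fin d) A) (x : B) : ev P * x = x * ev P :=
  C.even_comm _ _ (hev.even P)

include hev in
theorem IsGraphEval.euler {k : ℤ} {G : MvPolynomial (Fin d) A} (h : HomDeg k G) :
    ∑ l, C.I l φ * ev (MvPolynomial.pderiv l G) = k • ev G := by
  rw [← map_zsmul, ← h.euler, map_sum]
  exact Finset.sum_congr rfl fun l _ => by rw [map_mul, hev.map_X]

-- Only odd indices survive, and the sum over them in one slot is Euler's operator. The degree drops
-- by one with each slot, whence n!.
include hev in
theorem multi_symbolTwo (hφ : C.Par 1 φ) (n c : ℕ) (G : MvPolynomial (Fin d) A)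
    (hG : HomDeg n G) : C.multi n c (symbolTwo ι G) (fun _ => φ) = n.factorial • ev G := by
  induction n generalizing c G with
  | zero => rw [multi_zero, symbolTwo, ← hev.map_C, ← hG.eq_C]; simp
  | succ n ih =>
    rw [multi_odd_succ hφ, Fintype.sum_sum_type]
    have h1 : ∀ l : Fin d, C.multi n (c + indexDeg (Sum.inr l))
        (fun t => symbolTwo ι G (Sum.inr l :: t)) (Fin.tail fun _ => φ) =
        n.factorial • ev (MvPolynomial.pderiv l G) := fun l =>
      ih _ _ (by simpa using hG.pderiv l)
    have h2 : ∀ k : Fin d, C.multi n (c + indexDeg (Sum.inl k))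
        (fun t => symbolTwo ι G (Sum.inl k :: t)) (Fin.tail fun _ => φ) = 0 := fun k =>
      multi_zero_symbol _ _ _
    simp only [h1, h2, mul_zero, Finset.sum_const_zero, zero_add, dz,
      Sum.elim_inr, mul_smul_comm, ← Finset.smul_sum, hev.euler hG]
    rw [natCast_zsmul, smul_smul, Nat.factorial_succ, mul_comm]

/-- The value of `∑ g_i ξ^i + ∑ x_k w_k` on the graph of `dφ`. -/
def graphOne {R : Type*} [CommRing R] (C : SuperCalculus 𝕜 d B) (ev : R →+* B) (φ : B)
    (g w : Fin d → R) : B :=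
  ∑ i, ev (g i) * C.ξ i + ∑ k, C.D k φ * ev (w k)

/-- Twice the value of `∑ x_j g_{ji} ξ^i + ½ ∑ x_j x_k w_{jk}` on the graph of `dφ`. -/
def graphZero {R : Type*} [CommRing R] (C : SuperCalculus 𝕜 d B) (ev : R →+* B) (φ : B)
    (g w : Fin d → Fin d → R) : B :=
  2 • ∑ j, C.D j φ * ∑ i, ev (g j i) * C.ξ i + ∑ j, C.D j φ * ∑ k, C.D k φ * ev (w j k)

-- The weights agree: for g, Euler's operator gives n + 1; for w, of degree one less, it gives n,
-- and the slot receiving an even index adds one.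
include hev in
theorem multi_symbolOne (hφ : C.Par 1 φ) (n c : ℕ) (g w : Fin d → MvPolynomial (Fin d) A)
    (hg : ∀ i, HomDeg n (g i)) (hw : ∀ k, HomDeg ((n : ℤ) - 1) (w k)) :
    C.multi n c (symbolOne C ι g w) (fun _ => φ) = n.factorial • graphOne C ev φ g w := by
  induction n generalizing c g w with
  | zero =>
    rw [multi_zero, symbolOne, graphOne]
    have h1 : ∀ k, w k = 0 := fun k => (hw k).2 (by simp)
    have h2 : ∀ i, ev (g i) = ι (constantCoeff (g i)) := fun i => by
      rw [← hev.map_C, ← (hg i).eq_C]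
    simp [h1, h2]
  | succ n ih =>
    rw [multi_odd_succ hφ, Fintype.sum_sum_type]
    have h1 : ∀ l : Fin d, C.multi n (c + indexDeg (Sum.inr l))
        (fun t => symbolOne C ι g w (Sum.inr l :: t)) (Fin.tail fun _ => φ) =
        n.factorial • graphOne C ev φ (fun i => MvPolynomial.pderiv l (g i))
          fun i => MvPolynomial.pderiv l (w i) := fun l =>
      ih _ _ _ (fun i => by simpa using (hg i).pderiv l)
        (fun i => by simpa using (hw i).pderiv l)
    have h2 : ∀ k : Fin d, C.multi n (c + indexDeg (Sum.inl k))
        (fun t => symbolOne C ι g w (Sum.inl k :: t)) (Fin.tail fun _ => φ) =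
        n.factorial • ev (w k) := fun k =>
      multi_symbolTwo hev hφ _ _ _ (by simpa using hw k)
    have e1 : ∑ l, C.I l φ * ∑ i, ev (MvPolynomial.pderiv l (g i)) * C.ξ i =
        (n + 1) • ∑ i, ev (g i) * C.ξ i := by
      simp only [Finset.mul_sum]
      rw [Finset.sum_comm, Finset.smul_sum]
      refine Finset.sum_congr rfl fun i _ => ?_
      simp only [← mul_assoc, ← Finset.sum_mul]
      rw [hev.euler (hg i), natCast_zsmul, smul_mul_assoc]
    have e2 : ∑ l, C.I l φ * ∑ k, C.D k φ * ev (MvPolynomial.pderiv l (w k)) =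
        n • ∑ k, C.D k φ * ev (w k) := by
      simp only [Finset.mul_sum]
      rw [Finset.sum_comm, Finset.smul_sum]
      refine Finset.sum_congr rfl fun k _ => ?_
      have : ∀ l, C.I l φ * (C.D k φ * ev (MvPolynomial.pderiv l (w k))) =
          C.D k φ * (C.I l φ * ev (MvPolynomial.pderiv l (w k))) := fun l => by
        rw [← hev.map_X, ← mul_assoc, hev.commute, mul_assoc]
      simp only [this, ← Finset.mul_sum]
      rw [hev.euler (hw k), show ((n + 1 : ℕ) : ℤ) - 1 = n by push_cast; ring, natCast_zsmul,
        mul_smul_comm]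
    simp only [h1, h2, dz, Sum.elim_inr, Sum.elim_inl, mul_smul_comm, ← Finset.smul_sum]
    simp only [graphOne, mul_add, Finset.sum_add_distrib, e1, e2]
    rw [Nat.factorial_succ]
    module

-- The weights agree again: the mixed term gets n from Euler's operator and 1 from its odd momentum,
-- the quadratic term n - 1 from Euler's operator and 2 from its two odd momenta. Doubling both
-- sides keeps the coefficient ½ out of the ring.
include hev in
theorem multi_symbolZero (hφ : C.Par 1 φ) (n c : ℕ)
    (g w : Fin d → Fin d → MvPolynomial (Fin d) A)
    (hg : ∀ j i, HomDeg ((n : ℤ) - 1) (g j i)) (hw : ∀ j k, HomDeg ((n : ℤ) - 2) (w j k)) :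
    2 • C.multi n c (symbolZero C ι g w) (fun _ => φ) = n.factorial • graphZero C ev φ g w := by
  induction n generalizing c g w with
  | zero =>
    have h1 : ∀ j k, w j k = 0 := fun j k => (hw j k).2 (by simp)
    have h2 : ∀ j i, g j i = 0 := fun j i => (hg j i).2 (by simp)
    simp [multi_zero, symbolZero, graphZero, h1, h2]
  | succ n ih =>
    rw [multi_odd_succ hφ, Fintype.sum_sum_type, smul_add]
    have h1 : ∀ l : Fin d, 2 • C.multi n (c + indexDeg (Sum.inr l))
        (fun t => symbolZero C ι g w (Sum.inr l :: t)) (Fin.tail fun _ => φ) =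
        n.factorial • graphZero C ev φ (fun j i => MvPolynomial.pderiv l (g j i))
          fun j i => MvPolynomial.pderiv l (w j i) := fun l =>
      ih _ _ _ (fun j i => by simpa using (hg j i).pderiv l)
        (fun j i => by convert (hw j i).pderiv l using 1; push_cast; ring)
    have h2 : ∀ k : Fin d, C.multi n (c + indexDeg (Sum.inl k))
        (fun t => symbolZero C ι g w (Sum.inl k :: t)) (Fin.tail fun _ => φ) =
        n.factorial • graphOne C ev φ (g k) (w k) := fun k =>
      multi_symbolOne hev hφ _ _ _ _ (fun i => by simpa using hg k i)
        (fun i => by convert hw k i using 1; push_cast; ring)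
    have e1 : ∑ l, C.I l φ * ∑ j, C.D j φ * ∑ i, ev (MvPolynomial.pderiv l (g j i)) * C.ξ i =
        n • ∑ j, C.D j φ * ∑ i, ev (g j i) * C.ξ i := by
      simp only [Finset.mul_sum]
      rw [Finset.sum_comm, Finset.smul_sum]
      refine Finset.sum_congr rfl fun j _ => ?_
      rw [Finset.sum_comm, Finset.smul_sum]
      refine Finset.sum_congr rfl fun i _ => ?_
      have : ∀ l, C.I l φ * (C.D j φ * (ev (MvPolynomial.pderiv l (g j i)) * C.ξ i)) =
          C.D j φ * ((C.I l φ * ev (MvPolynomial.pderiv l (g j i))) * C.ξ i) := fun l => by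
        rw [← hev.map_X, ← mul_assoc, hev.commute, mul_assoc, mul_assoc]
      simp only [this, ← Finset.mul_sum, ← Finset.sum_mul]
      rw [hev.euler (hg j i), show ((n + 1 : ℕ) : ℤ) - 1 = n by push_cast; ring, natCast_zsmul,
        smul_mul_assoc, mul_smul_comm]
    have e2 : ∑ l, C.I l φ * ∑ j, C.D j φ * ∑ k, C.D k φ * ev (MvPolynomial.pderiv l (w j k)) =
        ((n : ℤ) - 1) • ∑ j, C.D j φ * ∑ k, C.D k φ * ev (w j k) := by
      simp only [Finset.mul_sum]
      rw [Finset.sum_comm, Finset.smul_sum]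
      refine Finset.sum_congr rfl fun j _ => ?_
      rw [Finset.sum_comm, Finset.smul_sum]
      refine Finset.sum_congr rfl fun k _ => ?_
      have : ∀ l, C.I l φ * (C.D j φ * (C.D k φ * ev (MvPolynomial.pderiv l (w j k)))) =
          C.D j φ * (C.D k φ * (C.I l φ * ev (MvPolynomial.pderiv l (w j k)))) := fun l => by
        rw [← hev.map_X, ← mul_assoc, hev.commute, mul_assoc, ← mul_assoc _ (C.D k φ),
          hev.commute, mul_assoc]
      simp only [this, ← Finset.mul_sum]
      rw [hev.euler (k := (n : ℤ) - 1) (by convert hw j k using 1; push_cast; ring),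
        mul_smul_comm, mul_smul_comm]
    have h1' : 2 • ∑ l, C.dz (Sum.inr l) φ * C.multi n (c + indexDeg (Sum.inr l))
        (fun t => symbolZero C ι g w (Sum.inr l :: t)) (Fin.tail fun _ => φ) =
        n.factorial • ∑ l, C.I l φ * graphZero C ev φ (fun j i => MvPolynomial.pderiv l (g j i))
          fun j i => MvPolynomial.pderiv l (w j i) := by
      rw [Finset.smul_sum, Finset.smul_sum]
      refine Finset.sum_congr rfl fun l _ => ?_
      rw [← mul_smul_comm, h1, mul_smul_comm]; rfl
    rw [h1']
    simp only [h2, dz, Sum.elim_inl, mul_smul_comm, ← Finset.smul_sum]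
    simp only [graphZero, graphOne, mul_add, Finset.sum_add_distrib, mul_smul_comm,
      ← Finset.smul_sum, e1, e2]
    rw [Nat.factorial_succ]
    module

end Diagonal

end SuperCalculus

end PInftyForms

end

noncomputable section

namespace PInftyForms

/-! ### The Jacobi identity on the graph of `dφ` -/

section Trilinear

variable {Z S : Type*} [CommRing Z] [Ring S] [Algebra Z S] {d : ℕ}

theorem sum_rotate {M : Type*} [AddCommMonoid M] (f : Fin d → Fin d → Fin d → Fin d → M) :
    ∑ k, ∑ a, ∑ i, ∑ c, f k a i c = ∑ a, ∑ i, ∑ c, ∑ k, f k a i c := by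
  rw [Finset.sum_comm]
  refine Finset.sum_congr rfl fun a _ => ?_
  rw [Finset.sum_comm]
  refine Finset.sum_congr rfl fun i _ => ?_
  rw [Finset.sum_comm]

theorem sum_word_mul_sum {x y z : Fin d → S} (p : Fin d → Fin d → Fin d → Z)
    (q : Fin d → Fin d → Z) :
    ∑ k, (∑ a, ∑ i, p k a i • (x a * y i)) * (∑ c, q k c • z c) =
      ∑ a, ∑ i, ∑ c, (∑ k, p k a i * q k c) • (x a * y i * z c) := by
  simp only [Finset.sum_smul]
  rw [← sum_rotate]
  refine Finset.sum_congr rfl fun k _ => ?_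
  rw [Finset.sum_mul]
  refine Finset.sum_congr rfl fun a _ => ?_
  rw [Finset.sum_mul]
  refine Finset.sum_congr rfl fun i _ => ?_
  rw [Finset.mul_sum]
  exact Finset.sum_congr rfl fun c _ => smul_mul_smul_comm _ _ _ _

theorem sum_sum_mul_word {x y z : Fin d → S} (p : Fin d → Fin d → Fin d → Z)
    (q : Fin d → Fin d → Z) :
    ∑ k, (∑ c, q k c • z c) * (∑ a, ∑ i, p k a i • (x a * y i)) =
      ∑ c, ∑ a, ∑ i, (∑ k, q k c * p k a i) • (z c * x a * y i) := by
  simp only [Finset.sum_smul]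
  rw [← sum_rotate]
  refine Finset.sum_congr rfl fun k _ => ?_
  rw [Finset.sum_mul]
  refine Finset.sum_congr rfl fun a _ => ?_
  rw [Finset.mul_sum]
  refine Finset.sum_congr rfl fun i _ => ?_
  rw [Finset.mul_sum]
  exact Finset.sum_congr rfl fun c _ => by rw [smul_mul_smul_comm, mul_assoc]

theorem sum_antisymm_eq_zero {M : Type*} [AddCommGroup M] (h2 : ∀ m : M, 2 • m = 0 → m = 0)
    (f : Fin d → Fin d → M) (hf : ∀ a b, f a b = -f b a) : ∑ a, ∑ b, f a b = 0 := by
  refine h2 _ ?_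
  rw [two_smul]
  nth_rewrite 2 [Finset.sum_comm]
  simp only [← Finset.sum_add_distrib]
  exact Finset.sum_eq_zero fun a _ => Finset.sum_eq_zero fun b _ => by rw [hf a b]; abel

/-- The Jacobi identity contracted with odd elements. -/
theorem jacobi_contraction (h6 : ∀ m : S, 6 • m = 0 → m = 0) (x ξ : Fin d → S)
    (hxx : ∀ a b, x a * x b = -(x b * x a)) (hxξ : ∀ a b, x a * ξ b = -(ξ b * x a))
    (hξξ : ∀ a b, ξ a * ξ b = -(ξ b * ξ a)) (g w : Fin d → Fin d → Z)
    (gx wx gp wp : Fin d → Fin d → Fin d → Z) (hw : ∀ i j, w i j = -w j i)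
    (hwx : ∀ k i j, wx k i j = -wx k j i)
    (jxxx : ∀ i j m, ∑ k, (w i k * wx k j m + w j k * wx k m i + w m k * wx k i j) =
      ∑ l, (g i l * wp l j m + g j l * wp l m i + g m l * wp l i j))
    (jxxp : ∀ i j m, ∑ l, (g i l * gp l j m - g j l * gp l i m) + ∑ k, g k m * wx k i j =
      ∑ k, (w i k * gx k j m - w j k * gx k i m))
    (jxpp : ∀ i j m, ∑ k, (g k j * gx k i m - g k m * gx k i j) = 0) :
    ∑ k, (2 • ∑ a, ∑ i, gx k a i • (x a * ξ i) + ∑ a, ∑ b, wx k a b • (x a * x b)) *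
        (∑ i, g k i • ξ i + ∑ j, w k j • x j) +
      ∑ l, (∑ j, g j l • x j) *
        (2 • ∑ a, ∑ i, gp l a i • (x a * ξ i) + ∑ a, ∑ b, wp l a b • (x a * x b)) = 0 := by
  have h2 : ∀ m : S, 2 • m = 0 → m = 0 := fun m hm => h6 m (by
    rw [show 6 = 3 * 2 by norm_num, mul_smul, hm, smul_zero])
  have h3 : ∀ m : S, 3 • m = 0 → m = 0 := fun m hm => h6 m (by
    rw [show 6 = 2 * 3 by norm_num, mul_smul, hm, smul_zero])
  simp only [add_mul, mul_add, Finset.sum_add_distrib, smul_mul_assoc, mul_smul_comm,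
    ← Finset.smul_sum]
  rw [sum_word_mul_sum, sum_word_mul_sum, sum_word_mul_sum, sum_word_mul_sum, sum_sum_mul_word,
    sum_sum_mul_word]
  -- Words x ξ ξ: by `jxpp` the coefficient is symmetric in the two indices in which the word is
  -- antisymmetric.
  have t1 : ∑ a, ∑ i, ∑ c, (∑ k, gx k a i * g k c) • (x a * ξ i * ξ c) = 0 := by
    refine Finset.sum_eq_zero fun a _ => sum_antisymm_eq_zero h2 _ fun i c => ?_
    have h := jxpp a i c
    rw [Finset.sum_sub_distrib, sub_eq_zero] at h
    have h' : ∑ k, gx k a i * g k c = ∑ k, gx k a c * g k i := by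
      simp only [mul_comm (gx _ _ _)]; exact h.symm
    rw [h', mul_assoc, hξξ i c, mul_neg, smul_neg, mul_assoc]
  have t2 : ∑ a, ∑ i, ∑ c, (∑ k, gx k a i * w k c) • (x a * ξ i * x c) =
      ∑ i, ∑ a, ∑ c, (∑ k, gx k c i * w k a) • (x a * x c * ξ i) := by
    rw [Finset.sum_comm]
    refine Finset.sum_congr rfl fun i _ => ?_
    rw [Finset.sum_comm]
    refine Finset.sum_congr rfl fun a _ => Finset.sum_congr rfl fun c _ => ?_
    rw [mul_assoc, ← neg_neg (ξ i * x a), ← hxξ a i, mul_neg, ← mul_assoc, hxx c a, neg_mul,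
      neg_neg]
  have t3 : ∀ (f : Fin d → Fin d → Fin d → Z) (y : Fin d → S),
      ∑ a, ∑ b, ∑ i, f a b i • (x a * x b * y i) =
      ∑ i, ∑ a, ∑ b, f a b i • (x a * x b * y i) := by
    intro f y
    have : ∀ a, ∑ b, ∑ i, f a b i • (x a * x b * y i) = ∑ i, ∑ b, f a b i • (x a * x b * y i) :=
      fun a => Finset.sum_comm
    simp only [this]
    rw [Finset.sum_comm]
  have hrot : ∀ a b c, x a * x b * x c = x c * x a * x b := fun a b c => by
    rw [mul_assoc, hxx b c, mul_neg, ← mul_assoc, hxx a c]; simp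
  -- Words x x x: they are invariant under cyclic rotation, so three times the sum is the sum with
  -- cyclically symmetrized coefficients, which vanish by `jxxx`. This is where 3-torsion must be
  -- excluded.
  have t4 : ∑ a, ∑ b, ∑ c, (∑ k, wx k a b * w k c) • (x a * x b * x c) +
      ∑ c, ∑ a, ∑ b, (∑ l, g c l * wp l a b) • (x c * x a * x b) = 0 := by
    rw [t3]
    simp only [hrot _ _, ← Finset.sum_add_distrib, ← add_smul]
    set t : Fin d → Fin d → Fin d → Z := fun c a b =>
      ∑ k, (wx k a b * w k c + g c k * wp k a b) with ht
    have ht0 : ∀ c a b, t c a b + t a b c + t b c a = 0 := fun c a b => by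
      have h := jxxx c a b
      rw [← sub_eq_zero, ← Finset.sum_sub_distrib] at h
      simp only [ht, ← Finset.sum_add_distrib]
      rw [← neg_eq_zero, ← h, ← Finset.sum_neg_distrib]
      refine Finset.sum_congr rfl fun k _ => ?_
      rw [hw k c, hw k a, hw k b]; ring
    have e0 : ∑ c, ∑ a, ∑ b, t c a b • (x c * x a * x b) = 0 := by
      refine h3 _ ?_
      have e1 : ∑ c, ∑ a, ∑ b, t c a b • (x c * x a * x b) =
          ∑ c, ∑ a, ∑ b, t a b c • (x c * x a * x b) := by
        rw [t3]
        exact Finset.sum_congr rfl fun c _ => Finset.sum_congr rfl fun a _ =>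
          Finset.sum_congr rfl fun b _ => by rw [hrot a b c]
      have e2 : ∑ c, ∑ a, ∑ b, t a b c • (x c * x a * x b) =
          ∑ c, ∑ a, ∑ b, t b c a • (x c * x a * x b) := by
        rw [t3 (fun c a b => t a b c)]
        exact Finset.sum_congr rfl fun c _ => Finset.sum_congr rfl fun a _ =>
          Finset.sum_congr rfl fun b _ => by rw [hrot a b c]
      rw [show 3 = 1 + 1 + 1 by norm_num, add_smul, add_smul, one_smul]
      nth_rewrite 3 [e1]
      rw [e2]
      nth_rewrite 2 [e1]
      simp only [← Finset.sum_add_distrib, ← add_smul, ht0, zero_smul, Finset.sum_const_zero]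
    exact e0
  -- Words x x ξ: `jxxp` makes the total coefficient symmetric in the indices of the two
  -- anticommuting factors.
  have t5 : ∑ i, ∑ a, ∑ c, (2 * ∑ k, gx k c i * w k a + ∑ k, wx k a c * g k i +
      2 * ∑ l, g a l * gp l c i) • (x a * x c * ξ i) = 0 := by
    refine Finset.sum_eq_zero fun i _ => sum_antisymm_eq_zero h2 _ fun a c => ?_
    rw [hxx a c, neg_mul, smul_neg]
    congr 2
    have h := jxxp a c i
    rw [← sub_eq_zero]
    rw [Finset.sum_sub_distrib, Finset.sum_sub_distrib] at h
    have e1 : ∑ k, gx k c i * w k a = -∑ k, w a k * gx k c i := by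
      rw [← Finset.sum_neg_distrib]
      exact Finset.sum_congr rfl fun k _ => by rw [hw k a]; ring
    have e2 : ∑ k, gx k a i * w k c = -∑ k, w c k * gx k a i := by
      rw [← Finset.sum_neg_distrib]
      exact Finset.sum_congr rfl fun k _ => by rw [hw k c]; ring
    have e3 : ∑ k, wx k c a * g k i = -∑ k, g k i * wx k a c := by
      rw [← Finset.sum_neg_distrib]
      exact Finset.sum_congr rfl fun k _ => by rw [hwx k c a]; ring
    have e4 : ∑ k, wx k a c * g k i = ∑ k, g k i * wx k a c :=
      Finset.sum_congr rfl fun k _ => mul_comm _ _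
    rw [e1, e2, e3, e4]
    linear_combination 2 * h
  rw [t1, t2, t3 (fun a b i => ∑ k, wx k a b * g k i), t3 (fun c a i => ∑ l, g c l * gp l a i)]
  have e : ∀ (i a c : Fin d), (2 * ∑ k, gx k c i * w k a + ∑ k, wx k a c * g k i +
      2 * ∑ l, g a l * gp l c i) • (x a * x c * ξ i) =
      2 • ((∑ k, gx k c i * w k a) • (x a * x c * ξ i)) +
      (∑ k, wx k a c * g k i) • (x a * x c * ξ i) +
      2 • ((∑ l, g a l * gp l c i) • (x a * x c * ξ i)) := fun i a c => by
    rw [add_smul, add_smul, mul_smul, mul_smul, ofNat_smul_eq_nsmul Z, ofNat_smul_eq_nsmul Z]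
  simp only [e, Finset.sum_add_distrib, ← Finset.smul_sum] at t5
  refine Eq.trans ?_ ((congrArg₂ (· + ·) t5 t4).trans (add_zero 0))
  abel

end Trilinear

/-! ### Derivatives of the Hamiltonian along the graph of dφ -/

namespace SuperCalculus

variable {𝕜 : Type*} [Field 𝕜] {d : ℕ} {S : Type*} [Ring S] [Algebra 𝕜 S]
  {C : SuperCalculus 𝕜 d S} {Z : Type*} [CommRing Z]

/-- The chain rule for functions on the cotangent bundle restricted to the graph of `dφ`. -/
structure IsGraphChain (C : SuperCalculus 𝕜 d S) (φ : S) (κ : Z →+* S)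
    (p : Fin d ⊕ Fin d → Z →+ Z) : Prop where
  odd : C.Par 1 φ
  even : ∀ z, C.s (κ z) = κ z
  D_apply : ∀ k z, C.D k (κ z) = κ (p (Sum.inl k) z) +
    ∑ l, κ (p (Sum.inr l) z) * C.D k (C.I l φ)
  I_apply : ∀ k z, C.I k (κ z) = ∑ l, κ (p (Sum.inr l) z) * C.I k (C.I l φ)

namespace IsGraphChain

variable {φ : S} {κ : Z →+* S} {p : Fin d ⊕ Fin d → Z →+ Z} (hκ : IsGraphChain C φ κ p)

include hκ

theorem commute (z : Z) (x : S) : κ z * x = x * κ z := C.even_comm _ _ (hκ.even z)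

theorem D_odd (k : Fin d) : C.s (C.D k φ) = -C.D k φ := par_odd.1 (hκ.odd.D k)

theorem I_even (k : Fin d) : C.s (C.I k φ) = C.I k φ := par_even.1 ((hκ.odd.I k).congr (by decide))

theorem DI_comm (k l : Fin d) (x : S) : C.D k (C.I l φ) * x = x * C.D k (C.I l φ) :=
  C.even_comm _ _ (by rw [← C.D_s, hκ.I_even])

theorem II_comm (k l : Fin d) (x : S) : C.I k (C.I l φ) * x = C.s x * C.I k (C.I l φ) :=
  C.odd_comm _ _ (by
    have := C.I_s k (C.I l φ)
    rw [hκ.I_even] at this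
    rw [← neg_eq_iff_eq_neg]; exact this.symm)

theorem DD_comm (k l : Fin d) (x : S) : C.D k (C.D l φ) * x = C.s x * C.D k (C.D l φ) :=
  C.odd_comm _ _ (by rw [← C.D_s, hκ.D_odd, map_neg])

theorem ID_comm (k l : Fin d) (x : S) : C.I k (C.D l φ) * x = x * C.I k (C.D l φ) :=
  C.even_comm _ _ (by rw [← C.D_I, ← C.D_s, hκ.I_even])

/-- The chain rule has three sources: the base dependence of the coefficients, their dependence on p
= Iφ, and the odd momenta D_m φ themselves. -/
theorem D_graphOne (k : Fin d) (g w : Fin d → Z) :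
    C.D k (graphOne C κ φ g w) = graphOne C κ φ (fun i => p (Sum.inl k) (g i))
      (fun i => p (Sum.inl k) (w i)) + ∑ l, graphOne C κ φ (fun i => p (Sum.inr l) (g i))
      (fun i => p (Sum.inr l) (w i)) * C.D k (C.I l φ) + ∑ m, C.D k (C.D m φ) * κ (w m) := by
  simp only [graphOne, map_add, map_sum, C.D_mul, hκ.D_apply, C.D_ξ, mul_zero, add_zero,
    add_mul, mul_add, Finset.sum_add_distrib, Finset.sum_mul, Finset.mul_sum]
  rw [Finset.sum_comm (f := fun i l => κ (p (Sum.inr l) (g i)) * C.D k (C.I l φ) * C.ξ i),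
    Finset.sum_comm (f := fun i l => C.D i φ * (κ (p (Sum.inr l) (w i)) * C.D k (C.I l φ)))]
  simp only [mul_assoc, hκ.DI_comm]
  abel

/-- Contractions do not see the base dependence of the coefficients. The undifferentiated term `κ (g
l)` comes from contracting ξ^l. -/
theorem I_graphOne (l : Fin d) (g w : Fin d → Z) :
    C.I l (graphOne C κ φ g w) = -∑ m, graphOne C κ φ (fun i => p (Sum.inr m) (g i))
      (fun i => p (Sum.inr m) (w i)) * C.I l (C.I m φ) + κ (g l) +
      ∑ m, C.I l (C.D m φ) * κ (w m) := by
  simp only [graphOne, map_add, map_sum, C.I_mul, hκ.I_apply, C.I_ξ, hκ.even, hκ.D_odd,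
    add_mul, Finset.sum_add_distrib, Finset.sum_mul, Finset.mul_sum, mul_ite, mul_one, mul_zero,
    Finset.sum_ite_eq, Finset.mem_univ, if_true, neg_mul, Finset.sum_neg_distrib]
  rw [Finset.sum_comm (f := fun i m => κ (p (Sum.inr m) (g i)) * C.I l (C.I m φ) * C.ξ i),
    Finset.sum_comm (f := fun i m => C.D i φ * (κ (p (Sum.inr m) (w i)) * C.I l (C.I m φ)))]
  simp only [mul_assoc, hκ.II_comm, C.s_ξ, neg_mul, mul_neg, Finset.sum_neg_distrib]
  abel

omit hκ in
theorem graphZero_eq (g w : Fin d → Fin d → Z) : graphZero C κ φ g w =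
    2 • ∑ j, C.D j φ * graphOne C κ φ (g j) 0 + ∑ j, C.D j φ * graphOne C κ φ 0 (w j) := by
  simp [graphZero, graphOne]

omit hκ in
theorem graphOne_split (g w : Fin d → Z) :
    graphOne C κ φ g w = graphOne C κ φ g 0 + graphOne C κ φ 0 w := by
  simp [graphOne]

omit hκ in
/-- Exchange of the two odd factors in the quadratic part. -/
theorem sum_exchange (F : Fin d → S) (hF : ∀ m j, F m * C.D j φ = -(C.D j φ * F m))
    (w : Fin d → Fin d → Z) (hw : ∀ i j, w i j = -w j i) :
    ∑ j, C.D j φ * ∑ m, F m * κ (w j m) = ∑ m, F m * graphOne C κ φ 0 (w m) := by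
  simp only [graphOne, Pi.zero_apply, map_zero, zero_mul, Finset.sum_const_zero, zero_add,
    Finset.mul_sum]
  rw [Finset.sum_comm]
  refine Finset.sum_congr rfl fun m _ => Finset.sum_congr rfl fun j _ => ?_
  rw [hw m j, map_neg, mul_neg, mul_neg, ← mul_assoc, ← mul_assoc, hF, neg_mul, neg_neg]

/-- In the quadratic part the derivative may hit either odd momentum. Both choices give the same sum
because w is skew (`sum_exchange`), so the second-derivative terms of the two parts share the factor
2. -/
theorem D_graphZero (k : Fin d) (g w : Fin d → Fin d → Z) (hw : ∀ i j, w i j = -w j i) :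
    C.D k (graphZero C κ φ g w) = 2 • ∑ j, C.D k (C.D j φ) * graphOne C κ φ (g j) (w j) +
      graphZero C κ φ (fun j i => p (Sum.inl k) (g j i)) (fun j i => p (Sum.inl k) (w j i)) +
      ∑ l, graphZero C κ φ (fun j i => p (Sum.inr l) (g j i))
        (fun j i => p (Sum.inr l) (w j i)) * C.D k (C.I l φ) := by
  have hz : (fun _ : Fin d => (0 : Z)) = 0 := rfl
  have e := sum_exchange (κ := κ) (fun m => C.D k (C.D m φ))
    (fun m j => by rw [hκ.DD_comm, hκ.D_odd, neg_mul]) w hw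
  simp only [graphZero_eq, map_add, map_nsmul, map_sum, C.D_mul, hκ.D_graphOne, Pi.zero_apply,
    map_zero, hz, mul_zero, Finset.sum_const_zero, add_zero, mul_add, Finset.sum_add_distrib, e]
  simp only [Finset.mul_sum, Finset.sum_add_distrib, add_mul, Finset.sum_mul, smul_mul_assoc, ← Finset.smul_sum]
  rw [Finset.sum_comm (f := fun j l => C.D j φ * (graphOne C κ φ (fun i => p (Sum.inr l) (g j i)) 0
      * C.D k (C.I l φ))),
    Finset.sum_comm (f := fun j l => C.D j φ * (graphOne C κ φ 0 (fun i => p (Sum.inr l) (w j i))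
      * C.D k (C.I l φ)))]
  have h1 : ∑ j, C.D k (C.D j φ) * graphOne C κ φ (g j) (w j) =
      ∑ j, C.D k (C.D j φ) * graphOne C κ φ (g j) 0 +
      ∑ j, C.D k (C.D j φ) * graphOne C κ φ 0 (w j) := by
    rw [← Finset.sum_add_distrib]
    exact Finset.sum_congr rfl fun j _ => by rw [← mul_add, ← graphOne_split]
  rw [h1]
  simp only [mul_assoc]
  abel

/-- Compared with the even derivations there is one sign from passing an odd momentum and another
because I_l D_m φ is even, so the two halves of the quadratic part add up here as well. -/
theorem I_graphZero (l : Fin d) (g w : Fin d → Fin d → Z) (hw : ∀ i j, w i j = -w j i) :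
    C.I l (graphZero C κ φ g w) = 2 • ∑ j, C.I l (C.D j φ) * graphOne C κ φ (g j) (w j) -
      2 • ∑ j, C.D j φ * κ (g j l) +
      ∑ m, graphZero C κ φ (fun j i => p (Sum.inr m) (g j i))
        (fun j i => p (Sum.inr m) (w j i)) * C.I l (C.I m φ) := by
  have hz : (fun _ : Fin d => (0 : Z)) = 0 := rfl
  have e : ∑ j, C.D j φ * ∑ m, C.I l (C.D m φ) * κ (w j m) =
      -∑ m, C.I l (C.D m φ) * graphOne C κ φ 0 (w m) := by
    simp only [graphOne, Pi.zero_apply, map_zero, zero_mul, Finset.sum_const_zero, zero_add,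
      Finset.mul_sum, ← Finset.sum_neg_distrib]
    rw [Finset.sum_comm]
    refine Finset.sum_congr rfl fun m _ => Finset.sum_congr rfl fun j _ => ?_
    rw [hw m j, map_neg, mul_neg, mul_neg, neg_neg, ← mul_assoc, ← mul_assoc, hκ.ID_comm]
  simp only [graphZero_eq, map_add, map_nsmul, map_sum, C.I_mul, hκ.I_graphOne, Pi.zero_apply,
    map_zero, hz, mul_zero, Finset.sum_const_zero, add_zero, mul_add, Finset.sum_add_distrib, e,
    hκ.D_odd, neg_mul, Finset.sum_neg_distrib, mul_neg, neg_neg]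
  simp only [Finset.mul_sum, Finset.sum_add_distrib, add_mul, Finset.sum_mul, smul_mul_assoc, ← Finset.smul_sum]
  rw [Finset.sum_comm (f := fun j m => C.D j φ * (graphOne C κ φ (fun i => p (Sum.inr m) (g j i)) 0
      * C.I l (C.I m φ))),
    Finset.sum_comm (f := fun j m => C.D j φ * (graphOne C κ φ 0 (fun i => p (Sum.inr m) (w j i))
      * C.I l (C.I m φ)))]
  have h1 : ∑ j, C.I l (C.D j φ) * graphOne C κ φ (g j) (w j) =
      ∑ j, C.I l (C.D j φ) * graphOne C κ φ (g j) 0 +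
      ∑ j, C.I l (C.D j φ) * graphOne C κ φ 0 (w j) := by
    rw [← Finset.sum_add_distrib]
    exact Finset.sum_congr rfl fun j _ => by rw [← mul_add, ← graphOne_split]
  rw [h1]
  simp only [mul_assoc]
  abel

theorem graphOne_odd (g w : Fin d → Z) : C.s (graphOne C κ φ g w) = -graphOne C κ φ g w := by
  simp only [graphOne, map_add, map_sum, C.s_mul, hκ.even, C.s_ξ, hκ.D_odd, mul_neg, neg_mul,
    Finset.sum_neg_distrib]
  abel

theorem graphZero_even (g w : Fin d → Fin d → Z) :
    C.s (graphZero C κ φ g w) = graphZero C κ φ g w := by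
  simp only [graphZero_eq, map_add, map_nsmul, map_sum, C.s_mul, hκ.D_odd, hκ.graphOne_odd,
    neg_mul_neg]

/-- The Jacobi identity for the bivector with blocks `-w` and `g` implies the master equation on
the graph of `dφ`. -/
theorem master (h6 : ∀ m : S, 6 • m = 0 → m = 0) (g w : Fin d → Fin d → Z)
    (hw : ∀ i j, w i j = -w j i)
    (jxxx : ∀ i j m, ∑ k, (w i k * p (Sum.inl k) (w j m) + w j k * p (Sum.inl k) (w m i) +
        w m k * p (Sum.inl k) (w i j)) =
      ∑ l, (g i l * p (Sum.inr l) (w j m) + g j l * p (Sum.inr l) (w m i) +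
        g m l * p (Sum.inr l) (w i j)))
    (jxxp : ∀ i j m, ∑ l, (g i l * p (Sum.inr l) (g j m) - g j l * p (Sum.inr l) (g i m)) +
        ∑ k, g k m * p (Sum.inl k) (w i j) =
      ∑ k, (w i k * p (Sum.inl k) (g j m) - w j k * p (Sum.inl k) (g i m)))
    (jxpp : ∀ i j m, ∑ k, (g k j * p (Sum.inl k) (g i m) - g k m * p (Sum.inl k) (g i j)) = 0) :
    2 • ∑ k, C.D k (graphZero C κ φ g w) * graphOne C κ φ (g k) (w k) =
      ∑ l, C.I l (graphZero C κ φ g w) * graphZero C κ φ (fun j i => p (Sum.inr l) (g j i))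
        (fun j i => p (Sum.inr l) (w j i)) := by
  have h2 : ∀ m : S, 2 • m = 0 → m = 0 := fun m hm => h6 m (by
    rw [show 6 = 3 * 2 by norm_num, mul_smul, hm, smul_zero])
  -- Up to factors of two, `V`, `E` and `K` are the values on the graph of the derivatives of the
  -- Hamiltonian along the odd momenta, the base coordinates and p.
  set V : Fin d → S := fun k => graphOne C κ φ (g k) (w k) with hV
  set E : Fin d → S := fun k => graphZero C κ φ (fun j i => p (Sum.inl k) (g j i))
    (fun j i => p (Sum.inl k) (w j i)) with hE
  set K : Fin d → S := fun k => graphZero C κ φ (fun j i => p (Sum.inr k) (g j i))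
    (fun j i => p (Sum.inr k) (w j i)) with hK
  have hVo : ∀ k, C.s (V k) = -V k := fun k => hκ.graphOne_odd _ _
  have hKc : ∀ l x, K l * x = x * K l := fun l x => C.even_comm _ _ (hκ.graphZero_even _ _)
  have hjac : ∑ k, E k * V k + ∑ l, (∑ j, C.D j φ * κ (g j l)) * K l = 0 := by
    -- The terms free of second derivatives of φ form a trilinear contraction; the values of κ are
    -- central, so they can act as scalars.
    let _ : Algebra Z S := κ.toAlgebra' hκ.commute
    have hs : ∀ (z : Z) (x : S), z • x = κ z * x := fun z x => rfl
    have := jacobi_contraction (Z := Z) h6 (fun j => C.D j φ) C.ξ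
      (fun a b => by rw [C.odd_comm _ _ (hκ.D_odd a), hκ.D_odd, neg_mul])
      (fun a b => by rw [C.odd_comm _ _ (hκ.D_odd a), C.s_ξ, neg_mul])
      (fun a b => by rw [C.odd_comm _ _ (C.s_ξ a), C.s_ξ, neg_mul]) g w
      (fun k i j => p (Sum.inl k) (g i j)) (fun k i j => p (Sum.inl k) (w i j))
      (fun k i j => p (Sum.inr k) (g i j)) (fun k i j => p (Sum.inr k) (w i j)) hw
      (fun k i j => by rw [hw i j, map_neg]) jxxx jxxp jxpp
    simp only [hs] at this
    have e1 : ∀ z a b, κ z * (C.D a φ * b) = C.D a φ * (κ z * b) := fun z a b => by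
      rw [← mul_assoc, hκ.commute, mul_assoc]
    have e2 : ∀ z a, κ z * C.D a φ = C.D a φ * κ z := fun z a => hκ.commute _ _
    simp only [e1, e2] at this
    rw [← this]
    simp only [hE, hV, hK, graphZero, graphOne, Finset.mul_sum]
  -- Symmetric second derivatives are paired with anticommuting odd factors.
  have hDD : ∑ k, (∑ j, C.D k (C.D j φ) * V j) * V k = 0 := by
    simp only [Finset.sum_mul]
    refine sum_antisymm_eq_zero h2 _ fun a b => ?_
    rw [C.D_D a b, mul_assoc, mul_assoc, C.odd_comm _ (V a) (hVo b), hVo, neg_mul, mul_neg]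
  -- Here the parities are reversed: antisymmetric second contractions are paired with central even
  -- factors.
  have hII : ∑ l, (∑ m, K m * C.I l (C.I m φ)) * K l = 0 := by
    simp only [Finset.sum_mul]
    refine sum_antisymm_eq_zero h2 _ fun a b => ?_
    rw [C.I_I a b, mul_neg, neg_mul, mul_assoc, ← hKc a, hKc b, mul_assoc]
  -- Mixed second derivatives occur on both sides of the equation and match because D and I commute.
  have hcross : ∑ k, (∑ l, K l * C.D k (C.I l φ)) * V k =
      ∑ l, (∑ j, C.I l (C.D j φ) * V j) * K l := by
    simp only [Finset.sum_mul]
    rw [Finset.sum_comm]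
    refine Finset.sum_congr rfl fun l _ => Finset.sum_congr rfl fun k _ => ?_
    rw [mul_assoc, hKc, C.D_I]
  have eD : ∀ k, C.D k (graphZero C κ φ g w) = 2 • ∑ j, C.D k (C.D j φ) * V j + E k +
      ∑ l, K l * C.D k (C.I l φ) := fun k => hκ.D_graphZero k g w hw
  have eI : ∀ l, C.I l (graphZero C κ φ g w) = 2 • ∑ j, C.I l (C.D j φ) * V j -
      2 • ∑ j, C.D j φ * κ (g j l) + ∑ m, K m * C.I l (C.I m φ) :=
    fun l => hκ.I_graphZero l g w hw
  change 2 • ∑ k, C.D k (graphZero C κ φ g w) * V k = ∑ l, C.I l (graphZero C κ φ g w) * K l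
  simp only [eD, eI, add_mul, sub_mul, smul_mul_assoc, Finset.sum_add_distrib,
    Finset.sum_sub_distrib, ← Finset.smul_sum, hDD, hII, hcross]
  rw [eq_neg_of_add_eq_zero_left hjac]
  simp only [smul_zero, zero_add, add_zero, smul_add, smul_neg]
  abel

end IsGraphChain
end SuperCalculus
end PInftyForms
end

noncomputable section

namespace PInftyForms

namespace SuperCalculus

variable {𝕜 : Type*} [Field 𝕜] {d : ℕ} {B : Type*} [Ring B] [Algebra 𝕜 B]

/-! ### Power series over a superalgebra -/

/-- A linear map acting on the coefficients of power series. -/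
def coeffwise (f : B →ₗ[𝕜] B) : PowerSeries B →ₗ[𝕜] PowerSeries B where
  toFun F := PowerSeries.mk fun n => f (PowerSeries.coeff n F)
  map_add' F G := by ext n; simp
  map_smul' r F := by ext n; simp

theorem coeff_coeffwise (f : B →ₗ[𝕜] B) (n : ℕ) (F : PowerSeries B) :
    PowerSeries.coeff n (coeffwise f F) = f (PowerSeries.coeff n F) := by
  simp [coeffwise]

theorem coeffwise_C (f : B →ₗ[𝕜] B) (x : B) :
    coeffwise f (PowerSeries.C x) = PowerSeries.C (f x) := by
  ext n
  rw [coeff_coeffwise, PowerSeries.coeff_C, PowerSeries.coeff_C]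
  split_ifs <;> simp

/-- The calculus on power series with coefficients in a superalgebra. -/
def powerSeries (C : SuperCalculus 𝕜 d B) : SuperCalculus 𝕜 d (PowerSeries B) where
  s := coeffwise C.s
  D i := coeffwise (C.D i)
  I i := coeffwise (C.I i)
  ξ i := PowerSeries.C (C.ξ i)
  s_one := by
    rw [show (1 : PowerSeries B) = PowerSeries.C 1 by simp, coeffwise_C, C.s_one]
  s_mul F G := by
    ext n
    simp only [coeff_coeffwise, PowerSeries.coeff_mul, map_sum, C.s_mul]
  s_s F := by ext n; simp only [coeff_coeffwise, C.s_s]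
  even_comm F G hF := by
    ext n
    rw [PowerSeries.coeff_mul, PowerSeries.coeff_mul, ← Finset.Nat.sum_antidiagonal_swap]
    refine Finset.sum_congr rfl fun x _ => C.even_comm _ _ ?_
    have := congrArg (PowerSeries.coeff x.swap.1) hF
    rwa [coeff_coeffwise] at this
  odd_comm F G hF := by
    ext n
    rw [PowerSeries.coeff_mul, PowerSeries.coeff_mul, ← Finset.Nat.sum_antidiagonal_swap]
    refine Finset.sum_congr rfl fun x _ => ?_
    have := congrArg (PowerSeries.coeff x.swap.1) hF
    rw [coeff_coeffwise, map_neg] at this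
    rw [coeff_coeffwise]
    exact C.odd_comm _ _ this
  D_mul i F G := by
    ext n
    simp only [coeff_coeffwise, PowerSeries.coeff_mul, map_sum, C.D_mul, map_add,
      Finset.sum_add_distrib]
  D_s i F := by ext n; simp only [coeff_coeffwise, C.D_s]
  I_mul i F G := by
    ext n
    simp only [coeff_coeffwise, PowerSeries.coeff_mul, map_sum, C.I_mul, map_add,
      Finset.sum_add_distrib]
  I_s i F := by ext n; simp only [coeff_coeffwise, C.I_s, map_neg]
  D_D i j F := by ext n; simp only [coeff_coeffwise, C.D_D i j]
  D_I i j F := by ext n; simp only [coeff_coeffwise, C.D_I i j]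
  I_I i j F := by
    ext n
    rw [coeff_coeffwise, coeff_coeffwise, map_neg, coeff_coeffwise, coeff_coeffwise, C.I_I i j]
  s_ξ i := by rw [coeffwise_C, C.s_ξ, map_neg]
  D_ξ i j := by rw [coeffwise_C, C.D_ξ, map_zero]
  I_ξ i j := by rw [coeffwise_C, C.I_ξ]; split_ifs <;> simp

/-! ### The homotopy Jacobi identity on odd elements -/

open MvPolynomial in
/-- Derivations `∂ k` of a ring extended to polynomials over it. -/
structure IsCoeffDerivation {A : Type*} [CommRing A] (δ : Fin d → A → A)
    (δp : Fin d → MvPolynomial (Fin d) A →+ MvPolynomial (Fin d) A) : Prop where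
  map_C : ∀ k a, δp k (C a) = C (δ k a)
  map_X : ∀ k l, δp k (X l) = 0
  leibniz : ∀ k P Q, δp k (P * Q) = δp k P * Q + P * δp k Q

variable {A : Type*} [CommRing A] {C : SuperCalculus 𝕜 d B} {ι : A →+* B} {φ : B}
  {δ : Fin d → A → A} {δp : Fin d → MvPolynomial (Fin d) A →+ MvPolynomial (Fin d) A}

/-- A ring of scalars compatible with the calculus. -/
structure IsScalarMap (C : SuperCalculus 𝕜 d B) (δ : Fin d → A → A) (ι : A →+* B) : Prop where
  even : ∀ a, C.s (ι a) = ι a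
  D_apply : ∀ k a, C.D k (ι a) = ι (δ k a)
  I_apply : ∀ k a, C.I k (ι a) = 0

open MvPolynomial in
theorem IsGraphEval.D_apply {ev : MvPolynomial (Fin d) A →+* B} (hev : IsGraphEval C ι φ ev)
    (hι : IsScalarMap C δ ι) (hδ : IsCoeffDerivation δ δp) (k : Fin d)
    (P : MvPolynomial (Fin d) A) :
    C.D k (ev P) = ev (δp k P) + ∑ l, ev (pderiv l P) * C.D k (C.I l φ) := by
  induction P using MvPolynomial.induction_on with
  | C a => simp [hev.map_C, hι.D_apply, hδ.map_C]
  | add P Q hP hQ => simp only [map_add, hP, hQ, add_mul, Finset.sum_add_distrib]; abel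
  | mul_X P i hP =>
    rw [map_mul, C.D_mul, hP, hδ.leibniz, hδ.map_X, mul_zero, add_zero, map_mul, hev.map_X, add_mul]
    have hc : ∀ x, C.I i φ * x = x * C.I i φ := fun x => by rw [← hev.map_X, hev.commute]
    simp only [Derivation.leibniz, pderiv_X, smul_eq_mul, map_add, map_mul, hev.map_X, add_mul,
      Finset.sum_add_distrib, Finset.sum_mul, mul_assoc, hc]
    have : ∑ x, ev P * (ev (Pi.single (M := fun _ => MvPolynomial (Fin d) A) x 1 i) *
        C.D k (C.I x φ)) = ev P * C.D k (C.I i φ) := by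
      rw [Finset.sum_eq_single i]
      · simp
      · intro b _ hb; rw [Pi.single_eq_of_ne hb.symm]; simp
      · simp
    rw [this]
    abel

open MvPolynomial in
theorem IsGraphEval.I_apply {ev : MvPolynomial (Fin d) A →+* B} (hev : IsGraphEval C ι φ ev)
    (hι : IsScalarMap C δ ι) (k : Fin d) (P : MvPolynomial (Fin d) A) :
    C.I k (ev P) = ∑ l, ev (pderiv l P) * C.I k (C.I l φ) := by
  induction P using MvPolynomial.induction_on with
  | C a => simp [hev.map_C, hι.I_apply]
  | add P Q hP hQ => simp only [map_add, hP, hQ, add_mul, Finset.sum_add_distrib]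
  | mul_X P i hP =>
    rw [map_mul, C.I_mul, hP, hev.even, hev.map_X]
    have hc : ∀ x, C.I i φ * x = x * C.I i φ := fun x => by rw [← hev.map_X, hev.commute]
    simp only [Derivation.leibniz, pderiv_X, smul_eq_mul, map_add, map_mul, hev.map_X, add_mul,
      Finset.sum_add_distrib, Finset.sum_mul, mul_assoc, hc]
    have : ∑ x, ev P * (ev (Pi.single (M := fun _ => MvPolynomial (Fin d) A) x 1 i) *
        C.I k (C.I x φ)) = ev P * C.I k (C.I i φ) := by
      rw [Finset.sum_eq_single i]
      · simp
      · intro b _ hb; rw [Pi.single_eq_of_ne hb.symm]; simp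
      · simp
    rw [this]
    abel

/-- An additive map acting on the coefficients of power series. -/
def coeffwiseAdd {R : Type*} [CommRing R] (f : R →+ R) : PowerSeries R →+ PowerSeries R where
  toFun F := PowerSeries.mk fun n => f (PowerSeries.coeff n F)
  map_zero' := by ext n; simp
  map_add' F G := by ext n; simp

theorem coeff_coeffwiseAdd {R : Type*} [CommRing R] (f : R →+ R) (n : ℕ) (F : PowerSeries R) :
    PowerSeries.coeff n (coeffwiseAdd f F) = f (PowerSeries.coeff n F) := by
  simp [coeffwiseAdd]

/-- The derivatives along base and fibre of formal functions on the cotangent bundle. -/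
def formalDeriv (δp : Fin d → MvPolynomial (Fin d) A →+ MvPolynomial (Fin d) A) :
    Fin d ⊕ Fin d → PowerSeries (MvPolynomial (Fin d) A) →+ PowerSeries (MvPolynomial (Fin d) A) :=
  Sum.elim (fun k => coeffwiseAdd (δp k))
    fun l => coeffwiseAdd (MvPolynomial.pderiv l).toLinearMap.toAddMonoidHom

/-- All operations act coefficientwise in t, with φ as a constant series, so the master equation can
be applied to the whole formal series at once. -/
theorem IsGraphEval.isGraphChain {ev : MvPolynomial (Fin d) A →+* B}
    (hev : IsGraphEval C ι φ ev) (hφ : C.Par 1 φ)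
    (hι : IsScalarMap C δ ι) (hδ : IsCoeffDerivation δ δp) :
    IsGraphChain C.powerSeries (PowerSeries.C φ) (PowerSeries.map ev) (formalDeriv δp) where
  odd := by
    rw [par_odd] at hφ ⊢
    change coeffwise C.s _ = _
    rw [coeffwise_C, hφ, map_neg]
  even F := by
    change coeffwise C.s _ = _
    ext n
    rw [coeff_coeffwise, PowerSeries.coeff_map, hev.even]
  D_apply k F := by
    change coeffwise (C.D k) _ = _ + ∑ l, _ * coeffwise (C.D k) (coeffwise (C.I l) _)
    simp only [coeffwise_C]
    ext n
    simp only [coeff_coeffwise, PowerSeries.coeff_map, hev.D_apply hι hδ, formalDeriv, Sum.elim_inl,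
      Sum.elim_inr, map_add, map_sum, PowerSeries.coeff_mul_C, coeff_coeffwiseAdd]
    rfl
  I_apply k F := by
    change coeffwise (C.I k) _ = ∑ l, _ * coeffwise (C.I k) (coeffwise (C.I l) _)
    simp only [coeffwise_C]
    ext n
    simp only [coeff_coeffwise, PowerSeries.coeff_map, hev.I_apply hι, formalDeriv,
      Sum.elim_inr, map_sum, PowerSeries.coeff_mul_C, coeff_coeffwiseAdd]
    rfl

/-- The formal bivector with blocks `-w` and `g` is homogeneous and satisfies the Jacobi
identity. -/
structure IsFormalPoisson (δp : Fin d → MvPolynomial (Fin d) A →+ MvPolynomial (Fin d) A)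
    (g w : Fin d → Fin d → PowerSeries (MvPolynomial (Fin d) A)) : Prop where
  skew : ∀ i j, w i j = -w j i
  hom_g : ∀ (N : ℕ) j i, HomDeg N (PowerSeries.coeff N (g j i))
  hom_w : ∀ (N : ℕ) j i, HomDeg ((N : ℤ) - 1) (PowerSeries.coeff N (w j i))
  xxx : ∀ i j m, ∑ k, (w i k * formalDeriv δp (Sum.inl k) (w j m) +
      w j k * formalDeriv δp (Sum.inl k) (w m i) + w m k * formalDeriv δp (Sum.inl k) (w i j)) =
    ∑ l, (g i l * formalDeriv δp (Sum.inr l) (w j m) +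
      g j l * formalDeriv δp (Sum.inr l) (w m i) + g m l * formalDeriv δp (Sum.inr l) (w i j))
  xxp : ∀ i j m, ∑ l, (g i l * formalDeriv δp (Sum.inr l) (g j m) -
        g j l * formalDeriv δp (Sum.inr l) (g i m)) +
      ∑ k, g k m * formalDeriv δp (Sum.inl k) (w i j) =
    ∑ k, (w i k * formalDeriv δp (Sum.inl k) (g j m) -
      w j k * formalDeriv δp (Sum.inl k) (g i m))
  xpp : ∀ i j m, ∑ k, (g k j * formalDeriv δp (Sum.inl k) (g i m) -
    g k m * formalDeriv δp (Sum.inl k) (g i j)) = 0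

/-- The coefficient of `t^N` of a matrix of formal functions. -/
def coeffMatrix {R : Type*} [CommRing R] (N : ℕ) (g : Fin d → Fin d → PowerSeries R) :
    Fin d → Fin d → R := fun j i => PowerSeries.coeff N (g j i)

theorem coeff_graphOne {R : Type*} [CommRing R] (ev : R →+* B) (N : ℕ)
    (g w : Fin d → PowerSeries R) :
    PowerSeries.coeff N (graphOne C.powerSeries (PowerSeries.map ev) (PowerSeries.C φ) g w) =
      graphOne C ev φ (fun i => PowerSeries.coeff N (g i)) (fun i => PowerSeries.coeff N (w i)) := by
  have h1 : ∀ k, C.powerSeries.D k (PowerSeries.C φ) = PowerSeries.C (C.D k φ) :=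
    fun k => coeffwise_C _ _
  have h2 : ∀ k, C.powerSeries.ξ k = PowerSeries.C (C.ξ k) := fun k => rfl
  simp [graphOne, h1, h2, PowerSeries.coeff_mul_C, PowerSeries.coeff_C_mul]

theorem coeff_graphZero {R : Type*} [CommRing R] (ev : R →+* B) (N : ℕ)
    (g w : Fin d → Fin d → PowerSeries R) :
    PowerSeries.coeff N (graphZero C.powerSeries (PowerSeries.map ev) (PowerSeries.C φ) g w) =
      graphZero C ev φ (coeffMatrix N g) (coeffMatrix N w) := by
  have h1 : ∀ k, C.powerSeries.D k (PowerSeries.C φ) = PowerSeries.C (C.D k φ) :=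
    fun k => coeffwise_C _ _
  have h2 : ∀ k, C.powerSeries.ξ k = PowerSeries.C (C.ξ k) := fun k => rfl
  simp only [graphZero, h1, h2, map_add, map_nsmul, map_sum, Finset.mul_sum,
    PowerSeries.coeff_C_mul, PowerSeries.coeff_mul_C, PowerSeries.coeff_map, coeffMatrix]

/-- The Jacobi identity of the formal bivector mixes orders in t. Taking the coefficient of t^N
turns products into convolutions, and the two orders become the arities, less one, of the inner and
the outer bracket. -/
theorem master_coeff {g w : Fin d → Fin d → PowerSeries (MvPolynomial (Fin d) A)}
    (h6 : ∀ m : B, 6 • m = 0 → m = 0)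
    (hP : IsFormalPoisson δp g w) {ev : MvPolynomial (Fin d) A →+* B}
    (hev : IsGraphEval C ι φ ev) (hφ : C.Par 1 φ)
    (hι : IsScalarMap C δ ι) (hδ : IsCoeffDerivation δ δp) (N : ℕ) :
    ∑ x ∈ Finset.HasAntidiagonal.antidiagonal N,
      (2 • ∑ k, C.D k (graphZero C ev φ (coeffMatrix x.1 g) (coeffMatrix x.1 w)) *
          graphOne C ev φ (coeffMatrix x.2 g k) (coeffMatrix x.2 w k) -
        ∑ l, C.I l (graphZero C ev φ (coeffMatrix x.1 g) (coeffMatrix x.1 w)) *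
          graphZero C ev φ (fun j i => MvPolynomial.pderiv l (coeffMatrix x.2 g j i))
            (fun j i => MvPolynomial.pderiv l (coeffMatrix x.2 w j i))) = 0 := by
  have h := (hev.isGraphChain hφ hι hδ).master
    (fun m hm => by
      ext n
      refine h6 _ ?_
      have := congrArg (PowerSeries.coeff n) hm
      rwa [map_nsmul, map_zero] at this) g w hP.skew hP.xxx hP.xxp hP.xpp
  have h' := congrArg (PowerSeries.coeff N) h
  have hD : ∀ k, C.powerSeries.D k = coeffwise (C.D k) := fun k => rfl
  have hI : ∀ k, C.powerSeries.I k = coeffwise (C.I k) := fun k => rfl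
  rw [map_nsmul, map_sum, map_sum] at h'
  simp only [PowerSeries.coeff_mul, hD, hI, coeff_coeffwise, coeff_graphOne, coeff_graphZero] at h'
  rw [Finset.sum_comm, Finset.sum_comm (s := Finset.univ)] at h'
  rw [Finset.sum_sub_distrib, ← Finset.smul_sum, sub_eq_zero]
  refine h'.trans ?_
  refine Finset.sum_congr rfl fun x _ => Finset.sum_congr rfl fun l _ => ?_
  congr 2 <;>
  · ext j i
    simp [coeffMatrix, formalDeriv, coeff_coeffwiseAdd]

/-- This is the shape of the outer bracket: an even entry, the value of the inner bracket, followed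
by copies of φ. The first slot is expanded by hand and the others collapse to values on the graph.
-/
theorem two_smul_multi_head {g w : Fin d → Fin d → MvPolynomial (Fin d) A} {m : ℕ}
    (hg : ∀ j i, HomDeg m (g j i)) (hw : ∀ j i, HomDeg ((m : ℤ) - 1) (w j i))
    {ev : MvPolynomial (Fin d) A →+* B} (hev : IsGraphEval C ι φ ev) (hφ : C.Par 1 φ)
    {ψ : B} (hψ : C.Par 0 ψ) :
    2 • C.multi (m + 1) (m + 1) (symbolZero C ι g w) (Fin.cons ψ fun _ => φ) =
      ((-1) ^ (m + 1) * m.factorial : ℤ) •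
        (2 • ∑ k, C.D k ψ * graphOne C ev φ (g k) (w k) -
          ∑ l, C.I l ψ * graphZero C ev φ (fun j i => MvPolynomial.pderiv l (g j i))
            (fun j i => MvPolynomial.pderiv l (w j i))) := by
  rw [multi_succ, Fintype.sum_sum_type]
  simp only [Fin.cons_zero, Fin.tail_cons]
  have h1 : ∀ k c, C.multi m c (fun t => symbolZero C ι g w (Sum.inl k :: t)) (fun _ => φ) =
      m.factorial • graphOne C ev φ (g k) (w k) := fun k c =>
    multi_symbolOne hev hφ _ _ _ _ (hg k) (hw k)
  have h2 : ∀ l c, 2 • C.multi m c (fun t => symbolZero C ι g w (Sum.inr l :: t)) (fun _ => φ) =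
      m.factorial • graphZero C ev φ (fun j i => MvPolynomial.pderiv l (g j i))
            (fun j i => MvPolynomial.pderiv l (w j i)) := fun l c =>
    multi_symbolZero hev hφ _ _ _ _ (fun j i => (hg j i).pderiv l)
      (fun j i => by convert (hw j i).pderiv l using 1; ring)
  -- On the even element ψ each twist is a sign change. An odd index adds one more twist, which
  -- produces the relative minus sign.
  have t1 : ∀ c : ℕ, C.tw c ψ = ((-1) ^ c : ℤ) • ψ := fun c => by
    rw [hψ.tw_eq]
    congr 1
    rcases Nat.even_or_odd c with hc | hc
    · rw [hc.neg_one_pow, Int.negOnePow_even]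
      · rfl
      · simpa using hc
    · rw [hc.neg_one_pow, Int.negOnePow_odd]
      · rfl
      · simpa using hc
  have e0 : ∀ k, indexDeg (Sum.inl k : Fin d ⊕ Fin d) = 0 := fun _ => rfl
  have e1 : ∀ k, indexDeg (Sum.inr k : Fin d ⊕ Fin d) = 1 := fun _ => rfl
  have h2' : 2 • ∑ l, C.dz (Sum.inr l) (C.tw (m + 1 + indexDeg (Sum.inr l : Fin d ⊕ Fin d)) ψ) *
      C.multi m (m + 1 + indexDeg (Sum.inr l : Fin d ⊕ Fin d))
        (fun t => symbolZero C ι g w (Sum.inr l :: t)) (fun _ => φ) =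
      ((-1) ^ (m + 1 + 1) * m.factorial : ℤ) • ∑ l, C.I l ψ *
        graphZero C ev φ (fun j i => MvPolynomial.pderiv l (g j i))
            (fun j i => MvPolynomial.pderiv l (w j i)) := by
    rw [Finset.smul_sum, Finset.smul_sum]
    refine Finset.sum_congr rfl fun l _ => ?_
    rw [← mul_smul_comm, h2, t1, e1, map_zsmul, smul_mul_assoc, mul_smul_comm, mul_smul,
      natCast_zsmul]
    rfl
  rw [smul_add, h2']
  simp only [h1, t1, e0, map_zsmul, smul_mul_assoc, mul_smul_comm, ← Finset.smul_sum, dz,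
    Sum.elim_inl, add_zero]
  rw [pow_succ _ (m + 1)]
  module

/-- The brackets generated by a formal Poisson structure. -/
def brackets (C : SuperCalculus 𝕜 d B) (ι : A →+* B)
    (g w : Fin d → Fin d → PowerSeries (MvPolynomial (Fin d) A)) :
    (n : ℕ) → MultilinearMap 𝕜 (fun _ : Fin n => B) B
  | 0 => 0
  -- The coefficient of t^N has p-degree N in g and N - 1 in w. With one or two odd momenta this
  -- makes N + 1 momenta, one for each slot; the counter starts at the arity for the sake of the
  -- derivation property.
  | N + 1 => sgnTri (N + 1) •
      C.multi (N + 1) (N + 1) (symbolZero C ι (coeffMatrix N g) (coeffMatrix N w))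

theorem sgnTri_succ (m : ℕ) : sgnTri (m + 1) = sgnTri m * (-1) ^ (m + 1) := by
  rw [sgnTri, sgnTri, ← pow_add]
  congr 1
  rw [show (m + 1) * (m + 1 + 1) = m * (m + 1) + (m + 1) * 2 by ring,
    Nat.add_mul_div_right _ _ (by norm_num)]

/-- The quadratic exponent fails to be additive by pq, and this defect is the sign (-1)^{k(n-k)} in
the homotopy Jacobi identity. -/
theorem sgnTri_add (p q : ℕ) : sgnTri (p + q) = sgnTri p * sgnTri q * (-1) ^ (p * q) := by
  induction q with
  | zero => simp [sgnTri]
  | succ q ih =>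
    rw [← add_assoc, sgnTri_succ, ih, sgnTri_succ, mul_add, pow_add _ _ (p * 1), mul_one,
      add_assoc p, pow_add _ p]
    ring

theorem par_graphZero {G W : Fin d → Fin d → MvPolynomial (Fin d) A}
    {ev : MvPolynomial (Fin d) A →+* B} (hev : IsGraphEval C ι φ ev) (hφ : C.Par 1 φ) :
    C.Par 0 (graphZero C ev φ G W) := by
  have he : ∀ P, C.Par 0 (ev P) := fun P => C.par_even.2 (hev.even P)
  have hx : ∀ k, C.Par 1 (C.ξ k) := fun k => C.par_odd.2 (C.s_ξ k)
  have hD : ∀ k, C.Par 1 (C.D k φ) := fun k => hφ.D k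
  unfold graphZero
  have h2 : ∀ x, C.Par 0 x → C.Par 0 (2 • x) := fun x hx => by
    rw [two_nsmul]
    exact hx.add hx
  exact (h2 _ (Par.sum fun j _ => ((hD j).mul (Par.sum (a := 1) fun i _ =>
    ((he _).mul (hx i)).congr (by decide))).congr (by decide))).add
    (Par.sum fun j _ => ((hD j).mul (Par.sum (a := 1) fun i _ =>
      ((hD i).mul (he _)).congr (by decide))).congr (by decide))

theorem cons_natSmul {n : ℕ} (F : MultilinearMap 𝕜 (fun _ : Fin (n + 1) => B) B) (m : ℕ) (x : B)
    (v : Fin n → B) : m • F (Fin.cons x v) = F (Fin.cons (m • x) v) := by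
  rw [← Nat.cast_smul_eq_nsmul 𝕜, ← Nat.cast_smul_eq_nsmul 𝕜, F.cons_smul]

theorem cons_intSmul {n : ℕ} (F : MultilinearMap 𝕜 (fun _ : Fin (n + 1) => B) B) (m : ℤ) (x : B)
    (v : Fin n → B) : F (Fin.cons (m • x) v) = m • F (Fin.cons x v) := by
  rw [← Int.cast_smul_eq_zsmul 𝕜, ← Int.cast_smul_eq_zsmul 𝕜, F.cons_smul]

/-- The factorials from Euler's formula cancel those in the Jacobi expression, and the triangular
signs combine to one common sign. What is left is a coefficient of the master equation. -/
theorem brackets_jacobi_diagonal [CharZero 𝕜]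
    {g w : Fin d → Fin d → PowerSeries (MvPolynomial (Fin d) A)}
    (hP : IsFormalPoisson δp g w) {ev : MvPolynomial (Fin d) A →+* B}
    (hev : IsGraphEval C ι φ ev) (hφ : C.Par 1 φ)
    (hι : IsScalarMap C δ ι) (hδ : IsCoeffDerivation δ δp) (n : ℕ) (hn : 1 ≤ n) :
    ∑ k : Fin n, ((-1 : 𝕜) ^ ((k.val + 1) * (n - (k.val + 1))) *
      (((k.val + 1).factorial * (n - (k.val + 1)).factorial : ℕ) : 𝕜)⁻¹) •
      brackets C ι g w (n - (k.val + 1) + 1)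
        (Fin.cons (brackets C ι g w (k.val + 1) fun _ => φ) fun _ => φ) = 0 := by
  set Z : ℕ → ℕ → B := fun k q =>
    2 • ∑ l, C.D l (graphZero C ev φ (coeffMatrix k g) (coeffMatrix k w)) *
          graphOne C ev φ (coeffMatrix q g l) (coeffMatrix q w l) -
        ∑ l, C.I l (graphZero C ev φ (coeffMatrix k g) (coeffMatrix k w)) *
          graphZero C ev φ (fun j i => MvPolynomial.pderiv l (coeffMatrix q g j i))
            (fun j i => MvPolynomial.pderiv l (coeffMatrix q w j i)) with hZ
  -- The factor 4 clears the two halves, one from the symbol of each bracket.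
  have key : ∀ k q : ℕ, (4 : 𝕜) • (((-1 : 𝕜) ^ ((k + 1) * q) *
      (((k + 1).factorial * q.factorial : ℕ) : 𝕜)⁻¹) •
      brackets C ι g w (q + 1) (Fin.cons (brackets C ι g w (k + 1) fun _ => φ) fun _ => φ)) =
      sgnTri (k + 1 + q) • Z k q := by
    intro k q
    have h1 : 2 • C.multi (k + 1) (k + 1)
        (symbolZero C ι (coeffMatrix k g) (coeffMatrix k w)) (fun _ => φ) = (k + 1).factorial •
          graphZero C ev φ (coeffMatrix k g) (coeffMatrix k w) :=
      multi_symbolZero hev hφ _ _ _ _ (fun j i => by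
        rw [Nat.cast_succ, add_sub_cancel_right]; exact hP.hom_g k j i)
        (fun j i => by
          rw [Nat.cast_succ, show (k : ℤ) + 1 - 2 = k - 1 by ring]; exact hP.hom_w k j i)
    have h2 := two_smul_multi_head (C := C) (g := coeffMatrix q g) (w := coeffMatrix q w) (hP.hom_g q) (hP.hom_w q) hev hφ
      (par_graphZero (G := coeffMatrix k g) (W := coeffMatrix k w) hev hφ)
    have h3 : 4 • C.multi (q + 1) (q + 1) (symbolZero C ι (coeffMatrix q g) (coeffMatrix q w))
        (Fin.cons (C.multi (k + 1) (k + 1)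
          (symbolZero C ι (coeffMatrix k g) (coeffMatrix k w)) fun _ => φ) fun _ => φ) =
        ((-1) ^ (q + 1) * (q.factorial * (k + 1).factorial : ℕ) : ℤ) • Z k q := by
      rw [show (4 : ℕ) = 2 * 2 from rfl, mul_smul, cons_natSmul, h1, ← cons_natSmul, smul_comm, h2,
        hZ]
      simp only [smul_smul, ← natCast_zsmul]
      congr 1
      push_cast
      ring
    have h4 : brackets C ι g w (q + 1) (Fin.cons (brackets C ι g w (k + 1) fun _ => φ) fun _ => φ) =
        (sgnTri (q + 1) * sgnTri (k + 1)) • C.multi (q + 1) (q + 1)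
          (symbolZero C ι (coeffMatrix q g) (coeffMatrix q w))
        (Fin.cons (C.multi (k + 1) (k + 1)
          (symbolZero C ι (coeffMatrix k g) (coeffMatrix k w)) fun _ => φ) fun _ => φ) := by
      rw [brackets, brackets, smul_apply, smul_apply, cons_intSmul,
        smul_smul]
    have hf : (((k + 1).factorial * q.factorial : ℕ) : 𝕜) ≠ 0 :=
      Nat.cast_ne_zero.2 (mul_ne_zero (Nat.factorial_ne_zero _) (Nat.factorial_ne_zero _))
    have h5 : (4 : 𝕜) • C.multi (q + 1) (q + 1)
          (symbolZero C ι (coeffMatrix q g) (coeffMatrix q w))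
        (Fin.cons (C.multi (k + 1) (k + 1)
          (symbolZero C ι (coeffMatrix k g) (coeffMatrix k w)) fun _ => φ) fun _ => φ) =
        ((-1) ^ (q + 1) * (((k + 1).factorial * q.factorial : ℕ) : 𝕜)) • Z k q := by
      have := h3
      rw [← Int.cast_smul_eq_zsmul 𝕜, ← Nat.cast_smul_eq_nsmul 𝕜] at this
      rw [mul_comm (k + 1).factorial]
      exact_mod_cast this
    rw [h4, ← Int.cast_smul_eq_zsmul 𝕜, smul_comm (4 : 𝕜), smul_comm (4 : 𝕜), h5,
      ← Int.cast_smul_eq_zsmul 𝕜, smul_smul, smul_smul, sgnTri_add (k + 1) q, sgnTri_succ q]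
    congr 1
    generalize (((k + 1).factorial * q.factorial : ℕ) : 𝕜) = F at hf
    have hs : ((-1 : 𝕜) ^ (q + 1)) * (-1) ^ (q + 1) = 1 := by
      rw [← pow_add, Even.neg_one_pow ⟨_, rfl⟩]
    push_cast
    calc _ = (sgnTri (k + 1) : 𝕜) * sgnTri q * (-1) ^ ((k + 1) * q) *
          ((-1 : 𝕜) ^ (q + 1) * (-1) ^ (q + 1)) * (F⁻¹ * F) := by ring
      _ = _ := by rw [hs, inv_mul_cancel₀ hf, mul_one, mul_one]
  have hsum : ∑ k : Fin n, Z k.val (n - (k.val + 1)) = 0 := by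
    -- The n-ary identity sits in order N = n - 1 of t, since the brackets of arities k + 1 and n -
    -- k use the orders k and n - 1 - k.
    obtain ⟨N, rfl⟩ : ∃ N, n = N + 1 := ⟨n - 1, by omega⟩
    have := master_coeff (fun m hm => ?_) hP hev hφ hι hδ N
    · rw [Finset.Nat.sum_antidiagonal_eq_sum_range_succ_mk, Finset.sum_range] at this
      simpa [hZ] using this
    · have : (6 : 𝕜) • m = 0 := by rw [← hm]; module
      exact (smul_eq_zero.1 this).resolve_left (by norm_num)
  have h4 : (4 : 𝕜) ≠ 0 := by norm_num
  rw [← (IsUnit.mk0 _ h4).smul_eq_zero, Finset.smul_sum, Finset.sum_congr rfl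
    (fun k _ => key k.val (n - (k.val + 1)))]
  rw [← smul_zero (sgnTri n), ← hsum, Finset.smul_sum]
  refine Finset.sum_congr rfl fun k _ => ?_
  rw [show k.val + 1 + (n - (k.val + 1)) = n by omega]

end SuperCalculus
end PInftyForms
end

/-! ### Nested brackets and the passage to odd arguments -/

noncomputable section

namespace PInftyForms

open MvPolynomial

/-- The composition `f₂ (f₁ (v₁, …, v_p), v_{p+1}, …, v_{p+q})`. -/
def nested {𝕜 V : Type*} [CommRing 𝕜] [AddCommGroup V] [Module 𝕜 V] {p q : ℕ}
    (f₁ : MultilinearMap 𝕜 (fun _ : Fin p => V) V)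
    (f₂ : MultilinearMap 𝕜 (fun _ : Fin (q + 1) => V) V) :
    MultilinearMap 𝕜 (fun _ : Fin (p + q) => V) V :=
  (MultilinearMap.uncurrySum (N := fun _ : Fin p ⊕ Fin q => V)
    (f₂.curryLeft.compMultilinearMap f₁)).domDomCongr finSumFinEquiv

theorem nested_apply {𝕜 V : Type*} [CommRing 𝕜] [AddCommGroup V] [Module 𝕜 V] {p q : ℕ}
    (f₁ : MultilinearMap 𝕜 (fun _ : Fin p => V) V)
    (f₂ : MultilinearMap 𝕜 (fun _ : Fin (q + 1) => V) V) (v : Fin (p + q) → V) :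
    nested f₁ f₂ v = f₂ (Fin.cons (f₁ fun i => v (Fin.castAdd q i)) fun i => v (Fin.natAdd p i)) := by
  simp [nested, MultilinearMap.uncurrySum_apply]

namespace SuperCalculus

variable {𝕜 : Type*} [Field 𝕜] {d : ℕ} {B : Type*} [Ring B] [Algebra 𝕜 B]
  {A : Type*} [CommRing A]

/-- The symbols of the brackets. -/
def bracketSymbol (C : SuperCalculus 𝕜 d B) (ι : A →+* B)
    (g w : Fin d → Fin d → PowerSeries (MvPolynomial (Fin d) A)) :
    ℕ → List (Fin d ⊕ Fin d) → B
  | 0 => fun _ => 0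
  | N + 1 => fun l => sgnTri (N + 1) • symbolZero C ι (coeffMatrix N g) (coeffMatrix N w) l

theorem brackets_eq_multi (C : SuperCalculus 𝕜 d B) (ι : A →+* B)
    (g w : Fin d → Fin d → PowerSeries (MvPolynomial (Fin d) A)) (n : ℕ) :
    brackets C ι g w n = C.multi n n (bracketSymbol C ι g w n) := by
  ext v
  cases n with
  | zero => rfl
  | succ n => exact (multi_zsmul _ _ _ _ _).symm

theorem par_bracketSymbol {C : SuperCalculus 𝕜 d B} {ι : A →+* B} (hι : ∀ a, C.s (ι a) = ι a)
    (g w : Fin d → Fin d → PowerSeries (MvPolynomial (Fin d) A)) (n : ℕ)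
    (l : List (Fin d ⊕ Fin d)) : C.Par (0 + evenCount l) (bracketSymbol C ι g w n l) := by
  rw [zero_add]
  cases n with
  | zero => exact Par.zero _
  | succ n => exact (par_symbolZero hι _ _ l).zsmul _

theorem bracketSymbol_symm {C : SuperCalculus 𝕜 d B} {ι : A →+* B}
    (g w : Fin d → Fin d → PowerSeries (MvPolynomial (Fin d) A)) (hw : ∀ i j, w i j = -w j i)
    (n : ℕ) : SymbolSymm (bracketSymbol C ι g w n) := by
  cases n with
  | zero => intro _ _ _ _; simp [bracketSymbol]
  | succ n =>
    intro l z y l'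
    simp only [bracketSymbol]
    rw [symbolZero_symm _ _ (fun i j => by simp only [coeffMatrix]; rw [hw, map_neg]), smul_comm]

/-! ### Base change along odd parameters -/

variable {Ω : Type*} [Ring Ω] [Algebra 𝕜 Ω] {C₀ : SuperCalculus 𝕜 d Ω} {C : SuperCalculus 𝕜 d B}
  {j : Ω →ₐ[𝕜] B} {ι : A →+* Ω}

/-- A morphism of calculi. -/
structure IsMorphism (C₀ : SuperCalculus 𝕜 d Ω) (C : SuperCalculus 𝕜 d B) (j : Ω →ₐ[𝕜] B) :
    Prop where
  map_s : ∀ x, j (C₀.s x) = C.s (j x)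
  map_D : ∀ i x, j (C₀.D i x) = C.D i (j x)
  map_I : ∀ i x, j (C₀.I i x) = C.I i (j x)
  map_ξ : ∀ i, j (C₀.ξ i) = C.ξ i

namespace IsMorphism

variable (hj : IsMorphism C₀ C j)
include hj

theorem map_tw (c : ℕ) (x : Ω) : j (C₀.tw c x) = C.tw c (j x) := by
  rcases Nat.even_or_odd c with h | h
  · rw [tw_even _ h, tw_even _ h]
  · rw [tw_odd _ h, tw_odd _ h, map_neg, hj.map_s]

theorem map_dz (z : Fin d ⊕ Fin d) (x : Ω) : j (C₀.dz z x) = C.dz z (j x) := by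
  rcases z with z | z
  · exact hj.map_D z x
  · exact hj.map_I z x

theorem map_multi (n c : ℕ) (h : List (Fin d ⊕ Fin d) → Ω) (v : Fin n → Ω) :
    j (C₀.multi n c h v) = C.multi n c (fun l => j (h l)) (j ∘ v) := by
  induction n generalizing c h with
  | zero => rfl
  | succ n ih =>
    rw [multi_succ, multi_succ, map_sum]
    refine Finset.sum_congr rfl fun z _ => ?_
    rw [map_mul, ih, hj.map_dz, hj.map_tw]
    rfl

theorem map_par {a : ℤ} {x : Ω} (hx : C₀.Par a x) : C.Par a (j x) := by
  change C.s (j x) = _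
  rw [← hj.map_s, hx, map_zsmul]

omit hj in
theorem map_symbolTwo (G : MvPolynomial (Fin d) A) (l : List (Fin d ⊕ Fin d)) :
    j (symbolTwo ι G l) = symbolTwo ((j : Ω →+* B).comp ι) G l := by
  induction l generalizing G with
  | nil => rfl
  | cons z l ih => rcases z with z | z <;> simp [symbolTwo, ih]

theorem map_symbolOne (g w : Fin d → MvPolynomial (Fin d) A) (l : List (Fin d ⊕ Fin d)) :
    j (symbolOne C₀ ι g w l) = symbolOne C ((j : Ω →+* B).comp ι) g w l := by
  induction l generalizing g w with
  | nil => simp [symbolOne, hj.map_ξ]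
  | cons z l ih => rcases z with z | z <;> simp [symbolOne, ih, map_symbolTwo]

theorem map_symbolZero (g w : Fin d → Fin d → MvPolynomial (Fin d) A)
    (l : List (Fin d ⊕ Fin d)) :
    j (symbolZero C₀ ι g w l) = symbolZero C ((j : Ω →+* B).comp ι) g w l := by
  induction l generalizing g w with
  | nil => simp [symbolZero]
  | cons z l ih => rcases z with z | z <;> simp [symbolZero, ih, hj.map_symbolOne]

/-- The brackets are built from the operations of the calculus and the scalars only, hence are
natural for morphisms of calculi. -/
theorem map_brackets (g w : Fin d → Fin d → PowerSeries (MvPolynomial (Fin d) A)) (n : ℕ)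
    (v : Fin n → Ω) :
    j (brackets C₀ ι g w n v) = brackets C ((j : Ω →+* B).comp ι) g w n (j ∘ v) := by
  rw [brackets_eq_multi, brackets_eq_multi, hj.map_multi]
  congr 2
  funext l
  cases n with
  | zero => simp [bracketSymbol]
  | succ n => simp [bracketSymbol, hj.map_symbolZero]

end IsMorphism

/-- Homogeneous constants of the calculus such that multiplication by their product detects
elements of the smaller calculus. -/
structure IsParameterExtension (C₀ : SuperCalculus 𝕜 d Ω) (C : SuperCalculus 𝕜 d B)
    (j : Ω →ₐ[𝕜] B) {n : ℕ} (e : Fin n → ℤ) (ε : Fin n → B) : Prop where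
  morphism : IsMorphism C₀ C j
  par : ∀ i, C.Par (e i) (ε i)
  dz_eq_zero : ∀ i z, C.dz z (ε i) = 0
  injective : ∀ x, (List.ofFn ε).prod * j x = 0 → x = 0

theorem dz_prod_ofFn {n : ℕ} {e : Fin n → ℤ} {ε : Fin n → B} (hε : ∀ i, C.Par (e i) (ε i))
    (hd : ∀ i z, C.dz z (ε i) = 0) (z : Fin d ⊕ Fin d) : C.dz z (List.ofFn ε).prod = 0 := by
  induction n with
  | zero =>
    have h := (Par.one (C := C)).dz_mul z 1
    simpa using h
  | succ n ih =>
    rw [List.ofFn_succ, List.prod_cons, (hε 0).dz_mul, hd, ih (fun i => hε i.succ)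
      (fun i => hd i.succ)]
    simp

/-- Homogeneous constants can be pulled out of nested brackets. -/
theorem nested_multi_mul {p q : ℕ} {h₁ h₂ : List (Fin d ⊕ Fin d) → B}
    (hh : ∀ l, C.Par (0 + evenCount l) (h₁ l)) {e b : Fin (p + q) → ℤ}
    {ε v : Fin (p + q) → B} (hε : ∀ i, C.Par (e i) (ε i)) (hdε : ∀ i z, C.dz z (ε i) = 0)
    (hv : ∀ i, C.Par (b i) (v i)) :
    nested (C.multi p p h₁) (C.multi (q + 1) (q + 1) h₂) (ε * v) =
      (pullSign ((p + q + 1 : ℕ) : ℤ) e b : ℤ) • ((List.ofFn ε).prod *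
        nested (C.multi p p h₁) (C.multi (q + 1) (q + 1) h₂) v) := by
  rw [nested_apply, nested_apply]
  have h1 := multi_mul (C := C) p h₁ (fun i => hε (Fin.castAdd q i)) (fun i => hdε (Fin.castAdd q i))
    (fun i => hv (Fin.castAdd q i))
  have hp := par_multi (C := C) p h₁ 0 (fun l _ => hh l) (fun i => hv (Fin.castAdd q i))
  -- The inner value enters the outer bracket as a single argument: its constant is the product of
  -- the inner constants, and its parity is the one computed by `par_multi`.
  have h2 := multi_mul (C := C) (q + 1) h₂
    (e := Fin.cons (∑ i, e (Fin.castAdd q i)) fun i => e (Fin.natAdd p i))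
    (b := Fin.cons (p + ∑ i, b (Fin.castAdd q i)) fun i => b (Fin.natAdd p i))
    (ε := Fin.cons (List.ofFn fun i => ε (Fin.castAdd q i)).prod fun i => ε (Fin.natAdd p i))
    (v := Fin.cons (C.multi p p h₁ fun i => v (Fin.castAdd q i)) fun i => v (Fin.natAdd p i))
    (Fin.cases (by simpa using par_prod_ofFn fun i => hε (Fin.castAdd q i)) fun i => by
      simpa using hε _)
    (Fin.cases (fun z => by
      simpa using dz_prod_ofFn (fun i => hε (Fin.castAdd q i)) (fun i => hdε _) z) fun i => by
      simpa using hdε _)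
    (Fin.cases (by simpa using hp) fun i => by simpa using hv _)
  have e1 : (Fin.cons (C.multi p p h₁ fun i => (ε * v) (Fin.castAdd q i))
      fun i => (ε * v) (Fin.natAdd p i) : Fin (q + 1) → B) =
      Fin.cons ((pullSign (p : ℤ) (fun i => e (Fin.castAdd q i)) (fun i => b (Fin.castAdd q i)) : ℤ) •
        ((List.ofFn fun i => ε (Fin.castAdd q i)).prod *
          C.multi p p h₁ fun i => v (Fin.castAdd q i))) fun i => (ε * v) (Fin.natAdd p i) := by
    congr 1
  have e2 : (Fin.cons (List.ofFn fun i => ε (Fin.castAdd q i)).prod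
      (fun i => ε (Fin.natAdd p i)) : Fin (q + 1) → B) *
      Fin.cons (C.multi p p h₁ fun i => v (Fin.castAdd q i)) (fun i => v (Fin.natAdd p i)) =
      Fin.cons ((List.ofFn fun i => ε (Fin.castAdd q i)).prod *
        C.multi p p h₁ fun i => v (Fin.castAdd q i)) fun i => (ε * v) (Fin.natAdd p i) := by
    funext i
    refine Fin.cases ?_ (fun i => ?_) i <;> simp
  rw [e1, cons_intSmul, ← e2, h2, smul_smul, ← Units.val_mul, ← pullSign_nested]
  congr 2
  rw [List.ofFn_succ, List.prod_cons, List.ofFn_add, List.prod_append]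
  simp only [Fin.cons_zero, Fin.cons_succ]
  rfl

section Consequences

variable {n : ℕ} {a e : Fin n → ℤ} {ε : Fin n → B} (hE : IsParameterExtension C₀ C j e ε)
  (he : ∀ i, e i = a i + 1) {v : Fin n → Ω} (hv : ∀ i, C₀.Par (a i) (v i))
include hE he hv

/-- After multiplication by parameters of degree a_i + 1 all arguments are odd and the
multiderivation is symmetric. Pulling the parameters out again converts symmetry into the graded
skew sign, and `injective` cancels their product. -/
theorem multi_swap {h : List (Fin d ⊕ Fin d) → Ω}
    (hh : SymbolSymm h) (i k : Fin n) (hik : k.val = i.val + 1) :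
    C₀.multi n n h (v ∘ Equiv.swap i k) = -(((a i * a k).negOnePow : ℤ) • C₀.multi n n h v) := by
  have hjv : ∀ i, C.Par (a i) ((j ∘ v) i) := fun i => hE.morphism.map_par (hv i)
  have h1 := multi_swap_odd (C := C) i k hik n (fun l => j (h l))
    (fun l z y l' => by simp only []; rw [hh, map_zsmul]) (ε * (j ∘ v))
    (fun i => ((hE.par i).mul (hjv i)).congr (by rw [he]; exact ⟨a i, by ring⟩))
  rw [multi_mul _ _ hE.par hE.dz_eq_zero hjv, Pi.mul_comp, multi_mul (C := C) n (fun l => j (h l))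
    (e := e ∘ Equiv.swap i k) (ε := ε ∘ Equiv.swap i k) (b := a ∘ Equiv.swap i k) (v := (j ∘ v) ∘ Equiv.swap i k)
    (fun i => hE.par _)
    (fun i z => hE.dz_eq_zero _ z) (fun i => hjv _), Function.comp_assoc, ← hE.morphism.map_multi,
    ← hE.morphism.map_multi, ← smul_mul_assoc, pullSign_smul_prod_perm _ a e he ε hE.par,
    ← smul_mul_assoc, smul_comm, smul_mul_assoc, smul_mul_assoc, smul_mul_assoc] at h1
  have h2 := congrArg (fun x => (pullSign (n : ℤ) e a : ℤ) • x) h1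
  simp only [smul_smul, ← Units.val_mul, Int.units_mul_self, Units.val_one, one_smul] at h2
  rw [← mul_smul_comm, ← map_zsmul, ← sub_eq_zero, ← mul_sub, ← map_sub] at h2
  have h3 := sub_eq_zero.1 (hE.injective _ h2)
  have h4 := koszulSign_mul_swap a 1 i k hik
  rw [one_mul, koszulSign_one, one_mul] at h4
  have hne : i ≠ k := by rintro rfl; omega
  rw [h4, Equiv.Perm.sign_swap hne] at h3
  rw [← mul_assoc (pullSign (n : ℤ) e a), Int.units_mul_self, one_mul] at h3
  simp only [Equiv.Perm.one_apply] at h3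
  rw [← h3, smul_smul, ← Units.val_mul, mul_left_comm, Int.units_mul_self, mul_one]
  simp

/-- The parameters leave every term of the Jacobi expression with the sign of σ times a sign
depending neither on σ nor on the split into p and q. This uniformity lets the symmetrized
expression be compared with `homotopyJacobi` term by term. -/
theorem nested_brackets_mul (hι : ∀ x, C₀.s (ι x) = ι x)
    (g w : Fin d → Fin d → PowerSeries (MvPolynomial (Fin d) A)) {p q : ℕ} (hpq : p + q = n)
    (σ : Equiv.Perm (Fin n)) :
    brackets C ((j : Ω →+* B).comp ι) g w (q + 1)
      (Fin.cons
        (brackets C ((j : Ω →+* B).comp ι) g w p fun i =>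
          ((ε * (j ∘ v)) ∘ σ) (Fin.cast hpq (Fin.castAdd q i)))
        fun i => ((ε * (j ∘ v)) ∘ σ) (Fin.cast hpq (Fin.natAdd p i))) =
      (pullSign ((n + 1 : ℕ) : ℤ) e a : ℤ) • ((List.ofFn ε).prod *
        j (((Equiv.Perm.sign σ * koszulSign a σ : ℤˣ) : ℤ) • brackets C₀ ι g w (q + 1)
          (Fin.cons (brackets C₀ ι g w p fun i => v (σ (Fin.cast hpq (Fin.castAdd q i))))
            fun i => v (σ (Fin.cast hpq (Fin.natAdd p i)))))) := by
  subst hpq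
  have hjv : ∀ i, C.Par (a i) ((j ∘ v) i) := fun i => hE.morphism.map_par (hv i)
  have hι' : ∀ x, C.s (((j : Ω →+* B).comp ι) x) = ((j : Ω →+* B).comp ι) x := fun x => by
    have := hE.morphism.map_s (ι x)
    rw [hι] at this
    exact this.symm
  simp only [Fin.cast_eq_self]
  rw [← nested_apply (brackets C ((j : Ω →+* B).comp ι) g w p)
    (brackets C ((j : Ω →+* B).comp ι) g w (q + 1)) ((ε * (j ∘ v)) ∘ σ), brackets_eq_multi,
    brackets_eq_multi, Pi.mul_comp, nested_multi_mul (par_bracketSymbol hι' _ _ _) (e := e ∘ σ)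
      (b := a ∘ σ) (ε := ε ∘ σ) (v := (j ∘ v) ∘ σ) (fun i => hE.par _) (fun i z => hE.dz_eq_zero _ z) (fun i => hjv _),
    ← smul_mul_assoc, pullSign_smul_prod_perm _ a e he ε hE.par, ← brackets_eq_multi,
    ← brackets_eq_multi, nested_apply, smul_comm, smul_mul_assoc, smul_mul_assoc, map_zsmul,
    mul_smul_comm, hE.morphism.map_brackets]
  congr 4
  funext i
  refine Fin.cases ?_ (fun i => ?_) i
  · simp only [Fin.cons_zero, Function.comp_apply]
    rw [hE.morphism.map_brackets]
    rfl
  · simp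

end Consequences

end SuperCalculus

namespace SuperCalculus

variable {𝕜 : Type} [Field 𝕜] [CharZero 𝕜] {d : ℕ} {B : Type*} [Ring B] [Algebra 𝕜 B]
  {A : Type*} [CommRing A] {Ω : Type} [Ring Ω] [Algebra 𝕜 Ω] {C₀ : SuperCalculus 𝕜 d Ω}
  {C : SuperCalculus 𝕜 d B} {j : Ω →ₐ[𝕜] B} {ι : A →+* Ω}
  {δ : Fin d → A → A} {δp : Fin d → MvPolynomial (Fin d) A →+ MvPolynomial (Fin d) A}

omit [CharZero 𝕜] in
theorem IsMorphism.isScalarMap (hj : IsMorphism C₀ C j) (hι : IsScalarMap C₀ δ ι) :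
    IsScalarMap C δ ((j : Ω →+* B).comp ι) where
  even x := by
    have := hj.map_s (ι x)
    rw [hι.even] at this
    exact this.symm
  D_apply k x := by
    have := hj.map_D k (ι x)
    rw [hι.D_apply] at this
    exact this.symm
  I_apply k x := by
    have := hj.map_I k (ι x)
    rw [hι.I_apply, map_zero] at this
    exact this.symm

/-- The identity is proved for the odd arguments ε_i v_i, where it is an ordinary symmetrization and
can be tested on the diagonal, and is then transferred back by cancelling the parameters. -/
theorem homotopyJacobi_brackets {n : ℕ} {a e : Fin n → ℤ} {ε : Fin n → B}
    (hE : IsParameterExtension C₀ C j e ε) (he : ∀ i, e i = a i + 1) {v : Fin n → Ω}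
    (hv : ∀ i, C₀.Par (a i) (v i)) (hι : IsScalarMap C₀ δ ι) (hδ : IsCoeffDerivation δ δp)
    {g w : Fin d → Fin d → PowerSeries (MvPolynomial (Fin d) A)} (hP : IsFormalPoisson δp g w)
    (hn : 1 ≤ n) : homotopyJacobi (brackets C₀ ι g w) n a v = 0 := by
  set ιB := (j : Ω →+* B).comp ι with hιB
  have hk : ∀ k : Fin n, k.val + 1 + (n - (k.val + 1)) = n := fun k => by omega
  -- The Jacobi expression before the sum over permutations, as one multilinear map; its
  -- symmetrization carries no signs.
  let F : MultilinearMap 𝕜 (fun _ : Fin n => B) B := ∑ k : Fin n,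
    ((-1 : 𝕜) ^ ((k.val + 1) * (n - (k.val + 1))) *
      (((k.val + 1).factorial * (n - (k.val + 1)).factorial : ℕ) : 𝕜)⁻¹) •
      (nested (brackets C ιB g w (k.val + 1)) (brackets C ιB g w (n - (k.val + 1) + 1))).domDomCongr
        (finCongr (hk k))
  have hF : ∀ u : Fin n → B, F u = ∑ k : Fin n,
    ((-1 : 𝕜) ^ ((k.val + 1) * (n - (k.val + 1))) *
      (((k.val + 1).factorial * (n - (k.val + 1)).factorial : ℕ) : 𝕜)⁻¹) •
      brackets C ιB g w (n - (k.val + 1) + 1)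
        (Fin.cons (brackets C ιB g w (k.val + 1) fun i => u (Fin.cast (hk k) (Fin.castAdd _ i)))
          fun i => u (Fin.cast (hk k) (Fin.natAdd _ i))) := fun u => by
    simp only [F, sum_apply, smul_apply,
      MultilinearMap.domDomCongr_apply, nested_apply, finCongr_apply]
  have hodd : ∀ i, C.Par 1 ((ε * (j ∘ v)) i) := fun i =>
    ((hE.par i).mul (hE.morphism.map_par (hv i))).congr (by rw [he]; exact ⟨a i, by ring⟩)
  have h0 := sum_perm_eq_zero_of_diagonal F (ε * (j ∘ v)) fun S => by
    have hφ : C.Par 1 (∑ i ∈ S, (ε * (j ∘ v)) i) := Par.sum fun i _ => hodd i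
    have hιC := hE.morphism.isScalarMap hι
    obtain ⟨ev, hev⟩ := exists_isGraphEval hιC.even hφ
    rw [hF]
    exact brackets_jacobi_diagonal hP hev hφ hιC hδ n hn
  have h1 : ∑ σ : Equiv.Perm (Fin n), F ((ε * (j ∘ v)) ∘ σ) =
      (pullSign ((n + 1 : ℕ) : ℤ) e a : ℤ) • ((List.ofFn ε).prod *
        j (homotopyJacobi (brackets C₀ ι g w) n a v)) := by
    simp only [hF]
    rw [Finset.sum_comm, homotopyJacobi, map_sum, Finset.mul_sum, Finset.smul_sum]
    refine Finset.sum_congr rfl fun k _ => ?_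
    rw [map_smul, mul_smul_comm, smul_comm _ (_ : 𝕜), map_sum, Finset.mul_sum, Finset.smul_sum,
      Finset.smul_sum]
    refine Finset.sum_congr rfl fun σ _ => ?_
    rw [nested_brackets_mul hE he hv hι.even g w (hk k) σ]
  rw [h0] at h1
  have h2 := congrArg (fun x => (pullSign ((n + 1 : ℕ) : ℤ) e a : ℤ) • x) h1
  simp only [smul_smul, ← Units.val_mul, Int.units_mul_self, Units.val_one, one_smul,
    smul_zero] at h2
  exact hE.injective _ h2.symm

end SuperCalculus

end PInftyForms

end

noncomputable section

namespace PInftyForms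

/-! ### The exterior algebra of a free module as a supercalculus -/

/-- The lift of a semilinear map with vanishing squares to a ring homomorphism. -/
def extRingLift {A M R : Type*} [CommRing A] [AddCommGroup M] [Module A M] [Ring R] (φ : A →+* R)
    (hφ : ∀ a x, φ a * x = x * φ a) (f : M →+ R) (hf : ∀ a m, f (a • m) = φ a * f m)
    (hsq : ∀ m, f m * f m = 0) : ExteriorAlgebra A M →+* R :=
  letI := φ.toAlgebra' hφ
  (ExteriorAlgebra.lift A (A := R)
    ⟨{ toFun := f, map_add' := f.map_add, map_smul' := hf }, hsq⟩).toRingHom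

section RingLift

variable {A M R : Type*} [CommRing A] [AddCommGroup M] [Module A M] [Ring R] (φ : A →+* R)
    (hφ : ∀ a x, φ a * x = x * φ a) (f : M →+ R) (hf : ∀ a m, f (a • m) = φ a * f m)
    (hsq : ∀ m, f m * f m = 0)

theorem extRingLift_algebraMap (a : A) :
    extRingLift φ hφ f hf hsq (algebraMap A _ a) = φ a :=
  letI := φ.toAlgebra' hφ
  (ExteriorAlgebra.lift A (A := R)
    ⟨{ toFun := f, map_add' := f.map_add, map_smul' := hf }, hsq⟩).commutes a

theorem extRingLift_ι (m : M) :
    extRingLift φ hφ f hf hsq (ExteriorAlgebra.ι A m) = f m :=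
  letI := φ.toAlgebra' hφ
  ExteriorAlgebra.lift_ι_apply A (A := R)
    { toFun := f, map_add' := f.map_add, map_smul' := hf } hsq m

end RingLift

variable {𝕜 : Type*} [Field 𝕜] {A : Type*} [CommRing A] [Algebra 𝕜 A] {S : Type*}

instance : Algebra 𝕜 (ExteriorAlgebra A (S → A)) := CliffordAlgebra.instAlgebra' _

theorem ext_induction {P : ExteriorAlgebra A (S → A) → Prop}
    (h0 : ∀ r, P (algebraMap A _ r)) (hadd : ∀ x y, P x → P y → P (x + y))
    (hι : ∀ x m, P x → P (ExteriorAlgebra.ι A m * x)) (x) : P x :=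
  CliffordAlgebra.left_induction (Q := (0 : QuadraticForm A (S → A))) (P := P) h0 hadd hι x

/-- A derivation acting on components. -/
def derivComp (δ : Derivation 𝕜 A A) (m : S → A) : S → A := fun s => δ (m s)

theorem ext_ι_mul_self (m : S → A) :
    ExteriorAlgebra.ι A m * ExteriorAlgebra.ι A m = 0 := ExteriorAlgebra.ι_sq_zero m

theorem ext_ι_mul_swap (m m' : S → A) :
    ExteriorAlgebra.ι A m * ExteriorAlgebra.ι A m' =
      -(ExteriorAlgebra.ι A m' * ExteriorAlgebra.ι A m) :=
  eq_neg_of_add_eq_zero_left (ExteriorAlgebra.ι_add_mul_swap m m')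

/-- The homomorphism `b ↦ b + ε D b`, where `D` acts on components as `δ`. -/
def extJet (δ : Derivation 𝕜 A A) :
    ExteriorAlgebra A (S → A) →+* TrivSqZeroExt (ExteriorAlgebra A (S → A))
      (ExteriorAlgebra A (S → A)) :=
  -- A derivation is not A-linear. It becomes a ring map over A once A acts on the dual numbers
  -- through a ↦ a + ε δ a, and the universal property applies to that action.
  extRingLift
    { toFun := fun a => (algebraMap A _ a, algebraMap A _ (δ a))
      map_one' := by
        refine TrivSqZeroExt.ext (map_one _) ?_
        change algebraMap A _ (δ 1) = 0
        rw [δ.map_one_eq_zero, map_zero]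
      map_zero' := by
        refine TrivSqZeroExt.ext (map_zero _) ?_
        change algebraMap A _ (δ 0) = 0
        rw [map_zero, map_zero]
      map_add' := fun a b => by
        refine TrivSqZeroExt.ext (map_add _ _ _) ?_
        change algebraMap A _ (δ (a + b)) = algebraMap A _ (δ a) + algebraMap A _ (δ b)
        rw [map_add, map_add]
      map_mul' := fun a b => by
        refine TrivSqZeroExt.ext ?_ ?_
        · exact map_mul (algebraMap A _) a b
        · change algebraMap A _ (δ (a * b)) = algebraMap A _ a * algebraMap A _ (δ b) +
            algebraMap A _ (δ a) * algebraMap A _ b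
          rw [δ.leibniz]
          simp only [smul_eq_mul, map_add, map_mul]
          rw [Algebra.commutes b] }
    (fun a x => by
      refine TrivSqZeroExt.ext ?_ ?_
      · exact Algebra.commutes a x.1
      · change algebraMap A _ a * x.2 + algebraMap A _ (δ a) * x.1 =
          x.1 * algebraMap A _ (δ a) + x.2 * algebraMap A _ a
        rw [Algebra.commutes, Algebra.commutes (δ a), add_comm])
    { toFun := fun m => (ExteriorAlgebra.ι A m, ExteriorAlgebra.ι A (derivComp δ m))
      map_zero' := by
        refine TrivSqZeroExt.ext (map_zero _) ?_
        change ExteriorAlgebra.ι A (derivComp δ 0) = 0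
        rw [show derivComp δ (0 : S → A) = 0 by funext s; simp [derivComp], map_zero]
      map_add' := fun a b => by
        refine TrivSqZeroExt.ext (map_add _ _ _) ?_
        change ExteriorAlgebra.ι A (derivComp δ (a + b)) = ExteriorAlgebra.ι A (derivComp δ a) +
          ExteriorAlgebra.ι A (derivComp δ b)
        rw [← map_add]
        congr 1
        funext s
        simp [derivComp] }
    (fun a m => by
      refine TrivSqZeroExt.ext ?_ ?_
      · exact (map_smul (ExteriorAlgebra.ι A) a m).trans (Algebra.smul_def _ _)
      · change ExteriorAlgebra.ι A (derivComp δ (a • m)) =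
          algebraMap A _ a * ExteriorAlgebra.ι A (derivComp δ m) +
            algebraMap A _ (δ a) * ExteriorAlgebra.ι A m
        rw [← Algebra.smul_def, ← Algebra.smul_def, ← map_smul, ← map_smul, ← map_add]
        congr 1
        funext s
        simp [derivComp, mul_comm])
    (fun m => by
      refine TrivSqZeroExt.ext ?_ ?_
      · exact ext_ι_mul_self m
      · change ExteriorAlgebra.ι A m * ExteriorAlgebra.ι A (derivComp δ m) +
          ExteriorAlgebra.ι A (derivComp δ m) * ExteriorAlgebra.ι A m = 0
        rw [ext_ι_mul_swap, neg_add_cancel])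

theorem extJet_fst (δ : Derivation 𝕜 A A) (x : ExteriorAlgebra A (S → A)) :
    (extJet δ x).fst = x := by
  induction x using ext_induction with
  | h0 r => rw [extJet, extRingLift_algebraMap]; rfl
  | hadd x y hx hy => rw [map_add, TrivSqZeroExt.fst_add, hx, hy]
  | hι x m hx => rw [map_mul, TrivSqZeroExt.fst_mul, hx, extJet, extRingLift_ι]; rfl

theorem extJet_mul_snd (δ : Derivation 𝕜 A A) (x y : ExteriorAlgebra A (S → A)) :
    (extJet δ (x * y)).snd = (extJet δ x).snd * y + x * (extJet δ y).snd := by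
  rw [map_mul, TrivSqZeroExt.snd_mul, extJet_fst, extJet_fst, add_comm]
  rfl

theorem extJet_algebraMap_snd (δ : Derivation 𝕜 A A) (a : A) :
    (extJet δ (algebraMap A (ExteriorAlgebra A (S → A)) a)).snd = algebraMap A _ (δ a) := by
  rw [extJet, extRingLift_algebraMap]; rfl

/-- The derivation of the exterior algebra acting on components as `δ`. -/
def extD (δ : Derivation 𝕜 A A) :
    ExteriorAlgebra A (S → A) →ₗ[𝕜] ExteriorAlgebra A (S → A) where
  toFun x := (extJet δ x).snd
  map_add' x y := by rw [map_add, TrivSqZeroExt.snd_add]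
  map_smul' r x := by
    have h : ∀ y : ExteriorAlgebra A (S → A), r • y =
        algebraMap A _ (algebraMap 𝕜 A r) * y := fun y => by
      rw [← Algebra.smul_def, algebraMap_smul]
    rw [RingHom.id_apply, h, extJet_mul_snd, extJet_algebraMap_snd, δ.map_algebraMap, map_zero,
      zero_mul, zero_add, h]

theorem extD_mul (δ : Derivation 𝕜 A A) (x y : ExteriorAlgebra A (S → A)) :
    extD δ (x * y) = extD δ x * y + x * extD δ y := extJet_mul_snd δ x y

theorem extD_algebraMap (δ : Derivation 𝕜 A A) (a : A) :
    extD δ (algebraMap A (ExteriorAlgebra A (S → A)) a) = algebraMap A _ (δ a) :=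
  extJet_algebraMap_snd δ a

theorem extD_ι (δ : Derivation 𝕜 A A) (m : S → A) :
    extD δ (ExteriorAlgebra.ι A m) = ExteriorAlgebra.ι A (derivComp δ m) := by
  change (extJet δ (ExteriorAlgebra.ι A m)).snd = _
  rw [extJet, extRingLift_ι]
  rfl

/-- The contraction of the exterior algebra with a coordinate vector. -/
def extI (s : S) : ExteriorAlgebra A (S → A) →ₗ[A] ExteriorAlgebra A (S → A) :=
  CliffordAlgebra.contractLeft (Q := (0 : QuadraticForm A (S → A))) (LinearMap.proj s)

theorem extI_algebraMap (s : S) (a : A) :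
    extI s (algebraMap A (ExteriorAlgebra A (S → A)) a) = 0 :=
  CliffordAlgebra.contractLeft_algebraMap _ _ _

theorem extI_ι_mul (s : S) (m : S → A) (x : ExteriorAlgebra A (S → A)) :
    extI s (ExteriorAlgebra.ι A m * x) = m s • x - ExteriorAlgebra.ι A m * extI s x :=
  CliffordAlgebra.contractLeft_ι_mul _ _ _

theorem extI_ι (s : S) (m : S → A) :
    extI s (ExteriorAlgebra.ι A m) = algebraMap A _ (m s) :=
  CliffordAlgebra.contractLeft_ι _ _ _

theorem extI_extI (s t : S) (x : ExteriorAlgebra A (S → A)) :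
    extI s (extI t x) = -extI t (extI s x) :=
  CliffordAlgebra.contractLeft_comm _ _ _

/-- The parity involution of the exterior algebra. -/
def extS : ExteriorAlgebra A (S → A) →ₐ[A] ExteriorAlgebra A (S → A) :=
  CliffordAlgebra.involute (Q := (0 : QuadraticForm A (S → A)))

theorem extS_ι (m : S → A) : extS (ExteriorAlgebra.ι A m) = -ExteriorAlgebra.ι A m :=
  CliffordAlgebra.involute_ι _

theorem extS_algebraMap (a : A) :
    extS (algebraMap A (ExteriorAlgebra A (S → A)) a) = algebraMap A _ a := extS.commutes a

theorem ext_ι_mul (m : S → A) (x : ExteriorAlgebra A (S → A)) :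
    ExteriorAlgebra.ι A m * x = extS x * ExteriorAlgebra.ι A m := by
  induction x using ext_induction with
  | h0 r => rw [extS_algebraMap, Algebra.commutes]
  | hadd x y hx hy => rw [mul_add, hx, hy, map_add, add_mul]
  | hι x m' hx =>
    rw [← mul_assoc, ext_ι_mul_swap, neg_mul, mul_assoc, hx, map_mul, extS_ι, neg_mul, neg_mul,
      mul_assoc]

theorem extI_mul (s : S) (x y : ExteriorAlgebra A (S → A)) :
    extI s (x * y) = extI s x * y + extS x * extI s y := by
  induction x using ext_induction with
  | h0 r => rw [extI_algebraMap, extS_algebraMap, ← Algebra.smul_def, ← Algebra.smul_def, map_smul,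
      zero_mul, zero_add]
  | hadd x x' hx hx' => simp only [add_mul, map_add, hx, hx']; abel
  | hι x m hx =>
    rw [mul_assoc, extI_ι_mul, hx, extI_ι_mul, map_mul, extS_ι]
    simp only [sub_mul, mul_add, neg_mul, smul_mul_assoc, mul_assoc]
    abel

theorem extS_extD (δ : Derivation 𝕜 A A) (x : ExteriorAlgebra A (S → A)) :
    extD δ (extS x) = extS (extD δ x) := by
  induction x using ext_induction with
  | h0 r => rw [extS_algebraMap, extD_algebraMap, extS_algebraMap]
  | hadd x y hx hy => simp only [map_add, hx, hy]
  | hι x m hx => simp only [map_mul, map_add, map_neg, extD_mul, extD_ι, extS_ι, hx]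

theorem extI_extS (s : S) (x : ExteriorAlgebra A (S → A)) :
    extI s (extS x) = -extS (extI s x) := by
  induction x using ext_induction with
  | h0 r => rw [extS_algebraMap, extI_algebraMap, map_zero, neg_zero]
  | hadd x y hx hy => simp only [map_add, hx, hy, neg_add]
  | hι x m hx =>
    simp only [map_mul, neg_mul, map_neg, map_sub, map_smul, extI_ι_mul, extS_ι, hx, mul_neg]

theorem extD_smul (δ : Derivation 𝕜 A A) (a : A) (x : ExteriorAlgebra A (S → A)) :
    extD δ (a • x) = δ a • x + a • extD δ x := by
  rw [Algebra.smul_def, extD_mul, extD_algebraMap, Algebra.smul_def, Algebra.smul_def]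

theorem extD_extI (δ : Derivation 𝕜 A A) (s : S) (x : ExteriorAlgebra A (S → A)) :
    extD δ (extI s x) = extI s (extD δ x) := by
  induction x using ext_induction with
  | h0 r => rw [extD_algebraMap, extI_algebraMap, extI_algebraMap, map_zero]
  | hadd x y hx hy => simp only [map_add, hx, hy]
  | hι x m hx =>
    simp only [map_add, map_sub, extD_mul, extI_ι_mul, extD_ι, extD_smul, hx, derivComp]
    abel

theorem extD_extD {δ δ' : Derivation 𝕜 A A} (h : ∀ a, δ (δ' a) = δ' (δ a))
    (x : ExteriorAlgebra A (S → A)) : extD δ (extD δ' x) = extD δ' (extD δ x) := by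
  induction x using ext_induction with
  | h0 r => simp only [extD_algebraMap, h]
  | hadd x y hx hy => simp only [map_add, hx, hy]
  | hι x m hx =>
    have : derivComp δ (derivComp δ' m) = derivComp δ' (derivComp δ m) := by
      funext s
      exact h _
    simp only [map_add, extD_mul, extD_ι, hx, this]
    abel

theorem ext_even_comm (b x : ExteriorAlgebra A (S → A)) (hb : extS b = b) : b * x = x * b := by
  induction x using ext_induction with
  | h0 r => rw [Algebra.commutes]
  | hadd x y hx hy => rw [mul_add, hx, hy, add_mul]
  | hι x m hx =>
    have := ext_ι_mul m b
    rw [hb] at this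
    rw [← mul_assoc, ← this, mul_assoc, hx, mul_assoc]

theorem ext_odd_comm (b x : ExteriorAlgebra A (S → A)) (hb : extS b = -b) :
    b * x = extS x * b := by
  induction x using ext_induction with
  | h0 r => rw [extS_algebraMap, Algebra.commutes]
  | hadd x y hx hy => rw [mul_add, hx, hy, map_add, add_mul]
  | hι x m hx =>
    have := ext_ι_mul m b
    rw [hb, neg_mul] at this
    rw [← mul_assoc, ← neg_neg (b * _), ← this, neg_mul, mul_assoc, hx, map_mul, extS_ι, neg_mul,
      neg_mul, mul_assoc]

/-- The exterior algebra over `A` with basis indexed by `S` as a supercalculus: the `δ i` act on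
components, and the basis elements `κ i` correspond to the coordinates. -/
def extCalculus [DecidableEq S] {d : ℕ} (δ : Fin d → Derivation 𝕜 A A)
    (hδ : ∀ i j a, δ i (δ j a) = δ j (δ i a)) (κ : Fin d ↪ S) :
    SuperCalculus 𝕜 d (ExteriorAlgebra A (S → A)) where
  s := extS.toLinearMap.restrictScalars 𝕜
  D i := extD (δ i)
  I i := (extI (κ i)).restrictScalars 𝕜
  ξ i := ExteriorAlgebra.ι A (Pi.single (κ i) 1)
  s_one := map_one (extS (A := A) (S := S))
  s_mul := map_mul (extS (A := A) (S := S))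
  s_s x := CliffordAlgebra.involute_involute _
  even_comm := ext_even_comm
  odd_comm := ext_odd_comm
  D_mul i := extD_mul _
  D_s i := extS_extD _
  I_mul i := extI_mul _
  I_s i := extI_extS _
  D_D i j := extD_extD (hδ i j)
  D_I i j := extD_extI _ _
  I_I i j := extI_extI _ _
  s_ξ i := extS_ι _
  D_ξ i j := by
    rw [extD_ι]
    have : derivComp (δ i) (Pi.single (κ j) 1 : S → A) = 0 := by
      funext s
      rcases eq_or_ne s (κ j) with rfl | h
      · simp [derivComp]
      · simp [derivComp, h]
    rw [this, map_zero]
  I_ξ i j := by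
    change extI (κ i) (ExteriorAlgebra.ι A (Pi.single (κ j) 1)) = _
    rw [extI_ι]
    split_ifs with h
    · subst h; simp
    · rw [Pi.single_eq_of_ne (fun h' => h (κ.injective h')), map_zero]

theorem isScalarMap_extCalculus [DecidableEq S] {d : ℕ} (δ : Fin d → Derivation 𝕜 A A)
    (hδ : ∀ i j a, δ i (δ j a) = δ j (δ i a)) (κ : Fin d ↪ S) :
    (extCalculus δ hδ κ).IsScalarMap (fun i => δ i) (algebraMap A (ExteriorAlgebra A (S → A))) where
  even := extS_algebraMap
  D_apply _ := extD_algebraMap _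
  I_apply _ := extI_algebraMap _

/-! ### Odd parameters -/

section Parameters

variable {d n : ℕ}

/-- The extension of components by zero. -/
def extendComp : (Fin d → A) →ₗ[A] (Fin d ⊕ Fin n → A) where
  toFun m := Sum.elim m 0
  map_add' m m' := by funext s; rcases s with s | s <;> simp
  map_smul' a m := by funext s; rcases s with s | s <;> simp

/-- The inclusion of forms into forms with additional odd parameters. -/
def extInclusion : ExteriorAlgebra A (Fin d → A) →ₐ[A] ExteriorAlgebra A (Fin d ⊕ Fin n → A) :=
  ExteriorAlgebra.map extendComp

theorem extInclusion_ι (m : Fin d → A) :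
    extInclusion (n := n) (ExteriorAlgebra.ι A m) = ExteriorAlgebra.ι A (extendComp m) :=
  ExteriorAlgebra.map_apply_ι _ _

theorem extInclusion_injective :
    Function.Injective (extInclusion : ExteriorAlgebra A (Fin d → A) →ₐ[A]
      ExteriorAlgebra A (Fin d ⊕ Fin n → A)) := by
  let f : (Fin d ⊕ Fin n → A) →ₗ[A] (Fin d → A) := LinearMap.funLeft A A Sum.inl
  refine Function.LeftInverse.injective (g := ExteriorAlgebra.map f) fun x => ?_
  rw [extInclusion, ← AlgHom.comp_apply, ExteriorAlgebra.map_comp_map]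
  have : f ∘ₗ extendComp = LinearMap.id := by ext; rfl
  rw [this, ExteriorAlgebra.map_id]
  rfl

theorem extI_inr_extInclusion (i : Fin n) (x : ExteriorAlgebra A (Fin d → A)) :
    extI (Sum.inr i) (extInclusion (n := n) x) = 0 := by
  induction x using ext_induction with
  | h0 r => rw [extInclusion.commutes, extI_algebraMap]
  | hadd x y hx hy => rw [map_add, map_add, hx, hy, add_zero]
  | hι x m hx =>
    rw [map_mul, extInclusion_ι, extI_ι_mul, hx]
    simp [extendComp]

theorem isMorphism_extInclusion (δ : Fin d → Derivation 𝕜 A A)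
    (hδ : ∀ i j a, δ i (δ j a) = δ j (δ i a)) :
    SuperCalculus.IsMorphism (extCalculus δ hδ (Function.Embedding.refl _))
      (extCalculus δ hδ (Function.Embedding.inl (α := Fin d) (β := Fin n)))
      (extInclusion.restrictScalars 𝕜) where
  map_s x := by
    change extInclusion (extS x) = extS (extInclusion x)
    induction x using ext_induction with
    | h0 r => rw [extS_algebraMap, extInclusion.commutes, extS_algebraMap]
    | hadd x y hx hy => simp only [map_add, hx, hy]
    | hι x m hx => simp only [map_mul, map_neg, extInclusion_ι, extS_ι, hx]
  map_D i x := by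
    change extInclusion (extD (δ i) x) = extD (δ i) (extInclusion x)
    induction x using ext_induction with
    | h0 r => rw [extD_algebraMap, extInclusion.commutes, extInclusion.commutes, extD_algebraMap]
    | hadd x y hx hy => simp only [map_add, hx, hy]
    | hι x m hx =>
      have : extendComp (n := n) (derivComp (δ i) m) = derivComp (δ i) (extendComp m) := by
        funext s
        rcases s with s | s <;> simp [derivComp, extendComp]
      simp only [map_mul, map_add, extD_mul, extInclusion_ι, extD_ι, hx, this]
  map_I i x := by
    change extInclusion (extI i x) = extI (Sum.inl i) (extInclusion x)
    induction x using ext_induction with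
    | h0 r => rw [extI_algebraMap, extInclusion.commutes, extI_algebraMap, map_zero]
    | hadd x y hx hy => simp only [map_add, hx, hy]
    | hι x m hx =>
      simp only [map_mul, map_sub, map_smul, extInclusion_ι, extI_ι_mul, hx]
      rfl
  map_ξ i := by
    change extInclusion (ExteriorAlgebra.ι A (Pi.single i 1)) = _
    rw [extInclusion_ι]
    congr 1
    funext s
    rcases s with s | s
    · simp [extendComp, Pi.single_apply]
    · simp [extendComp]

/-- The odd parameters attached to slots of even degree. -/
def oddParam (a : Fin n → ℤ) (i : Fin n) : ExteriorAlgebra A (Fin d ⊕ Fin n → A) :=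
  if Even (a i) then ExteriorAlgebra.ι A (Pi.single (Sum.inr i) 1) else 1

theorem extI_inr_prod_oddParam (a : Fin n → ℤ) (i : Fin n) (L : List (Fin n)) (hi : i ∉ L)
    {y : ExteriorAlgebra A (Fin d ⊕ Fin n → A)} (hy : extI (Sum.inr i) y = 0) :
    extI (Sum.inr i) ((L.map (oddParam a)).prod * y) = 0 := by
  induction L with
  | nil => simpa using hy
  | cons k L ih =>
    rw [List.mem_cons, not_or] at hi
    rw [List.map_cons, List.prod_cons, mul_assoc, oddParam]
    split_ifs
    · rw [extI_ι_mul, ih hi.2, mul_zero, Pi.single_eq_of_ne (by simpa using hi.1), zero_smul,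
        sub_zero]
    · rw [one_mul, ih hi.2]

/-- Contraction with the direction of the leading parameter strips it off, because nothing to its
right involves that direction. Parameters equal to 1 need no work. -/
theorem eq_zero_of_prod_oddParam (a : Fin n → ℤ) (L : List (Fin n)) (hL : L.Nodup)
    {y : ExteriorAlgebra A (Fin d ⊕ Fin n → A)} (hy : ∀ i, extI (Sum.inr i) y = 0)
    (h : (L.map (oddParam a)).prod * y = 0) : y = 0 := by
  induction L with
  | nil => simpa using h
  | cons k L ih =>
    rw [List.nodup_cons] at hL
    refine ih hL.2 ?_
    rw [List.map_cons, List.prod_cons, mul_assoc, oddParam] at h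
    split_ifs at h
    · have h' := congrArg (extI (Sum.inr k)) h
      rwa [extI_ι_mul, extI_inr_prod_oddParam a k L hL.1 (hy k), mul_zero, map_zero,
        Pi.single_eq_same, one_smul, sub_zero] at h'
    · rwa [one_mul] at h

/-- Only the parity of a_i + 1 matters: an odd generator serves an even slot and 1 serves an odd
slot. These are constants because derivations act on components and the calculus contracts only
along the original directions. -/
theorem isParameterExtension_oddParam (δ : Fin d → Derivation 𝕜 A A)
    (hδ : ∀ i j a, δ i (δ j a) = δ j (δ i a)) (a : Fin n → ℤ) :
    SuperCalculus.IsParameterExtension (extCalculus δ hδ (Function.Embedding.refl _))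
      (extCalculus δ hδ (Function.Embedding.inl (α := Fin d) (β := Fin n)))
      (extInclusion.restrictScalars 𝕜) (fun i => a i + 1) (oddParam a) where
  morphism := isMorphism_extInclusion δ hδ
  par i := by
    unfold oddParam
    split_ifs with h
    · exact (SuperCalculus.par_odd.2 (extS_ι _)).congr (by
        rw [show 1 - (a i + 1) = -a i by ring]; exact h.neg)
    · rw [Int.not_even_iff_odd] at h
      exact SuperCalculus.Par.one.congr (by rw [zero_sub, even_neg]; exact h.add_one)
  dz_eq_zero i z := by
    unfold oddParam
    split_ifs with h
    · rcases z with z | z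
      · change extD _ _ = 0
        rw [extD_ι]
        have : derivComp (δ z) (Pi.single (Sum.inr i) 1 : Fin d ⊕ Fin n → A) = 0 := by
          funext s
          rcases eq_or_ne s (Sum.inr i) with rfl | h
          · simp [derivComp]
          · simp [derivComp, h]
        rw [this, map_zero]
      · change extI (Sum.inl z) _ = 0
        rw [extI_ι]
        simp
    · rcases z with z | z
      · change extD _ _ = 0
        rw [← map_one (algebraMap A _), extD_algebraMap, (δ z).map_one_eq_zero, map_zero]
      · change extI (Sum.inl z) _ = 0
        rw [← map_one (algebraMap A _), extI_algebraMap]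
  injective x h := by
    rw [List.ofFn_eq_map] at h
    have := eq_zero_of_prod_oddParam a (List.finRange n) (List.nodup_finRange n)
      (y := extInclusion x) (fun i => extI_inr_extInclusion i x) h
    exact extInclusion_injective (this.trans (map_zero _).symm)

end Parameters

end PInftyForms

end

noncomputable section

namespace PInftyForms

variable {𝕜 : Type*} [Field 𝕜] {A : Type*} [CommRing A] [Algebra 𝕜 A] {S : Type*}

/-! ### The grading of the exterior algebra by the integers -/

variable (𝕜 A S) in
/-- The homogeneous components of the exterior algebra, indexed by the integers. -/
def extDegree (k : ℤ) : Submodule 𝕜 (ExteriorAlgebra A (S → A)) :=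
  if 0 ≤ k then (⋀[A]^k.toNat (S → A)).restrictScalars 𝕜 else ⊥

theorem mem_extDegree_natCast {n : ℕ} {x : ExteriorAlgebra A (S → A)} :
    x ∈ extDegree 𝕜 A S n ↔ x ∈ ⋀[A]^n (S → A) := by
  simp [extDegree]

theorem mem_extDegree_cases {k : ℤ} {x : ExteriorAlgebra A (S → A)} (hx : x ∈ extDegree 𝕜 A S k) :
    x = 0 ∨ ∃ n : ℕ, k = n ∧ x ∈ ⋀[A]^n (S → A) := by
  rcases lt_or_ge k 0 with h | h
  · left
    rw [extDegree, if_neg (not_le.2 h)] at hx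
    simpa using hx
  · right
    obtain ⟨n, rfl⟩ := Int.eq_ofNat_of_zero_le h
    exact ⟨n, rfl, mem_extDegree_natCast.1 hx⟩

theorem eq_zero_of_mem_extDegree_neg {k : ℤ} (hk : k < 0) {x : ExteriorAlgebra A (S → A)}
    (hx : x ∈ extDegree 𝕜 A S k) : x = 0 := by
  rw [extDegree, if_neg (not_le.2 hk)] at hx
  simpa using hx

theorem algebraMap_mem_extDegree (a : A) :
    algebraMap A (ExteriorAlgebra A (S → A)) a ∈ extDegree 𝕜 A S 0 := by
  have : algebraMap A (ExteriorAlgebra A (S → A)) a ∈ ⋀[A]^0 (S → A) := by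
    rw [ExteriorAlgebra.exteriorPower, pow_zero]
    exact Submodule.algebraMap_mem a
  exact (mem_extDegree_natCast (n := 0)).2 this

theorem ι_mem_extDegree (m : S → A) : ExteriorAlgebra.ι A m ∈ extDegree 𝕜 A S 1 := by
  have : ExteriorAlgebra.ι A m ∈ ⋀[A]^1 (S → A) := by
    rw [ExteriorAlgebra.exteriorPower, pow_one]
    exact ⟨m, rfl⟩
  exact (mem_extDegree_natCast (n := 1)).2 this

theorem one_mem_extDegree : (1 : ExteriorAlgebra A (S → A)) ∈ extDegree 𝕜 A S 0 := by
  simpa using algebraMap_mem_extDegree (𝕜 := 𝕜) (S := S) (1 : A)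

theorem mul_mem_extDegree {k l : ℤ} {x y : ExteriorAlgebra A (S → A)}
    (hx : x ∈ extDegree 𝕜 A S k) (hy : y ∈ extDegree 𝕜 A S l) :
    x * y ∈ extDegree 𝕜 A S (k + l) := by
  rcases mem_extDegree_cases hx with rfl | ⟨m, rfl, hx⟩
  · rw [zero_mul]; exact zero_mem _
  rcases mem_extDegree_cases hy with rfl | ⟨n, rfl, hy⟩
  · rw [mul_zero]; exact zero_mem _
  rw [← Nat.cast_add, mem_extDegree_natCast, ExteriorAlgebra.exteriorPower, pow_add]
  exact Submodule.mul_mem_mul hx hy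

theorem smul_mem_extDegree {k : ℤ} (a : A) {x : ExteriorAlgebra A (S → A)}
    (hx : x ∈ extDegree 𝕜 A S k) : a • x ∈ extDegree 𝕜 A S k := by
  rw [Algebra.smul_def, ← zero_add k]
  exact mul_mem_extDegree (algebraMap_mem_extDegree a) hx

/-- Induction over products of elements of degree one. -/
theorem extDegree_induction {P : ℕ → ExteriorAlgebra A (S → A) → Prop}
    (h0 : ∀ r, P 0 (algebraMap A _ r))
    (hadd : ∀ x y (n : ℕ), x ∈ extDegree 𝕜 A S n → y ∈ extDegree 𝕜 A S n → P n x → P n y → P n (x + y))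
    (hι : ∀ x m (n : ℕ), x ∈ extDegree 𝕜 A S n → P n x → P (n + 1) (ExteriorAlgebra.ι A m * x))
    {n : ℕ} {x : ExteriorAlgebra A (S → A)} (hx : x ∈ extDegree 𝕜 A S n) : P n x := by
  rw [mem_extDegree_natCast] at hx
  refine Submodule.pow_induction_on_left' (LinearMap.range (ExteriorAlgebra.ι A))
    (C := fun n x _ => P n x) h0
    (fun x y i hx hy => hadd x y i (mem_extDegree_natCast.2 hx) (mem_extDegree_natCast.2 hy)) ?_ hx
  rintro _ ⟨m, rfl⟩ i x hx h
  exact hι x m i (mem_extDegree_natCast.2 hx) h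

theorem extD_mem_extDegree (δ : Derivation 𝕜 A A) {k : ℤ} {x : ExteriorAlgebra A (S → A)}
    (hx : x ∈ extDegree 𝕜 A S k) : extD δ x ∈ extDegree 𝕜 A S k := by
  rcases mem_extDegree_cases hx with rfl | ⟨n, rfl, -⟩
  · rw [map_zero]; exact zero_mem _
  refine extDegree_induction (P := fun n x => extD δ x ∈ extDegree 𝕜 A S n) ?_ ?_ ?_ hx
  · intro r
    rw [extD_algebraMap]
    exact algebraMap_mem_extDegree _
  · intro x y n _ _ hx hy
    rw [map_add]
    exact add_mem hx hy
  · intro x m n h hx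
    rw [extD_mul, extD_ι, Nat.cast_succ, add_comm]
    exact add_mem (mul_mem_extDegree (ι_mem_extDegree _) h)
      (mul_mem_extDegree (ι_mem_extDegree _) hx)

theorem extI_mem_extDegree (s : S) {k : ℤ} {x : ExteriorAlgebra A (S → A)}
    (hx : x ∈ extDegree 𝕜 A S k) : extI s x ∈ extDegree 𝕜 A S (k - 1) := by
  rcases mem_extDegree_cases hx with rfl | ⟨n, rfl, -⟩
  · rw [map_zero]; exact zero_mem _
  refine extDegree_induction (P := fun n x => extI s x ∈ extDegree 𝕜 A S ((n : ℤ) - 1)) ?_ ?_ ?_ hx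
  · intro r
    rw [extI_algebraMap]
    exact zero_mem _
  · intro x y n _ _ hx hy
    rw [map_add]
    exact add_mem hx hy
  · intro x m n h hx
    rw [extI_ι_mul, Nat.cast_succ, add_sub_cancel_right]
    refine sub_mem (smul_mem_extDegree _ h) ?_
    have := mul_mem_extDegree (ι_mem_extDegree m) hx
    rwa [add_sub_cancel] at this

theorem extS_of_mem_extDegree {k : ℤ} {x : ExteriorAlgebra A (S → A)}
    (hx : x ∈ extDegree 𝕜 A S k) : extS x = (k.negOnePow : ℤ) • x := by
  rcases mem_extDegree_cases hx with rfl | ⟨n, rfl, -⟩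
  · rw [map_zero, smul_zero]
  refine extDegree_induction (P := fun n x => extS x = ((n : ℤ).negOnePow : ℤ) • x) ?_ ?_ ?_ hx
  · intro r
    rw [extS_algebraMap]
    simp
  · intro x y n _ _ hx hy
    rw [map_add, hx, hy, smul_add]
  · intro x m n h hx
    rw [map_mul, extS_ι, hx, mul_smul_comm, Nat.cast_succ, Int.negOnePow_succ]
    simp

-- The natural grading of the exterior algebra is extended by zero to negative degrees, and its
-- projections `π` separate the components.
open DirectSum in
theorem isInternal_extDegree : DirectSum.IsInternal (extDegree 𝕜 A S) := by
  classical
  let 𝒜 : ℕ → Submodule A (ExteriorAlgebra A (S → A)) := fun n => ⋀[A]^n (S → A)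
  let π : ℤ → ExteriorAlgebra A (S → A) →+ ExteriorAlgebra A (S → A) := fun k =>
    if 0 ≤ k then (GradedRing.proj 𝒜 k.toNat) else 0
  have hπ : ∀ k l : ℤ, ∀ x ∈ extDegree 𝕜 A S l, π k x = if k = l then x else 0 := by
    intro k l x hx
    rcases mem_extDegree_cases hx with rfl | ⟨n, rfl, hx⟩
    · simp
    rcases lt_or_ge k 0 with h | h
    · simp only [π, if_neg (not_le.2 h)]
      rw [if_neg (by omega)]
      rfl
    · obtain ⟨m, rfl⟩ := Int.eq_ofNat_of_zero_le h
      simp only [π, if_pos h, Int.toNat_natCast, GradedRing.proj_apply]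
      split_ifs with hmn
      · obtain rfl : m = n := by exact_mod_cast hmn
        exact decompose_of_mem_same 𝒜 hx
      · exact decompose_of_mem_ne 𝒜 hx fun h => hmn (by exact_mod_cast h.symm)
  constructor
  · rw [injective_iff_map_eq_zero]
    intro f hf
    have key : ∀ k (f : ⨁ i, extDegree 𝕜 A S i),
        π k (DirectSum.coeAddMonoidHom (extDegree 𝕜 A S) f) = f k := by
      intro k f
      induction f using DirectSum.induction_on with
      | zero => simp
      | of i x =>
        rw [coeAddMonoidHom_of, hπ k i _ x.2, coe_of_apply]
        split_ifs with h1 h2 h2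
        · rfl
        · exact absurd h1.symm h2
        · exact absurd h2.symm h1
        · rfl
      | add x y hx hy => simp only [map_add, hx, hy, DirectSum.add_apply, Submodule.coe_add]
    refine DFinsupp.ext fun k => Subtype.ext ?_
    rw [← key k f, hf, map_zero]
    rfl
  · intro x
    refine ⟨∑ n ∈ (decompose 𝒜 x).support, DirectSum.of (fun i => extDegree 𝕜 A S i) (n : ℤ)
      ⟨decompose 𝒜 x n, mem_extDegree_natCast.2 (decompose 𝒜 x n).2⟩, ?_⟩
    rw [map_sum]
    simp only [coeAddMonoidHom_of]
    exact sum_support_decompose 𝒜 x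

/-! ### Degrees of the symbols and of the brackets -/

section Calculus

variable {S : Type*} [DecidableEq S] {d : ℕ} {δ : Fin d → Derivation 𝕜 A A}
    {hδ : ∀ i j a, δ i (δ j a) = δ j (δ i a)} {κ : Fin d ↪ S}

theorem par_of_mem_extDegree {k : ℤ} {x : ExteriorAlgebra A (S → A)}
    (hx : x ∈ extDegree 𝕜 A S k) : (extCalculus δ hδ κ).Par k x := extS_of_mem_extDegree hx

theorem tw_mem_extDegree (c : ℕ) {k : ℤ} {x : ExteriorAlgebra A (S → A)}
    (hx : x ∈ extDegree 𝕜 A S k) : (extCalculus δ hδ κ).tw c x ∈ extDegree 𝕜 A S k := by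
  rw [(par_of_mem_extDegree hx).tw_eq]
  exact zsmul_mem hx _

theorem dz_mem_extDegree (z : Fin d ⊕ Fin d) {k : ℤ} {x : ExteriorAlgebra A (S → A)}
    (hx : x ∈ extDegree 𝕜 A S k) :
    (extCalculus δ hδ κ).dz z x ∈ extDegree 𝕜 A S (k - indexDeg z) := by
  rcases z with z | z
  · rw [show (indexDeg (Sum.inl z : Fin d ⊕ Fin d) : ℤ) = 0 from rfl, sub_zero]
    exact extD_mem_extDegree (δ z) hx
  · exact extI_mem_extDegree (κ z) hx

/-- Each slot lowers the total degree by exactly one, either through a contraction or through the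
loss of one odd momentum in the symbol. -/
theorem multi_mem_extDegree {n : ℕ} (c : ℕ) (h : List (Fin d ⊕ Fin d) → ExteriorAlgebra A (S → A))
    (u : ℤ) (hh : ∀ l, l.length = n → h l ∈ extDegree 𝕜 A S (u - SuperCalculus.evenCount l))
    {b : Fin n → ℤ} {v : Fin n → ExteriorAlgebra A (S → A)}
    (hv : ∀ i, v i ∈ extDegree 𝕜 A S (b i)) :
    (extCalculus δ hδ κ).multi n c h v ∈ extDegree 𝕜 A S (u - n + ∑ i, b i) := by
  induction n generalizing c h u with
  | zero => simpa [SuperCalculus.multi_zero, SuperCalculus.evenCount] using hh [] rfl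
  | succ n ih =>
    rw [SuperCalculus.multi_succ]
    refine sum_mem fun z _ => ?_
    have h1 := dz_mem_extDegree (δ := δ) (hδ := hδ) (κ := κ) z
      (tw_mem_extDegree (δ := δ) (hδ := hδ) (κ := κ) (c + indexDeg z) (hv 0))
    have h2 := ih (c + indexDeg z) (fun l => h (z :: l)) (u - (1 - indexDeg z : ℕ))
      (fun l hl => by
        have := hh (z :: l) (by simp [hl])
        rcases z with z | z
        · rw [SuperCalculus.evenCount_inl] at this
          convert this using 2
          simp [indexDeg]
          ring
        · rw [SuperCalculus.evenCount_inr] at this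
          simpa [indexDeg] using this)
      (b := fun i => b i.succ) (v := Fin.tail v) (fun i => hv i.succ)
    have h3 := mul_mem_extDegree h1 h2
    convert h3 using 2
    rw [Fin.sum_univ_succ]
    rcases z with z | z <;> simp [indexDeg] <;> ring

open MvPolynomial SuperCalculus

omit [DecidableEq S] in
theorem symbolTwo_mem_extDegree (G : MvPolynomial (Fin d) A) (l : List (Fin d ⊕ Fin d)) :
    symbolTwo (algebraMap A (ExteriorAlgebra A (S → A))) G l ∈
      extDegree 𝕜 A S (-evenCount l) := by
  induction l generalizing G with
  | nil => exact algebraMap_mem_extDegree _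
  | cons z l ih =>
    rcases z with z | z
    · exact zero_mem _
    · rw [evenCount_inr]; exact ih _

theorem symbolOne_mem_extDegree (g w : Fin d → MvPolynomial (Fin d) A)
    (l : List (Fin d ⊕ Fin d)) :
    symbolOne (extCalculus δ hδ κ) (algebraMap A (ExteriorAlgebra A (S → A))) g w l ∈
      extDegree 𝕜 A S (1 - evenCount l) := by
  induction l generalizing g w with
  | nil =>
    refine sum_mem fun i _ => ?_
    have := mul_mem_extDegree (algebraMap_mem_extDegree (𝕜 := 𝕜) (S := S) (constantCoeff (g i)))
      (ι_mem_extDegree (Pi.single (κ i) 1))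
    rw [zero_add] at this
    rw [show (1 : ℤ) - (evenCount ([] : List (Fin d ⊕ Fin d)) : ℤ) = 1 by simp [evenCount]]
    exact this
  | cons z l ih =>
    rcases z with z | z
    · rw [evenCount_inl]
      have := symbolTwo_mem_extDegree (𝕜 := 𝕜) (S := S) (w z) l
      rwa [Nat.cast_succ, sub_add_cancel_right]
    · rw [evenCount_inr]; exact ih _ _

/-- With ξ and the odd momenta in degree one and p in degree zero, both parts of the Hamiltonian
have degree two. -/
theorem symbolZero_mem_extDegree (g w : Fin d → Fin d → MvPolynomial (Fin d) A)
    (l : List (Fin d ⊕ Fin d)) :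
    symbolZero (extCalculus δ hδ κ) (algebraMap A (ExteriorAlgebra A (S → A))) g w l ∈
      extDegree 𝕜 A S (2 - evenCount l) := by
  induction l generalizing g w with
  | nil => exact zero_mem _
  | cons z l ih =>
    rcases z with z | z
    · rw [evenCount_inl]
      have := symbolOne_mem_extDegree (δ := δ) (hδ := hδ) (κ := κ) (g z) (w z) l
      rwa [Nat.cast_succ, show (2 : ℤ) - (evenCount l + 1) = 1 - evenCount l by ring]
    · rw [evenCount_inr]; exact ih _ _

theorem brackets_mem_extDegree (g w : Fin d → Fin d → PowerSeries (MvPolynomial (Fin d) A))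
    {n : ℕ} {b : Fin n → ℤ} {v : Fin n → ExteriorAlgebra A (S → A)}
    (hv : ∀ i, v i ∈ extDegree 𝕜 A S (b i)) :
    brackets (extCalculus δ hδ κ) (algebraMap A (ExteriorAlgebra A (S → A))) g w n v ∈
      extDegree 𝕜 A S (2 - n + ∑ i, b i) := by
  rw [brackets_eq_multi]
  refine multi_mem_extDegree n _ 2 (fun l _ => ?_) hv
  cases n with
  | zero => exact zero_mem _
  | succ n => exact zsmul_mem (symbolZero_mem_extDegree _ _ l) _

end Calculus

/-- The brackets of a formal Poisson structure form a `P_∞`-structure on the exterior algebra. -/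
theorem isPInfinity_brackets {𝕜 : Type} [Field 𝕜] [CharZero 𝕜] {A : Type} [CommRing A]
    [Algebra 𝕜 A] {d : ℕ} (δ : Fin d → Derivation 𝕜 A A)
    (hδ : ∀ i j a, δ i (δ j a) = δ j (δ i a))
    {δp : Fin d → MvPolynomial (Fin d) A →+ MvPolynomial (Fin d) A}
    (hp : SuperCalculus.IsCoeffDerivation (fun i => δ i) δp)
    {g w : Fin d → Fin d → PowerSeries (MvPolynomial (Fin d) A)}
    (hP : SuperCalculus.IsFormalPoisson δp g w) :
    IsPInfinity (extDegree 𝕜 A (Fin d))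
      (SuperCalculus.brackets (extCalculus δ hδ (Function.Embedding.refl _))
        (algebraMap A (ExteriorAlgebra A (Fin d → A))) g w) where
  gradedCommutative :=
    { internal := isInternal_extDegree
      one_mem := one_mem_extDegree
      mul_mem := fun k l v w hv hw => mul_mem_extDegree hv hw
      comm := fun k l v w hv hw => (par_of_mem_extDegree (δ := δ) (hδ := hδ)
        (κ := Function.Embedding.refl _) hv).comm (par_of_mem_extDegree hw) }
  lInfinity :=
    { flat := rfl
      degree := fun n a v hv => brackets_mem_extDegree g w hv
      skew := fun n a v hv i j hij => by
        rw [SuperCalculus.brackets_eq_multi]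
        exact SuperCalculus.multi_swap (isParameterExtension_oddParam δ hδ a) (fun _ => rfl)
          (fun i => par_of_mem_extDegree (hv i)) (SuperCalculus.bracketSymbol_symm g w hP.skew n)
          i j hij
      jacobi := fun n hn a v hv =>
        SuperCalculus.homotopyJacobi_brackets (isParameterExtension_oddParam δ hδ a) (fun _ => rfl)
          (fun i => par_of_mem_extDegree (hv i)) (isScalarMap_extCalculus δ hδ _) hp hP hn }
  derivation := fun n a v hv p b c hb => by
    rw [SuperCalculus.brackets_eq_multi, SuperCalculus.multi_snoc_mul (n + 1) _ 0
      (fun l _ => SuperCalculus.par_bracketSymbol extS_algebraMap g w (n + 1) l) (by simp)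
      (fun i => par_of_mem_extDegree (hv i)) (par_of_mem_extDegree hb) c]
    congr 2
    -- The degree n + 1 found by `multi_snoc_mul` and the degree 2 - (n + 1) required here have the
    -- same parity.
    rw [Units.val_inj, Int.negOnePow_eq_iff, ← mul_sub]
    exact Even.mul_left ⟨(n : ℤ), by ring⟩ _

end PInftyForms

end

noncomputable section

namespace PInftyForms

/-! ### Partial derivatives of smooth functions -/

section Smooth

variable {𝕜 : Type} [RCLike 𝕜] {d : ℕ} {U : TopologicalSpace.Opens (Fin d → ℝ)}

/-- The extension of a smooth function by zero. -/
def SmoothFun.extend (f : SmoothFun 𝕜 U) : (Fin d → ℝ) → 𝕜 :=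
  Function.extend Subtype.val f.1 (0 : (Fin d → ℝ) → 𝕜)

theorem SmoothFun.extend_apply (f : SmoothFun 𝕜 U) (x : U) : f.extend x = f.1 x :=
  Subtype.val_injective.extend_apply f.1 0 x

theorem SmoothFun.contDiffAt_extend (f : SmoothFun 𝕜 U) (x : U) : ContDiffAt ℝ ∞ f.extend x :=
  ContDiffOn.contDiffAt (s := (U : Set (Fin d → ℝ))) f.2 (U.isOpen.mem_nhds x.2)

theorem SmoothFun.differentiableAt_extend (f : SmoothFun 𝕜 U) (x : U) :
    DifferentiableAt ℝ f.extend x :=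
  (f.contDiffAt_extend x).differentiableAt (by simp)

theorem SmoothFun.ext_apply {f g : SmoothFun 𝕜 U} (h : ∀ x, f.1 x = g.1 x) : f = g :=
  Subtype.ext (funext h)

theorem partialX_apply (i : Fin d) (f : SmoothFun 𝕜 U) (x : U) :
    (partialX i f).1 x = fderiv ℝ f.extend x (Pi.single i 1) := rfl

/-- As U is open, the germ at a point of U ignores the values outside. This reduces derivatives of
extensions by zero to ordinary ones. -/
theorem SmoothFun.extend_eventuallyEq (f : SmoothFun 𝕜 U) {F : (Fin d → ℝ) → 𝕜}
    (h : ∀ y : U, f.1 y = F y) (x : U) : f.extend =ᶠ[nhds (x : Fin d → ℝ)] F := by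
  filter_upwards [U.isOpen.mem_nhds x.2] with y hy
  rw [← h ⟨y, hy⟩]
  exact f.extend_apply ⟨y, hy⟩

variable (𝕜 U) in
/-- The partial derivative as a derivation. -/
def partialDer (i : Fin d) : Derivation 𝕜 (SmoothFun 𝕜 U) (SmoothFun 𝕜 U) :=
  Derivation.mk'
    { toFun := partialX i
      map_add' := fun f g => SmoothFun.ext_apply fun x => by
        have h : (f + g).extend =ᶠ[nhds (x : Fin d → ℝ)] f.extend + g.extend :=
          (f + g).extend_eventuallyEq (fun y => by
            rw [Pi.add_apply, f.extend_apply, g.extend_apply]; rfl) x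
        rw [partialX_apply, h.fderiv_eq,
          fderiv_add (f.differentiableAt_extend x) (g.differentiableAt_extend x)]
        rfl
      map_smul' := fun c f => SmoothFun.ext_apply fun x => by
        have h : (c • f).extend =ᶠ[nhds (x : Fin d → ℝ)] c • f.extend :=
          (c • f).extend_eventuallyEq (fun y => by
            rw [Pi.smul_apply, f.extend_apply]; rfl) x
        rw [partialX_apply, h.fderiv_eq, fderiv_const_smul (f.differentiableAt_extend x)]
        rfl }
    fun f g => SmoothFun.ext_apply fun x => by
      have h : (f * g).extend =ᶠ[nhds (x : Fin d → ℝ)] f.extend * g.extend :=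
          (f * g).extend_eventuallyEq (fun y => by
            rw [Pi.mul_apply, f.extend_apply, g.extend_apply]; rfl) x
      change (partialX i (f * g)).1 x = f.1 x * (partialX i g).1 x + g.1 x * (partialX i f).1 x
      rw [partialX_apply, h.fderiv_eq,
        fderiv_mul (f.differentiableAt_extend x) (g.differentiableAt_extend x), f.extend_apply,
        g.extend_apply]
      rfl

theorem partialDer_apply (i : Fin d) (f : SmoothFun 𝕜 U) : partialDer 𝕜 U i f = partialX i f := rfl

/-- Symmetry of the second derivative applies because the extension by zero is smooth at each point
of U. -/
theorem partialDer_comm (i j : Fin d) (f : SmoothFun 𝕜 U) :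
    partialDer 𝕜 U i (partialDer 𝕜 U j f) = partialDer 𝕜 U j (partialDer 𝕜 U i f) := by
  have key : ∀ (i j : Fin d) (x : U), (partialX i (partialX j f)).1 x =
      fderiv ℝ (fderiv ℝ f.extend) x (Pi.single i 1) (Pi.single j 1) := fun i j x => by
    have h := (partialX j f).extend_eventuallyEq
      (F := fun y => fderiv ℝ f.extend y (Pi.single j 1)) (fun y => rfl) x
    have hd : DifferentiableAt ℝ (fderiv ℝ f.extend) x :=
      ((f.contDiffAt_extend x).fderiv_right (m := 1) (by norm_cast)).differentiableAt (by simp)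
    rw [partialX_apply, h.fderiv_eq, fderiv_clm_apply hd (differentiableAt_const _)]
    simp
  refine SmoothFun.ext_apply fun x => ?_
  change (partialX i (partialX j f)).1 x = (partialX j (partialX i f)).1 x
  rw [key, key]
  exact (f.contDiffAt_extend x).isSymmSndFDerivAt (by
    rw [minSmoothness_of_isRCLikeNormedField]
    exact WithTop.coe_le_coe.2 (le_top : (2 : ℕ∞) ≤ ⊤)) _ _

end Smooth

/-! ### Formal functions on the cotangent bundle -/

section Formal

open MvPolynomial SuperCalculus

variable {𝕜 : Type} [RCLike 𝕜] {d : ℕ} {U : TopologicalSpace.Opens (Fin d → ℝ)}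

theorem coeff_polyPartialX (i : Fin d) (P : MvPolynomial (Fin d) (SmoothFun 𝕜 U)) (m : Fin d →₀ ℕ) :
    (polyPartialX i P).coeff m = partialDer 𝕜 U i (P.coeff m) := by
  classical
  rw [polyPartialX, coeff_sum]
  simp only [coeff_monomial]
  rw [Finset.sum_ite_eq']
  split_ifs with h
  · rfl
  · rw [notMem_support_iff.1 h, map_zero]

variable (𝕜 U) in
/-- The derivative `∂_i` of fibrewise polynomial functions as an additive map. -/
def polyDer (i : Fin d) :
    MvPolynomial (Fin d) (SmoothFun 𝕜 U) →+ MvPolynomial (Fin d) (SmoothFun 𝕜 U) where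
  toFun := polyPartialX i
  map_zero' := by ext m; rw [coeff_polyPartialX, coeff_zero, map_zero]
  map_add' P Q := by
    ext m
    rw [coeff_add, coeff_polyPartialX, coeff_polyPartialX, coeff_polyPartialX, coeff_add, map_add]

theorem isCoeffDerivation_polyDer :
    IsCoeffDerivation (fun i => partialDer 𝕜 U i) (polyDer 𝕜 U) where
  map_C k a := by
    classical
    ext m
    change (polyPartialX k _).coeff m = _
    rw [coeff_polyPartialX, coeff_C, coeff_C]
    split_ifs <;> simp
  map_X k l := by
    classical
    ext m
    change (polyPartialX k _).coeff m = _
    rw [coeff_polyPartialX, coeff_X, coeff_zero]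
    split_ifs <;> simp
  leibniz k P Q := by
    classical
    ext m
    change (polyPartialX k _).coeff m = (polyPartialX k P * Q + P * polyPartialX k Q).coeff m
    rw [coeff_polyPartialX, coeff_mul, coeff_add, coeff_mul, coeff_mul, map_sum,
      ← Finset.sum_add_distrib]
    refine Finset.sum_congr rfl fun x _ => ?_
    rw [Derivation.leibniz, coeff_polyPartialX, coeff_polyPartialX, smul_eq_mul, smul_eq_mul]
    ring

theorem partialT_eq (a : Fin d ⊕ Fin d) (F : FormalFun 𝕜 U) :
    partialT a F = formalDeriv (polyDer 𝕜 U) a F := by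
  ext n : 1
  rcases a with a | a
  · simp only [partialT, formalDeriv, Sum.elim_inl, coeff_coeffwiseAdd, PowerSeries.coeff_mk]
    rfl
  · simp only [partialT, formalDeriv, Sum.elim_inr, coeff_coeffwiseAdd, PowerSeries.coeff_mk]
    rfl

theorem formalDeriv_mul (a : Fin d ⊕ Fin d) (F G : FormalFun 𝕜 U) :
    formalDeriv (polyDer 𝕜 U) a (F * G) =
      formalDeriv (polyDer 𝕜 U) a F * G + F * formalDeriv (polyDer 𝕜 U) a G := by
  ext n : 1
  rcases a with a | a
  · simp only [formalDeriv, Sum.elim_inl, coeff_coeffwiseAdd, map_add, PowerSeries.coeff_mul,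
      map_sum, isCoeffDerivation_polyDer.leibniz, Finset.sum_add_distrib]
  · simp only [formalDeriv, Sum.elim_inr, coeff_coeffwiseAdd, map_add, PowerSeries.coeff_mul,
      map_sum, ← Finset.sum_add_distrib]
    refine Finset.sum_congr rfl fun x _ => ?_
    change MvPolynomial.pderiv a _ = MvPolynomial.pderiv a _ * _ + _ * MvPolynomial.pderiv a _
    rw [Derivation.leibniz, smul_eq_mul, smul_eq_mul]
    ring

end Formal

/-! ### The Jacobi identity for the inverse of a closed form -/

/-- The inverse of a skew-symmetric matrix is skew-symmetric. -/
theorem skew_of_mul_eq_one {R T : Type*} [CommRing R] [Fintype T] [DecidableEq T]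
    {F W : Matrix T T R} (hF : ∀ a b, F a b = -F b a) (h : F * W = 1) (a b : T) :
    W a b = -W b a := by
  have h1 : F.transpose = -F := by ext a b; exact hF b a
  have h2 : W * F = 1 := mul_eq_one_comm.1 h
  have h3 : W.transpose = -W := by
    have h4 : (-W.transpose) * F = 1 := by
      have := congrArg Matrix.transpose h
      rw [Matrix.transpose_mul, h1, Matrix.transpose_one] at this
      rw [← this]
      simp
    calc W.transpose = -((-W.transpose) * (F * W)) := by rw [h]; simp
      _ = -W := by rw [← Matrix.mul_assoc, h4, Matrix.one_mul]
  exact congrFun (congrFun h3 b) a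

/-- Differentiating WF = 1 gives dW = -W(dF)W, so the Jacobiator of W is the cyclic sum of dF
contracted with three copies of W. The derivations need not commute. -/
theorem jacobi_of_closed {R T : Type*} [CommRing R] [Fintype T] [DecidableEq T]
    (p : T → R →+ R) (hp : ∀ e x y, p e (x * y) = p e x * y + x * p e y)
    {F W : Matrix T T R} (hF : ∀ a b, F a b = -F b a) (h : F * W = 1)
    (hc : ∀ a b c, p a (F b c) + p b (F c a) + p c (F a b) = 0) (a b c : T) :
    ∑ e, (W a e * p e (W b c) + W b e * p e (W c a) + W c e * p e (W a b)) = 0 := by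
  have hW := skew_of_mul_eq_one hF h
  have hWF : W * F = 1 := mul_eq_one_comm.1 h
  have hp1 : ∀ e, p e 1 = 0 := fun e => by
    have := hp e 1 1
    simpa using this
  have hone : ∀ e (a b : T), p e ((1 : Matrix T T R) a b) = 0 := fun e a b => by
    rw [Matrix.one_apply]
    split_ifs
    · exact hp1 e
    · exact map_zero _
  have hmul : ∀ e (X Y : Matrix T T R), (X * Y).map (p e) = X.map (p e) * Y + X * Y.map (p e) := by
    intro e X Y
    ext a b
    simp only [Matrix.map_apply, Matrix.mul_apply, Matrix.add_apply, map_sum, hp,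
      Finset.sum_add_distrib]
  have hd : ∀ e, W.map (p e) = -(W * F.map (p e) * W) := by
    intro e
    have h1 := hmul e W F
    have h2 : (W * F).map (p e) = 0 := by
      rw [hWF]
      ext a b
      exact hone e a b
    rw [h2] at h1
    have h3 : W.map (p e) * F = -(W * F.map (p e)) := eq_neg_of_add_eq_zero_left h1.symm
    calc W.map (p e) = W.map (p e) * (F * W) := by rw [h, Matrix.mul_one]
      _ = _ := by rw [← Matrix.mul_assoc, h3, Matrix.neg_mul]
  -- The minus sign of dW = -W(dF)W is spent on transposing the last copy of W.
  have key : ∀ a b c, ∑ e, W a e * p e (W b c) =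
      ∑ e, ∑ f, ∑ g, W a e * W b f * W c g * p e (F f g) := by
    intro a b c
    refine Finset.sum_congr rfl fun e _ => ?_
    have h1 : p e (W b c) = -∑ g, (∑ f, W b f * p e (F f g)) * W g c :=
      congrFun (congrFun (hd e) b) c
    rw [h1, ← Finset.sum_neg_distrib, Finset.mul_sum]
    simp only [Finset.sum_mul, ← Finset.sum_neg_distrib, Finset.mul_sum]
    rw [Finset.sum_comm]
    refine Finset.sum_congr rfl fun f _ => Finset.sum_congr rfl fun g _ => ?_
    rw [hW g c]
    ring
  rw [Finset.sum_add_distrib, Finset.sum_add_distrib, key a b c, key b c a, key c a b]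
  have r1 : ∑ e, ∑ f, ∑ g, W b e * W c f * W a g * p e (F f g) =
      ∑ e, ∑ f, ∑ g, W a e * W b f * W c g * p f (F g e) := by
    rw [Finset.sum_comm_cycle]
    refine Finset.sum_congr rfl fun e _ => Finset.sum_congr rfl fun f _ =>
      Finset.sum_congr rfl fun g _ => ?_
    ring
  have r2 : ∑ e, ∑ f, ∑ g, W c e * W a f * W b g * p e (F f g) =
      ∑ e, ∑ f, ∑ g, W a e * W b f * W c g * p g (F e f) := by
    rw [← Finset.sum_comm_cycle]
    refine Finset.sum_congr rfl fun e _ => Finset.sum_congr rfl fun f _ =>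
      Finset.sum_congr rfl fun g _ => ?_
    ring
  rw [r1, r2, ← Finset.sum_add_distrib, ← Finset.sum_add_distrib]
  refine Finset.sum_eq_zero fun e _ => ?_
  rw [← Finset.sum_add_distrib, ← Finset.sum_add_distrib]
  refine Finset.sum_eq_zero fun f _ => ?_
  rw [← Finset.sum_add_distrib, ← Finset.sum_add_distrib]
  refine Finset.sum_eq_zero fun g _ => ?_
  rw [← mul_add, ← mul_add, hc, mul_zero]

/-! ### The formal Poisson structure of a local symplectic embedding -/

namespace LocalSymplecticEmbedding

open MvPolynomial SuperCalculus

variable {𝕜 : Type} [RCLike 𝕜] {d : ℕ} {U : TopologicalSpace.Opens (Fin d → ℝ)}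
  {θ : AlmostPoisson 𝕜 U} (E : LocalSymplecticEmbedding θ)

/-- The brackets `{x^j, p_i}`. -/
def mixed (j i : Fin d) : FormalFun 𝕜 U := E.cosymp (Sum.inl j) (Sum.inr i)

/-- The brackets `{x^i, x^j}`, up to sign. -/
def base (i j : Fin d) : FormalFun 𝕜 U := -E.cosymp (Sum.inl i) (Sum.inl j)

theorem cosymp_skew (a b : Fin d ⊕ Fin d) : E.cosymp a b = -E.cosymp b a :=
  skew_of_mul_eq_one E.skew E.inverse a b

/-- At t = 0 the inverse is that of the canonical form, so the mixed block is the identity there.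
This is why the unary bracket is the exterior derivative. -/
theorem map_constantCoeff_cosymp :
    E.cosymp.map PowerSeries.constantCoeff = Matrix.fromBlocks 0 1 (-1) 0 := by
  have h1 := congrArg (fun M => M.map (PowerSeries.constantCoeff
    (R := MvPolynomial (Fin d) (SmoothFun 𝕜 U)))) E.inverse
  simp only [Matrix.map_mul, E.deformation] at h1
  rw [Matrix.map_one _ (map_zero _) (map_one _)] at h1
  have h2 : Matrix.fromBlocks 0 1 (-1) 0 * (Matrix.fromBlocks 0 (-1) 1 0 :
      Matrix (Fin d ⊕ Fin d) (Fin d ⊕ Fin d) (MvPolynomial (Fin d) (SmoothFun 𝕜 U))) = 1 := by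
    rw [Matrix.fromBlocks_multiply]
    simp
  calc E.cosymp.map PowerSeries.constantCoeff = 1 * E.cosymp.map PowerSeries.constantCoeff := by
        rw [Matrix.one_mul]
    _ = _ := by rw [← h2, Matrix.mul_assoc, h1, Matrix.mul_one]

theorem coeff_zero_mixed (j i : Fin d) :
    PowerSeries.coeff 0 (E.mixed j i) = if j = i then 1 else 0 := by
  have := congrFun (congrFun E.map_constantCoeff_cosymp (Sum.inl j)) (Sum.inr i)
  rw [Matrix.map_apply, Matrix.fromBlocks_apply₁₂, Matrix.one_apply] at this
  rw [PowerSeries.coeff_zero_eq_constantCoeff_apply]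
  exact this

theorem coeff_zero_base (i j : Fin d) : PowerSeries.coeff 0 (E.base i j) = 0 := by
  have := congrFun (congrFun E.map_constantCoeff_cosymp (Sum.inl i)) (Sum.inl j)
  rw [Matrix.map_apply, Matrix.fromBlocks_apply₁₁, Matrix.zero_apply] at this
  rw [PowerSeries.coeff_zero_eq_constantCoeff_apply, base, map_neg, this, neg_zero]

theorem isHomogeneous_sum {R : Type*} [CommRing R] {n : ℕ} (c : (Fin n → Fin d) → R) :
    (∑ I : Fin n → Fin d, C (c I) * ∏ k, X (I k) : MvPolynomial (Fin d) R).IsHomogeneous n := by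
  refine IsHomogeneous.sum _ _ _ fun I _ => ?_
  have h := (isHomogeneous_C (Fin d) (c I)).mul
    (IsHomogeneous.prod Finset.univ (fun k => (X (I k) : MvPolynomial (Fin d) R)) (fun _ => 1)
      fun k _ => isHomogeneous_X _ _)
  simpa using h

theorem homDeg_of_isHomogeneous {R : Type*} [CommRing R] {n : ℕ} {k : ℤ} (hk : k = n)
    {G : MvPolynomial (Fin d) R} (h : G.IsHomogeneous n) : HomDeg k G := by
  subst hk
  exact ⟨fun m hm => by rwa [Nat.cast_injective hm], fun h0 => by omega⟩

theorem jacobi (a b c : Fin d ⊕ Fin d) :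
    ∑ e, (E.cosymp a e * formalDeriv (polyDer 𝕜 U) e (E.cosymp b c) +
      E.cosymp b e * formalDeriv (polyDer 𝕜 U) e (E.cosymp c a) +
      E.cosymp c e * formalDeriv (polyDer 𝕜 U) e (E.cosymp a b)) = 0 :=
  jacobi_of_closed (formalDeriv (polyDer 𝕜 U)) formalDeriv_mul E.skew E.inverse
    (fun a b c => by simpa only [partialT_eq] using E.closed a b c) a b c

theorem cosymp_inl_inl (i j : Fin d) : E.cosymp (Sum.inl i) (Sum.inl j) = -E.base i j :=
  (neg_neg _).symm

theorem cosymp_inl_inr (i j : Fin d) : E.cosymp (Sum.inl i) (Sum.inr j) = E.mixed i j := rfl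

theorem cosymp_inr_inl (i j : Fin d) : E.cosymp (Sum.inr i) (Sum.inl j) = -E.mixed j i :=
  E.cosymp_skew _ _

-- The homogeneity is the matching of powers of t and p in the local form of the bivector. The three
-- equations are the Jacobi identity on the triples (x, x, x), (x, x, p) and (x, p, p), simplified
-- by {p_i, p_j} = 0.
set_option linter.unusedSimpArgs false in
theorem isFormalPoisson : IsFormalPoisson (polyDer 𝕜 U) E.mixed E.base where
  skew i j := by rw [base, base, E.cosymp_skew]
  hom_g N j i := by
    refine homDeg_of_isHomogeneous rfl ?_
    rcases Nat.eq_zero_or_pos N with rfl | hN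
    · rw [coeff_zero_mixed]
      split_ifs
      · exact isHomogeneous_one _ _
      · exact isHomogeneous_zero _ _ _
    · rw [mixed, E.cosymp_xp N i j hN]
      exact isHomogeneous_sum _
  hom_w N j i := by
    rcases N with _ | N
    · rw [coeff_zero_base]
      exact ⟨fun m _ => isHomogeneous_zero _ _ _, fun _ => rfl⟩
    · refine homDeg_of_isHomogeneous (n := N) (by push_cast; ring) ?_
      rw [base, map_neg, E.cosymp_xx N j i]
      exact (isHomogeneous_sum _).neg
  xxx i j m := by
    have h := E.jacobi (Sum.inl i) (Sum.inl j) (Sum.inl m)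
    simp only [Fintype.sum_sum_type, cosymp_inl_inl, cosymp_inl_inr, cosymp_inr_inl, E.cosymp_pp,
      map_neg, map_zero, mul_neg, neg_mul, neg_neg, mul_zero, zero_mul, Finset.sum_add_distrib,
      Finset.sum_neg_distrib, Finset.sum_const_zero, neg_zero, add_zero, zero_add] at h
    simp only [Finset.sum_add_distrib, Finset.sum_sub_distrib]
    linear_combination h
  xxp i j m := by
    have h := E.jacobi (Sum.inl i) (Sum.inl j) (Sum.inr m)
    simp only [Fintype.sum_sum_type, cosymp_inl_inl, cosymp_inl_inr, cosymp_inr_inl, E.cosymp_pp,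
      map_neg, map_zero, mul_neg, neg_mul, neg_neg, mul_zero, zero_mul, Finset.sum_add_distrib,
      Finset.sum_neg_distrib, Finset.sum_const_zero, neg_zero, add_zero, zero_add] at h
    simp only [Finset.sum_add_distrib, Finset.sum_sub_distrib]
    linear_combination h
  xpp i j m := by
    have h := E.jacobi (Sum.inl i) (Sum.inr j) (Sum.inr m)
    simp only [Fintype.sum_sum_type, cosymp_inl_inl, cosymp_inl_inr, cosymp_inr_inl, E.cosymp_pp,
      map_neg, map_zero, mul_neg, neg_mul, neg_neg, mul_zero, zero_mul, Finset.sum_add_distrib,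
      Finset.sum_neg_distrib, Finset.sum_const_zero, neg_zero, add_zero, zero_add] at h
    simp only [Finset.sum_add_distrib, Finset.sum_sub_distrib]
    linear_combination h

end LocalSymplecticEmbedding

end PInftyForms

end

noncomputable section

namespace PInftyForms

open MvPolynomial

/-! ### Polarization of homogeneous polynomials -/

section Polar

variable {A : Type*} [CommRing A] {d : ℕ}

/-- The polarization of the part of degree `n` of a polynomial. -/
def polar : (n : ℕ) → MvPolynomial (Fin d) A → (Fin n → Fin d → A) → A
  | 0, G, _ => constantCoeff G
  | n + 1, G, α => ∑ l, α 0 l * polar n (pderiv l G) (Fin.tail α)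

theorem polar_neg {n : ℕ} (G : MvPolynomial (Fin d) A) (α : Fin n → Fin d → A) :
    polar n (-G) α = -polar n G α := by
  induction n generalizing G with
  | zero => simp [polar]
  | succ n ih => simp [polar, ih]

theorem polar_nsmul {n : ℕ} (r : ℕ) (G : MvPolynomial (Fin d) A) (α : Fin n → Fin d → A) :
    polar n (r • G) α = r • polar n G α := by
  induction n generalizing G with
  | zero => simp [polar]
  | succ n ih => simp only [polar, map_nsmul, ih, mul_smul_comm, Finset.smul_sum]

theorem sum_insertNth {n : ℕ} {M : Type*} [AddCommMonoid M] (p : Fin (n + 1))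
    (F : (Fin (n + 1) → Fin d) → M) :
    ∑ I, F I = ∑ l, ∑ J : Fin n → Fin d, F (p.insertNth l J) := by
  rw [← (Fin.insertNthEquiv (fun _ => Fin d) p).sum_comp, Fintype.sum_prod_type]
  rfl

theorem derivation_prod_univ {R B : Type*} [CommRing R] [CommRing B] [Algebra R B]
    (D : Derivation R B B) {n : ℕ} (x : Fin (n + 1) → B) :
    D (∏ k, x k) = ∑ p, D (x p) * ∏ k, x (p.succAbove k) := by
  induction n with
  | zero => simp
  | succ n ih =>
    rw [Fin.prod_univ_succ, D.leibniz, ih]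
    rw [add_comm, smul_eq_mul, smul_eq_mul, Finset.mul_sum, mul_comm, Fin.sum_univ_succ (n := n + 1)]
    refine congrArg₂ _ (by simp only [Fin.zero_succAbove]) ?_
    refine Finset.sum_congr rfl fun p _ => ?_
    rw [Fin.prod_univ_succ]
    simp only [Fin.succ_succAbove_zero, Fin.succ_succAbove_succ]
    ring

/-- Leibniz' rule gives one term for each of the n + 1 positions. Symmetry of the coefficients moves
the differentiated index to the front, so these terms coincide. -/
theorem pderiv_sum_symm {n : ℕ} (c : (Fin (n + 1) → Fin d) → A)
    (hc : ∀ I (σ : Equiv.Perm (Fin (n + 1))), c (I ∘ σ) = c I) (l : Fin d) :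
    pderiv l (∑ I : Fin (n + 1) → Fin d, C (c I) * ∏ k, X (I k)) =
      (n + 1) • ∑ J : Fin n → Fin d, C (c (Fin.cons l J)) * ∏ k, X (J k) := by
  have h1 : ∀ (p : Fin (n + 1)) (J : Fin n → Fin d), c (p.insertNth l J) = c (Fin.cons l J) :=
    fun p J => by rw [← Fin.insertNth_comp_cycleRange_symm p l J, hc]
  simp only [map_sum, pderiv_C_mul, derivation_prod_univ, Finset.mul_sum]
  rw [Finset.sum_comm]
  have h2 : ∀ p : Fin (n + 1), ∑ I : Fin (n + 1) → Fin d,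
      (C (c I) * (pderiv l (X (I p)) * ∏ k, X (I (p.succAbove k))) : MvPolynomial (Fin d) A) =
      ∑ J : Fin n → Fin d, C (c (Fin.cons l J)) * ∏ k, X (J k) := by
    intro p
    rw [sum_insertNth p, Finset.sum_eq_single l]
    · refine Finset.sum_congr rfl fun J _ => ?_
      simp only [Fin.insertNth_apply_same, Fin.insertNth_apply_succAbove, h1, pderiv_X_self,
        one_mul]
    · intro l' _ hl
      refine Finset.sum_eq_zero fun J _ => ?_
      rw [Fin.insertNth_apply_same, pderiv_X_of_ne hl, zero_mul, mul_zero]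
    · simp
  simp only [h2, Finset.sum_const, Finset.card_univ, Fintype.card_fin]

/-- Iterating the previous derivative formula collects n!, the factor in the definitions of the
tensors of the embedding. -/
theorem polar_sum_symm {n : ℕ} (c : (Fin n → Fin d) → A)
    (hc : ∀ I (σ : Equiv.Perm (Fin n)), c (I ∘ σ) = c I) (α : Fin n → Fin d → A) :
    polar n (∑ I : Fin n → Fin d, C (c I) * ∏ k, X (I k)) α =
      n.factorial • ∑ I, c I * ∏ k, α k (I k) := by
  induction n with
  | zero => simp [polar]
  | succ n ih =>
    have h : ∀ l, polar n (∑ J : Fin n → Fin d, C (c (Fin.cons l J)) * ∏ k, X (J k))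
        (Fin.tail α) = n.factorial • ∑ J : Fin n → Fin d, c (Fin.cons l J) *
          ∏ k, Fin.tail α k (J k) := fun l =>
      ih _ (fun J σ => by
        -- The pair (0, σ) encodes the permutation fixing the first position and acting as σ on the
        -- others.
        rw [← hc (Fin.cons l J) (Equiv.Perm.decomposeFin.symm (0, σ))]
        congr 1
        funext i
        refine Fin.cases ?_ (fun i => ?_) i
        · simp
        · simp) _
    simp only [polar, pderiv_sum_symm c hc, polar_nsmul, h]
    rw [sum_insertNth 0, Finset.smul_sum]
    refine Finset.sum_congr rfl fun l _ => ?_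
    rw [smul_smul, mul_smul_comm, ← Nat.factorial_succ, Finset.mul_sum]
    congr 1
    refine Finset.sum_congr rfl fun J _ => ?_
    rw [Fin.prod_univ_succ, Fin.insertNth_zero]
    simp only [Fin.cons_zero, Fin.cons_succ, Fin.tail]
    exact mul_left_comm _ _ _

end Polar

/-! ### Multiderivations on functions and one-forms -/

section Generators

open SuperCalculus

variable {𝕜 : Type*} [Field 𝕜] {A : Type*} [CommRing A] [Algebra 𝕜 A] {d : ℕ}
  {δ : Fin d → Derivation 𝕜 A A} {hδ : ∀ i j a, δ i (δ j a) = δ j (δ i a)}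

local notation "Ωd" => ExteriorAlgebra A (Fin d → A)
local notation "ιΩ" => algebraMap A (ExteriorAlgebra A (Fin d → A))
local notation "CΩ" => extCalculus δ hδ (Function.Embedding.refl (Fin d))

theorem par_extι (m : Fin d → A) : (CΩ).Par 1 (ExteriorAlgebra.ι A m) :=
  par_odd.2 (extS_ι m)

theorem multi_ones_succ {n c : ℕ} (h : List (Fin d ⊕ Fin d) → Ωd)
    (α : Fin (n + 1) → Fin d → A) :
    (CΩ).multi (n + 1) c h (fun i => ExteriorAlgebra.ι A (α i)) =
      ∑ j, ExteriorAlgebra.ι A (derivComp (δ j) (α 0)) *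
          (CΩ).multi n c (fun l => h (Sum.inl j :: l)) (fun i => ExteriorAlgebra.ι A (Fin.tail α i)) +
        ∑ l, α 0 l • (CΩ).multi n c (fun t => h (Sum.inr l :: t))
          (fun i => ExteriorAlgebra.ι A (Fin.tail α i)) := by
  rw [multi_odd_succ (par_extι _), Fintype.sum_sum_type]
  congr 1
  · refine Finset.sum_congr rfl fun j _ => ?_
    congr 1
    exact extD_ι _ _
  · refine Finset.sum_congr rfl fun l _ => ?_
    rw [Algebra.smul_def, multi_odd_indep (C := CΩ) (c + indexDeg (Sum.inr l : Fin d ⊕ Fin d)) c _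
      (v := Fin.tail fun i => ExteriorAlgebra.ι A (α i)) (fun i => par_extι _)]
    congr 1
    exact extI_ι _ _

/-- Contractions kill functions, so only even indices remain. The sign is the twist of an even
argument. -/
theorem multi_fun_succ {n c : ℕ} (h : List (Fin d ⊕ Fin d) → Ωd) (f : A) (v : Fin n → Ωd) :
    (CΩ).multi (n + 1) c h (Fin.cons (ιΩ f) v) =
      (-1 : ℤ) ^ c • ∑ j, δ j f • (CΩ).multi n c (fun l => h (Sum.inl j :: l)) v := by
  have ht : ∀ c, (CΩ).tw c (ιΩ f) = (-1 : ℤ) ^ c • ιΩ f := by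
    intro c
    have hs : (CΩ).s (ιΩ f) = ιΩ f := extS_algebraMap f
    rcases Nat.even_or_odd c with hc | hc
    · rw [tw_even _ hc, hc.neg_one_pow, one_smul]
    · rw [tw_odd _ hc, hc.neg_one_pow, neg_one_smul, hs]
  rw [multi_succ, Fintype.sum_sum_type]
  simp only [Fin.cons_zero, Fin.tail_cons, ht]
  have h2 : ∀ l : Fin d, (CΩ).dz (Sum.inr l) (ιΩ f) = 0 := fun l => extI_algebraMap _ _
  have h1 : ∀ l : Fin d, (CΩ).dz (Sum.inl l) (ιΩ f) = ιΩ (δ l f) := fun l => extD_algebraMap _ _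
  have h3 : ∀ (m : ℕ) (z : Fin d ⊕ Fin d), (CΩ).dz z ((-1 : ℤ) ^ m • ιΩ f) =
    (-1 : ℤ) ^ m • (CΩ).dz z (ιΩ f) := fun m z => map_zsmul _ _ _
  simp only [h3, h1, h2, smul_zero, zero_mul, Finset.sum_const_zero, add_zero, smul_mul_assoc]
  rw [Finset.smul_sum]
  refine Finset.sum_congr rfl fun j _ => ?_
  rw [← Algebra.smul_def]
  rfl

theorem multi_symbolTwo_ones {n c : ℕ} (G : MvPolynomial (Fin d) A) (α : Fin n → Fin d → A) :
    (CΩ).multi n c (symbolTwo ιΩ G) (fun i => ExteriorAlgebra.ι A (α i)) = ιΩ (polar n G α) := by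
  induction n generalizing G with
  | zero => rfl
  | succ n ih =>
    rw [multi_ones_succ, polar, map_sum]
    have h0 : ∀ j, (CΩ).multi n c (fun l => symbolTwo ιΩ G (Sum.inl j :: l))
        (fun i => ExteriorAlgebra.ι A (Fin.tail α i)) = 0 := fun j => multi_zero_symbol _ _ _
    simp only [h0, mul_zero, Finset.sum_const_zero, zero_add]
    refine Finset.sum_congr rfl fun l _ => ?_
    rw [map_mul, ← Algebra.smul_def, ← ih]
    rfl

theorem comp_succ_succAbove_zero {n : ℕ} {M : Type*} (α : Fin (n + 2) → M) (p : Fin (n + 1)) :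
    (α ∘ p.succ.succAbove) 0 = α 0 := by simp

theorem tail_comp_succ_succAbove {n : ℕ} {M : Type*} (α : Fin (n + 2) → M) (p : Fin (n + 1)) :
    Fin.tail (α ∘ p.succ.succAbove) = Fin.tail α ∘ p.succAbove := by
  funext i
  simp [Fin.tail]

/-- Polarizations with one argument in a distinguished slot. -/
def polarOne {T : Type*} [Fintype T] (Φ : T → (Fin d → A) → Ωd) (w : T → MvPolynomial (Fin d) A) :
    (n : ℕ) → (Fin n → Fin d → A) → Ωd
  | 0, _ => 0
  | n + 1, α => ∑ p, ∑ a, polar n (w a) (α ∘ p.succAbove) • Φ a (α p)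

/-- Either the distinguished slot is the first one, or the first argument is polarized and the
distinguished slot comes later. -/
theorem polarOne_succ {T : Type*} [Fintype T] (Φ : T → (Fin d → A) → Ωd)
    (w : T → MvPolynomial (Fin d) A) (n : ℕ) (α : Fin (n + 1) → Fin d → A) :
    polarOne Φ w (n + 1) α = ∑ a, polar n (w a) (Fin.tail α) • Φ a (α 0) +
      ∑ l, α 0 l • polarOne Φ (fun a => pderiv l (w a)) n (Fin.tail α) := by
  rw [polarOne, Fin.sum_univ_succ]
  congr 1
  cases n with
  | zero => simp [polarOne]
  | succ n =>
    simp only [polarOne, polar, comp_succ_succAbove_zero, tail_comp_succ_succAbove, Finset.sum_smul,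
      Finset.smul_sum, mul_smul]
    rw [Finset.sum_comm_cycle]
    rfl

variable (δ) in
/-- Polarizations with two arguments in distinguished slots. -/
def polarTwo (w : Fin d → Fin d → MvPolynomial (Fin d) A) :
    (n : ℕ) → (Fin n → Fin d → A) → Ωd
  | 0, _ => 0
  | 1, _ => 0
  | n + 2, α => ∑ i : Fin (n + 2), ∑ k : Fin (n + 1), if i < i.succAbove k then
      ∑ a, ∑ b, polar n (w a b) (α ∘ i.succAbove ∘ k.succAbove) •
        (ExteriorAlgebra.ι A (derivComp (δ a) (α i)) *
          ExteriorAlgebra.ι A (derivComp (δ b) (α (i.succAbove k)))) else 0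

/-- The same dichotomy for an ordered pair of distinguished slots: if it contains the first slot,
one distinguished slot remains to be chosen among the others. -/
theorem polarTwo_succ (w : Fin d → Fin d → MvPolynomial (Fin d) A) (n : ℕ)
    (α : Fin (n + 1) → Fin d → A) :
    polarTwo δ w (n + 1) α = ∑ a, ExteriorAlgebra.ι A (derivComp (δ a) (α 0)) *
        polarOne (fun b m => ExteriorAlgebra.ι A (derivComp (δ b) m)) (w a) n (Fin.tail α) +
      ∑ l, α 0 l • polarTwo δ (fun a b => pderiv l (w a b)) n (Fin.tail α) := by
  cases n with
  | zero => simp [polarTwo, polarOne]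
  | succ n =>
    rw [polarTwo, Fin.sum_univ_succ]
    congr 1
    · simp only [polarOne, Fin.zero_succAbove, Fin.succ_pos, if_true, Finset.mul_sum, mul_smul_comm]
      rw [Finset.sum_comm]
      rfl
    · have h0 : ∀ i : Fin (n + 1), ¬ (i.succ < i.succ.succAbove 0) := fun i => by simp
      refine (Finset.sum_congr rfl fun i _ => by
        rw [Fin.sum_univ_succ, if_neg (h0 i), zero_add]).trans ?_
      simp only [Fin.succ_succAbove_succ, Fin.succ_lt_succ_iff]
      cases n with
      | zero => simp [polarTwo]
      | succ n =>
        have h1 : ∀ (i : Fin (n + 2)) (k : Fin (n + 1)),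
            (α ∘ i.succ.succAbove ∘ k.succ.succAbove) 0 = α 0 := fun i k => by simp
        have h2 : ∀ (i : Fin (n + 2)) (k : Fin (n + 1)),
            Fin.tail (α ∘ i.succ.succAbove ∘ k.succ.succAbove) =
              Fin.tail α ∘ i.succAbove ∘ k.succAbove := fun i k => by
          funext r
          simp [Fin.tail]
        have h3 : ∀ (c : Prop) [Decidable c] (β : Fin n → Fin d → A) (Z : Fin d → Fin d → Ωd),
            (if c then ∑ a, ∑ b, (∑ l, α 0 l * polar n (pderiv l (w a b)) β) • Z a b else 0) =
              ∑ l, α 0 l • if c then ∑ a, ∑ b, polar n (pderiv l (w a b)) β • Z a b else 0 := by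
          intro c _ β Z
          split_ifs
          · simp only [Finset.sum_smul, Finset.smul_sum, mul_smul]
            rw [Finset.sum_comm_cycle]
          · simp
        simp only [polarTwo, polar, h1, h2, h3]
        rw [Finset.sum_comm_cycle]
        simp only [Finset.smul_sum]
        rfl

theorem multi_symbolOne_ones {n c : ℕ} (g w : Fin d → MvPolynomial (Fin d) A)
    (α : Fin n → Fin d → A) :
    (CΩ).multi n c (symbolOne CΩ ιΩ g w) (fun i => ExteriorAlgebra.ι A (α i)) =
      ∑ i, polar n (g i) α • ExteriorAlgebra.ι A (Pi.single i 1) +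
        polarOne (fun b m => ExteriorAlgebra.ι A (derivComp (δ b) m)) w n α := by
  induction n generalizing g w with
  | zero =>
    rw [polarOne, add_zero]
    change ∑ i, ιΩ (constantCoeff (g i)) * ExteriorAlgebra.ι A (Pi.single i 1) = _
    exact Finset.sum_congr rfl fun i _ => (Algebra.smul_def _ _).symm
  | succ n ih =>
    rw [multi_ones_succ, polarOne_succ]
    have h1 : ∀ j, (CΩ).multi n c (fun l => symbolOne CΩ ιΩ g w (Sum.inl j :: l))
        (fun i => ExteriorAlgebra.ι A (Fin.tail α i)) = ιΩ (polar n (w j) (Fin.tail α)) :=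
      fun j => multi_symbolTwo_ones _ _
    have h2 : ∀ l, (CΩ).multi n c (fun t => symbolOne CΩ ιΩ g w (Sum.inr l :: t))
        (fun i => ExteriorAlgebra.ι A (Fin.tail α i)) = _ := fun l => ih _ _ _
    simp only [h1, h2, smul_add, Finset.sum_add_distrib, polar, Finset.sum_smul, Finset.smul_sum,
      mul_smul]
    rw [Finset.sum_comm (s := Finset.univ) (t := Finset.univ)
      (f := fun i l => α 0 l • polar n (pderiv l (g i)) (Fin.tail α) •
        ExteriorAlgebra.ι A (Pi.single i 1)), add_left_comm]
    refine congrArg₂ _ rfl (congrArg₂ _ (Finset.sum_congr rfl fun j _ => ?_) rfl)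
    rw [Algebra.smul_def, Algebra.commutes]

/-- The slots that receive a Lie derivative are the distinguished ones: one for the mixed part, two
for the quadratic part. The two are listed once, in the order of the slots, and this absorbs the ½.
-/
theorem multi_symbolZero_ones {n c : ℕ} (g w : Fin d → Fin d → MvPolynomial (Fin d) A)
    (α : Fin n → Fin d → A) :
    (CΩ).multi n c (symbolZero CΩ ιΩ g w) (fun i => ExteriorAlgebra.ι A (α i)) =
      polarOne (fun (a : Fin d × Fin d) m => ExteriorAlgebra.ι A (derivComp (δ a.1) m) *
        ExteriorAlgebra.ι A (Pi.single a.2 1)) (fun a => g a.1 a.2) n α + polarTwo δ w n α := by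
  induction n generalizing g w with
  | zero => rw [polarOne, polarTwo, add_zero]; rfl
  | succ n ih =>
    rw [multi_ones_succ, polarOne_succ, polarTwo_succ]
    have h1 : ∀ j, (CΩ).multi n c (fun l => symbolZero CΩ ιΩ g w (Sum.inl j :: l))
        (fun i => ExteriorAlgebra.ι A (Fin.tail α i)) = _ :=
      fun j => multi_symbolOne_ones (g j) (w j) _
    have h2 : ∀ l, (CΩ).multi n c (fun t => symbolZero CΩ ιΩ g w (Sum.inr l :: t))
        (fun i => ExteriorAlgebra.ι A (Fin.tail α i)) = _ := fun l => ih _ _ _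
    simp only [h1, h2, smul_add, mul_add, Finset.sum_add_distrib, Fintype.sum_prod_type,
      Finset.mul_sum, mul_smul_comm]
    abel

theorem multi_symbolZero_fun_ones {n c : ℕ} (g w : Fin d → Fin d → MvPolynomial (Fin d) A) (f : A)
    (α : Fin n → Fin d → A) :
    (CΩ).multi (n + 1) c (symbolZero CΩ ιΩ g w)
        (Fin.cons (ιΩ f) fun i => ExteriorAlgebra.ι A (α i)) =
      (-1 : ℤ) ^ c • ∑ j, δ j f • (∑ i, polar n (g j i) α • ExteriorAlgebra.ι A (Pi.single i 1) +
        polarOne (fun b m => ExteriorAlgebra.ι A (derivComp (δ b) m)) (w j) n α) := by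
  rw [multi_fun_succ]
  congr 1
  refine Finset.sum_congr rfl fun j _ => ?_
  congr 1
  exact multi_symbolOne_ones (g j) (w j) _

theorem multi_symbolZero_fun_fun_ones {n c : ℕ} (g w : Fin d → Fin d → MvPolynomial (Fin d) A)
    (f f' : A) (α : Fin n → Fin d → A) :
    (CΩ).multi (n + 2) c (symbolZero CΩ ιΩ g w)
        (Fin.cons (ιΩ f) (Fin.cons (ιΩ f') fun i => ExteriorAlgebra.ι A (α i))) =
      ∑ j, ∑ i, ιΩ (δ j f * (δ i f' * polar n (w j i) α)) := by
  rw [multi_fun_succ]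
  have h1 : ∀ j, (CΩ).multi (n + 1) c (fun l => symbolZero CΩ ιΩ g w (Sum.inl j :: l))
      (Fin.cons (ιΩ f') fun i => ExteriorAlgebra.ι A (α i)) =
        (-1 : ℤ) ^ c • ∑ i, ιΩ (δ i f' * polar n (w j i) α) := by
    intro j
    rw [multi_fun_succ]
    congr 1
    refine Finset.sum_congr rfl fun i _ => ?_
    rw [map_mul, ← Algebra.smul_def]
    congr 1
    exact multi_symbolTwo_ones (w j i) _
  -- Even indices leave the counter unchanged, so both functions contribute the same sign (-1)^c and
  -- the signs cancel.
  rw [Finset.sum_congr rfl fun j _ => by rw [h1, smul_comm], ← Finset.smul_sum,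
    smul_smul, ← mul_pow, neg_one_mul, neg_neg, one_pow, one_smul]
  refine Finset.sum_congr rfl fun j _ => ?_
  rw [Finset.smul_sum]
  refine Finset.sum_congr rfl fun i _ => ?_
  simp only [map_mul, Algebra.smul_def]

end Generators

end PInftyForms

end

noncomputable section

namespace PInftyForms

/-! ### The brackets of a local symplectic embedding on generators -/

namespace LocalSymplecticEmbedding

open MvPolynomial SuperCalculus

variable {𝕜 : Type} [RCLike 𝕜] {d : ℕ} {U : TopologicalSpace.Opens (Fin d → ℝ)}
  {θ : AlmostPoisson 𝕜 U} (E : LocalSymplecticEmbedding θ)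

/-- The brackets on differential forms defined by a local symplectic embedding. -/
def formBrackets (n : ℕ) : MultilinearMap 𝕜 (fun _ : Fin n => Forms 𝕜 U) (Forms 𝕜 U) :=
  brackets (extCalculus (partialDer 𝕜 U) partialDer_comm (Function.Embedding.refl (Fin d)))
    (algebraMap (SmoothFun 𝕜 U) (Forms 𝕜 U)) E.mixed E.base n

theorem formBrackets_succ (N : ℕ) (v : Fin (N + 1) → Forms 𝕜 U) :
    E.formBrackets (N + 1) v = sgnTri (N + 1) •
      (extCalculus (partialDer 𝕜 U) partialDer_comm (Function.Embedding.refl (Fin d))).multi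
        (N + 1) (N + 1)
        (symbolZero (extCalculus (partialDer 𝕜 U) partialDer_comm (Function.Embedding.refl (Fin d)))
          (algebraMap (SmoothFun 𝕜 U) (Forms 𝕜 U)) (coeffMatrix N E.mixed) (coeffMatrix N E.base))
        v := rfl

theorem polar_mixed (n : ℕ) (i j : Fin d) (α : Fin (n + 1) → OneForm 𝕜 U) :
    polar (n + 1) (coeffMatrix (n + 1) E.mixed j i) α =
      (n + 1).factorial • ∑ I, E.gam (n + 1) i j I * ∏ k, α k (I k) := by
  rw [coeffMatrix, mixed, E.cosymp_xp _ i j n.succ_pos]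
  exact polar_sum_symm _ (E.gam_symm _ i j) α

theorem polar_base (n : ℕ) (i j : Fin d) (α : Fin n → OneForm 𝕜 U) :
    polar n (coeffMatrix (n + 1) E.base i j) α =
      -(n.factorial • ∑ I, E.the n i j I * ∏ k, α k (I k)) := by
  rw [coeffMatrix, base, map_neg, E.cosymp_xx, polar_neg]
  exact congrArg _ (polar_sum_symm _ (E.the_symm _ i j) α)

theorem ofOne_eq_sum (α : OneForm 𝕜 U) : ofOne α = ∑ i, α i • ofOne (dx i) := by
  conv_lhs => rw [pi_eq_sum_univ' α]
  simp only [ofOne, map_sum, map_smul, dx]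

theorem formBrackets_fun_fun_ones (n : ℕ) (f g : SmoothFun 𝕜 U) (α : Fin n → OneForm 𝕜 U) :
    E.formBrackets (n + 2) (Fin.cons (ofFun f) (Fin.cons (ofFun g) fun i => ofOne (α i))) =
      ofFun (sgnTri n • E.thetaEval n (dFun f) (dFun g) α) := by
  rw [formBrackets_succ]
  refine (congrArg _ (multi_symbolZero_fun_fun_ones _ _ _ _ _)).trans ?_
  -- This minus sign compensates the one in `base`.
  have hs : sgnTri (n + 2) = -sgnTri n := by
    rw [sgnTri_succ, sgnTri_succ]
    rcases Nat.even_or_odd n with h | h <;> simp [pow_succ, h.neg_one_pow]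
  rw [hs, ofFun, map_zsmul, neg_smul, ← smul_neg]
  congr 1
  simp only [← map_sum, ← map_neg]
  congr 1
  simp only [polar_base, thetaEval, mul_neg, Finset.sum_neg_distrib, neg_neg, Finset.smul_sum,
    Finset.mul_sum, mul_smul_comm]
  refine Finset.sum_congr rfl fun j _ => Finset.sum_congr rfl fun i _ =>
    Finset.sum_congr rfl fun I _ => ?_
  simp only [partialDer_apply, dFun]
  congr 1
  ring

theorem ofOne_thetaTensorOne (n : ℕ) (lam β : OneForm 𝕜 U) (α : Fin n → OneForm 𝕜 U) :
    ofOne (E.thetaTensorOne n lam β α) = ∑ i, ∑ j,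
      (lam i * (n.factorial • ∑ I, E.the n i j I * ∏ k, α k (I k))) • ofOne (lieX j β) := by
  simp only [thetaTensorOne, ofOne, map_nsmul, map_sum, map_smul, Finset.smul_sum, Finset.mul_sum,
    Finset.sum_smul]
  refine Finset.sum_congr rfl fun j _ => Finset.sum_congr rfl fun i _ =>
    Finset.sum_congr rfl fun I _ => ?_
  rw [← smul_assoc]
  congr 1
  rw [mul_smul_comm]
  congr 1
  ring

theorem formBrackets_fun_ones (n : ℕ) (f : SmoothFun 𝕜 U) (α : Fin (n + 1) → OneForm 𝕜 U) :
    E.formBrackets (n + 2) (Fin.cons (ofFun f) fun i => ofOne (α i)) =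
      ofOne (sgnTri (n + 1) • (E.gammaEval (n + 1) (dFun f) α -
        ∑ i, E.thetaTensorOne n (dFun f) (α i) (α ∘ i.succAbove))) := by
  rw [formBrackets_succ]
  refine (congrArg _ (multi_symbolZero_fun_ones _ _ _ _)).trans ?_
  -- The twist of the function has exponent n + 2, the arity, and lowers the index of the triangular
  -- sign by one.
  have hs : sgnTri (n + 2) * (-1) ^ (n + 2) = sgnTri (n + 1) := by
    rw [sgnTri_succ, mul_assoc, ← mul_pow]
    simp
  rw [smul_smul, hs, ofOne, map_zsmul]
  congr 1
  simp only [smul_add, Finset.sum_add_distrib, polarOne, polar_base, polar_mixed]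
  rw [map_sub, map_sum, sub_eq_add_neg, ← Finset.sum_neg_distrib]
  refine congrArg₂ _ ?_ ?_
  · refine Eq.trans ?_ (ofOne_eq_sum _).symm
    simp only [gammaEval, Finset.smul_sum, Finset.sum_smul]
    rw [Finset.sum_comm]
    refine Finset.sum_congr rfl fun i _ => Finset.sum_congr rfl fun j _ =>
      Finset.sum_congr rfl fun I _ => ?_
    rw [smul_smul]
    congr 1
    rw [mul_smul_comm]
    congr 1
    simp only [partialDer_apply, dFun]
    ring
  · simp only [Finset.smul_sum]
    rw [Finset.sum_comm]
    refine Finset.sum_congr rfl fun p _ => ?_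
    refine Eq.trans ?_ (congrArg Neg.neg (E.ofOne_thetaTensorOne _ _ _ _).symm)
    simp only [← Finset.sum_neg_distrib]
    refine Finset.sum_congr rfl fun i _ => Finset.sum_congr rfl fun j _ => ?_
    rw [smul_smul, Finset.sum_neg_distrib, mul_neg, neg_smul, ← Finset.smul_sum]
    rfl

theorem gammaTensor_eq (n : ℕ) (β : OneForm 𝕜 U) (α : Fin n → OneForm 𝕜 U) :
    E.gammaTensor n β α = ∑ a : Fin d × Fin d,
      (n.factorial • ∑ I, E.gam n a.2 a.1 I * ∏ k, α k (I k)) •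
        (ofOne (lieX a.1 β) * ofOne (dx a.2)) := by
  simp only [gammaTensor, Fintype.sum_prod_type, Finset.smul_sum, Finset.sum_smul, smul_assoc]
  exact Finset.sum_comm

theorem thetaTensorTwo_eq (n : ℕ) (β β' : OneForm 𝕜 U) (α : Fin n → OneForm 𝕜 U) :
    E.thetaTensorTwo n β β' α = ∑ i, ∑ j,
      (n.factorial • ∑ I, E.the n i j I * ∏ k, α k (I k)) •
        (ofOne (lieX i β) * ofOne (lieX j β')) := by
  simp only [thetaTensorTwo, Finset.smul_sum, Finset.sum_smul, smul_assoc]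

theorem formBrackets_ones (n : ℕ) (α : Fin (n + 2) → OneForm 𝕜 U) :
    E.formBrackets (n + 2) (fun i => ofOne (α i)) =
      sgnTri (n + 2) • (∑ i, E.gammaTensor (n + 1) (α i) (α ∘ i.succAbove) -
        ∑ i : Fin (n + 2), ∑ k : Fin (n + 1), if i < i.succAbove k then
          E.thetaTensorTwo n (α i) (α (i.succAbove k)) (α ∘ i.succAbove ∘ k.succAbove) else 0) := by
  rw [formBrackets_succ]
  refine congrArg _ ((multi_symbolZero_ones _ _ _).trans ?_)
  rw [sub_eq_add_neg]
  simp only [polarOne, polarTwo, polar_base, polar_mixed, gammaTensor_eq, thetaTensorTwo_eq]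
  refine congrArg₂ _ rfl ?_
  simp only [← Finset.sum_neg_distrib]
  refine Finset.sum_congr rfl fun i _ => Finset.sum_congr rfl fun k _ => ?_
  split_ifs
  · simp only [neg_smul, Finset.sum_neg_distrib]
    rfl
  · exact neg_zero.symm

theorem formBrackets_one_fun (f : SmoothFun 𝕜 U) :
    E.formBrackets 1 ![ofFun f] = ofOne (dFun f) := by
  rw [formBrackets_succ]
  have h2 : ∀ j, (extCalculus (partialDer 𝕜 U) partialDer_comm
      (Function.Embedding.refl (Fin d))).multi 0 1
        (symbolOne (extCalculus (partialDer 𝕜 U) partialDer_comm (Function.Embedding.refl (Fin d)))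
          (algebraMap (SmoothFun 𝕜 U) (Forms 𝕜 U)) (coeffMatrix 0 E.mixed j)
          (coeffMatrix 0 E.base j)) ![] = ofOne (dx j) := by
    intro j
    refine Eq.trans (b := ∑ i, algebraMap (SmoothFun 𝕜 U) (Forms 𝕜 U)
      (constantCoeff (coeffMatrix 0 E.mixed j i)) * ofOne (dx i)) rfl ?_
    rw [Finset.sum_eq_single j]
    · rw [coeffMatrix, coeff_zero_mixed, if_pos rfl, map_one, map_one, one_mul]
    · intro i _ hi
      rw [coeffMatrix, coeff_zero_mixed, if_neg hi.symm, map_zero, map_zero, zero_mul]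
    · simp
  refine (congrArg _ ((multi_fun_succ _ _ _).trans (congrArg _ (Finset.sum_congr rfl fun i _ =>
      congrArg _ (h2 i))))).trans ?_
  rw [ofOne_eq_sum, smul_smul]
  simp [sgnTri, dFun, partialDer_apply]

theorem formBrackets_one_one (α : OneForm 𝕜 U) : E.formBrackets 1 ![ofOne α] = dOne α := by
  rw [formBrackets_succ]
  have h : (![ofOne α] : Fin 1 → Forms 𝕜 U) = fun i => ExteriorAlgebra.ι _ (![α] i) := by
    funext i
    fin_cases i
    rfl
  rw [h]
  refine (congrArg _ (multi_symbolZero_ones _ _ _)).trans ?_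
  simp only [polarTwo, polarOne, add_zero, Fintype.sum_prod_type, polar, coeffMatrix,
    coeff_zero_mixed]
  -- The sign -1 turns L_j α ∧ dx^j into dx^j ∧ L_j α.
  have h1 : sgnTri (0 + 1) = -1 := rfl
  rw [h1, neg_one_smul, dOne, ← Finset.sum_neg_distrib, Fin.sum_univ_one, ← Finset.sum_neg_distrib]
  refine Finset.sum_congr rfl fun j _ => ?_
  rw [Finset.sum_eq_single j]
  · rw [if_pos rfl, map_one, one_smul]
    exact neg_eq_of_add_eq_zero_left (ExteriorAlgebra.ι_add_mul_swap _ _)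
  · intro i _ hi
    rw [if_neg hi.symm, map_zero, zero_smul]
  · simp

/-- The low brackets are instances of the general formulas, rewritten with the given coefficients of
orders zero and one of the base part, θ^{ij} and -Π^{ijk}. -/
theorem hasGeneratorBrackets : HasGeneratorBrackets E E.formBrackets where
  one_fun := E.formBrackets_one_fun
  one_one := E.formBrackets_one_one
  two_fun_fun f g := by
    have h := E.formBrackets_fun_fun_ones 0 f g ![]
    have hv : (Fin.cons (ofFun f) (Fin.cons (ofFun g) fun i => ofOne ((![] : Fin 0 → _) i)) :
        Fin 2 → Forms 𝕜 U) = ![ofFun f, ofFun g] := by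
      funext i
      fin_cases i <;> rfl
    rw [hv] at h
    rw [h]
    simp [thetaEval, AlmostPoisson.bracket, sgnTri, E.the_zero, dFun]
  two_fun_one f α := by
    have h := E.formBrackets_fun_ones 0 f ![α]
    have hv : (Fin.cons (ofFun f) fun i => ofOne ((![α] : Fin 1 → _) i) :
        Fin 2 → Forms 𝕜 U) = ![ofFun f, ofOne α] := by
      funext i
      fin_cases i <;> rfl
    rw [hv] at h
    rw [h, show sgnTri (0 + 1) = -1 from rfl, neg_one_smul, neg_sub]
    simp [thetaTensorOne, AlmostPoisson.bracketFunOne, E.the_zero, dFun]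
  two_one_one α β := by
    have h := E.formBrackets_ones 0 ![α, β]
    have hv : (fun i => ofOne ((![α, β] : Fin 2 → _) i) :
        Fin 2 → Forms 𝕜 U) = ![ofOne α, ofOne β] := by
      funext i
      fin_cases i <;> rfl
    have h0 : (![α, β] : Fin 2 → _) ∘ (0 : Fin 2).succAbove = ![β] := by
      funext i
      fin_cases i
      rfl
    have h1 : (![α, β] : Fin 2 → _) ∘ (1 : Fin 2).succAbove = ![α] := by
      funext i
      fin_cases i
      rfl
    rw [hv] at h
    rw [h, show sgnTri (0 + 2) = -1 from rfl, neg_one_smul, neg_sub]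
    rw [Fin.sum_univ_two, Fin.sum_univ_two, Fin.sum_univ_one, Fin.sum_univ_one]
    have h2 : (0 : Fin 2) < (0 : Fin 2).succAbove (0 : Fin 1) := by decide
    have h3 : ¬ (1 : Fin 2) < (1 : Fin 2).succAbove (0 : Fin 1) := by decide
    erw [h0, h1, if_pos h2, if_neg h3]
    rw [add_zero, ← sub_sub]
    refine congrArg₂ _ (congrArg₂ _ ?_ rfl) rfl
    simp [thetaTensorTwo, AlmostPoisson.bracketOneOne, E.the_zero]
  three_fun_fun_one f g α := by
    have h := E.formBrackets_fun_fun_ones 1 f g ![α]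
    have hv : (Fin.cons (ofFun f) (Fin.cons (ofFun g) fun i => ofOne ((![α] : Fin 1 → _) i)) :
        Fin 3 → Forms 𝕜 U) = ![ofFun f, ofFun g, ofOne α] := by
      funext i
      fin_cases i <;> rfl
    rw [hv] at h
    -- The triangular sign cancels the minus sign in the first-order coefficient -Π.
    rw [h, show sgnTri 1 = -1 from rfl, neg_one_smul]
    congr 1
    simp only [thetaEval, AlmostPoisson.jacobiatorEval, E.the_one, Nat.factorial_one, one_smul,
      ← Finset.sum_neg_distrib]
    refine Finset.sum_congr rfl fun j _ => Finset.sum_congr rfl fun i _ => ?_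
    rw [← (Equiv.funUnique (Fin 1) (Fin d)).symm.sum_comp]
    refine Finset.sum_congr rfl fun k _ => ?_
    simp
  ones m α := E.formBrackets_ones m α
  fun_ones m f α := E.formBrackets_fun_ones (m + 1) f α
  fun_fun_ones m f g α := E.formBrackets_fun_fun_ones (m + 2) f g α

/-- `formsOfDegree` and `extDegree` unfold to the same submodules. -/
theorem isPInfinity_formBrackets : IsPInfinity (formsOfDegree 𝕜 U) E.formBrackets :=
  isPInfinity_brackets (partialDer 𝕜 U) partialDer_comm isCoeffDerivation_polyDer E.isFormalPoisson

end LocalSymplecticEmbedding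

end PInftyForms

end

noncomputable section

namespace PInftyForms

/-! ### Uniqueness of structures with given values on generators -/

section Uniqueness

variable {𝕜 : Type} [Field 𝕜] {V : Type} [Ring V] [Algebra 𝕜 V] {𝒢 : ℤ → Submodule 𝕜 V}
  {ℓ ℓ' : (n : ℕ) → MultilinearMap 𝕜 (fun _ : Fin n => V) V}

theorem IsLInfinity.eq_comp_swap_iff (h : IsLInfinity 𝒢 ℓ) (h' : IsLInfinity 𝒢 ℓ') {n : ℕ}
    {a : Fin n → ℤ} {v : Fin n → V} (hv : ∀ i, v i ∈ 𝒢 (a i)) {i j : Fin n}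
    (hij : j.val = i.val + 1) :
    ℓ n (v ∘ Equiv.swap i j) = ℓ' n (v ∘ Equiv.swap i j) ↔ ℓ n v = ℓ' n v := by
  rw [h.skew n a v hv i j hij, h'.skew n a v hv i j hij, neg_inj]
  rcases Int.units_eq_one_or ((a i * a j).negOnePow) with hs | hs <;> simp [hs]

theorem IsLInfinity.eq_comp_perm_iff (h : IsLInfinity 𝒢 ℓ) (h' : IsLInfinity 𝒢 ℓ') {n : ℕ}
    {v : Fin n → V} (hv : ∀ i, ∃ k, v i ∈ 𝒢 k) (σ : Equiv.Perm (Fin n)) :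
    ℓ n (v ∘ σ) = ℓ' n (v ∘ σ) ↔ ℓ n v = ℓ' n v := by
  rcases n with _ | n
  · rw [Subsingleton.elim (v ∘ σ) v]
  have hσ : σ ∈ Submonoid.closure
      (Set.range fun i : Fin n => Equiv.swap i.castSucc i.succ) := by
    rw [Equiv.Perm.mclosure_swap_castSucc_succ]
    trivial
  induction hσ using Submonoid.closure_induction generalizing v with
  | mem τ hτ =>
    obtain ⟨i, rfl⟩ := hτ
    choose a ha using hv
    exact h.eq_comp_swap_iff h' ha (by simp)
  | one => rfl
  | mul τ ρ _ _ hτ hρ =>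
    exact (hρ (v := v ∘ τ) fun i => hv _).trans (hτ hv)

/-- Since the grading is exhaustive, multilinearity allows one slot at a time to be made
homogeneous; the induction is over the set of slots still arbitrary. -/
theorem IsPInfinity.eq_of_homogeneous (h : IsPInfinity 𝒢 ℓ) {n : ℕ}
    (H : ∀ v : Fin n → V, (∀ i, ∃ k, v i ∈ 𝒢 k) → ℓ n v = ℓ' n v) : ℓ n = ℓ' n := by
  have key : ∀ (s : Finset (Fin n)) (v : Fin n → V), (∀ i ∉ s, ∃ k, v i ∈ 𝒢 k) →
      ℓ n v = ℓ' n v := by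
    intro s
    induction s using Finset.induction_on with
    | empty => exact fun v hv => H v fun i => hv i (by simp)
    | insert i s hi ih =>
      intro v hv
      have hx : v i ∈ ⨆ k, 𝒢 k := by
        rw [h.gradedCommutative.internal.submodule_iSup_eq_top]
        trivial
      rw [← Function.update_eq_self i v]
      refine Submodule.iSup_induction 𝒢 (motive := fun x =>
        ℓ n (Function.update v i x) = ℓ' n (Function.update v i x)) hx ?_ ?_ ?_
      · intro k x hxk
        refine ih _ fun j hj => ?_
        rcases eq_or_ne j i with rfl | hji
        · exact ⟨k, by simpa using hxk⟩
        · rw [Function.update_of_ne hji]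
          exact hv j (by simp [hji, hj])
      · rw [MultilinearMap.map_update_zero, MultilinearMap.map_update_zero]
      · intro x y hx hy
        rw [MultilinearMap.map_update_add, MultilinearMap.map_update_add, hx, hy]
  ext v
  exact key Finset.univ v fun i hi => absurd (Finset.mem_univ i) hi

variable {A : Type} [CommRing A] [Algebra 𝕜 A] {d : ℕ}

/-- The generators of the exterior algebra: elements of the base ring and of the module. -/
def IsGenerator (x : ExteriorAlgebra A (Fin d → A)) : Prop :=
  (∃ f, x = algebraMap A _ f) ∨ ∃ α, x = ExteriorAlgebra.ι A α

theorem IsGenerator.homogeneous {x : ExteriorAlgebra A (Fin d → A)} (hx : IsGenerator x) :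
    ∃ k, x ∈ extDegree 𝕜 A (Fin d) k := by
  rcases hx with ⟨f, rfl⟩ | ⟨α, rfl⟩
  · exact ⟨0, algebraMap_mem_extDegree f⟩
  · exact ⟨1, ι_mem_extDegree α⟩

variable {ℓ ℓ' : (n : ℕ) → MultilinearMap 𝕜 (fun _ : Fin n => ExteriorAlgebra A (Fin d → A))
    (ExteriorAlgebra A (Fin d → A))}

theorem IsPInfinity.eq_snoc (h : IsPInfinity (extDegree 𝕜 A (Fin d)) ℓ)
    (h' : IsPInfinity (extDegree 𝕜 A (Fin d)) ℓ') {n : ℕ} {u : Fin n → ExteriorAlgebra A (Fin d → A)}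
    (hu : ∀ i, ∃ k, u i ∈ extDegree 𝕜 A (Fin d) k)
    (H : ∀ x, IsGenerator x → ℓ (n + 1) (Fin.snoc u x) = ℓ' (n + 1) (Fin.snoc u x))
    (x : ExteriorAlgebra A (Fin d → A)) :
    ℓ (n + 1) (Fin.snoc u x) = ℓ' (n + 1) (Fin.snoc u x) := by
  choose a ha using hu
  induction x using ext_induction with
  | h0 r => exact H _ (Or.inl ⟨r, rfl⟩)
  | hadd x y hx hy => rw [MultilinearMap.snoc_add, MultilinearMap.snoc_add, hx, hy]
  | hι x m hx =>
    rw [h.derivation n a u ha 1 _ x (ι_mem_extDegree m),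
      h'.derivation n a u ha 1 _ x (ι_mem_extDegree m), hx, H _ (Or.inr ⟨m, rfl⟩)]

/-- The derivation property concerns the last slot only. A transposition brings any slot there, at
the cost of a sign that is the same for both structures. -/
theorem IsPInfinity.eq_of_generators (h : IsPInfinity (extDegree 𝕜 A (Fin d)) ℓ)
    (h' : IsPInfinity (extDegree 𝕜 A (Fin d)) ℓ') {n : ℕ}
    (H : ∀ v : Fin n → ExteriorAlgebra A (Fin d → A), (∀ i, IsGenerator (v i)) →
      ℓ n v = ℓ' n v) : ℓ n = ℓ' n := by
  refine h.eq_of_homogeneous fun v hv => ?_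
  have key : ∀ (s : Finset (Fin n)) (v : Fin n → ExteriorAlgebra A (Fin d → A)),
      (∀ i, ∃ k, v i ∈ extDegree 𝕜 A (Fin d) k) → (∀ i ∉ s, IsGenerator (v i)) →
      ℓ n v = ℓ' n v := by
    intro s
    induction s using Finset.induction_on with
    | empty => exact fun v _ hv => H v fun i => hv i (by simp)
    | insert i s hi ih =>
      intro v hv hs
      rcases n with _ | n
      · exact i.elim0
      have hperm := fun {v : Fin (n + 1) → ExteriorAlgebra A (Fin d → A)}
        (hv : ∀ i, ∃ k, v i ∈ extDegree 𝕜 A (Fin d) k) =>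
        h.lInfinity.eq_comp_perm_iff h'.lInfinity hv (Equiv.swap i (Fin.last n))
      have hsn : ∀ x, (Function.update v i x) ∘ Equiv.swap i (Fin.last n) =
          Fin.snoc (Fin.init (v ∘ Equiv.swap i (Fin.last n))) x := by
        intro x
        have hc : (Function.update v i x) ∘ Equiv.swap i (Fin.last n) =
            Function.update (v ∘ Equiv.swap i (Fin.last n)) (Fin.last n) x := by
          have := Function.update_comp_equiv v (Equiv.swap i (Fin.last n)) i x
          rw [Equiv.symm_swap, Equiv.swap_apply_left] at this
          exact this
        rw [hc, ← Fin.snoc_init_self (v ∘ Equiv.swap i (Fin.last n)), Fin.update_snoc_last,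
          Fin.init_snoc]
      rw [← hperm hv, ← Function.update_eq_self i v, hsn]
      refine h.eq_snoc h' (fun j => hv _) (fun x hx => ?_) _
      have hg : ∀ j, ∃ k, Function.update v i x j ∈ extDegree 𝕜 A (Fin d) k := fun j => by
        rcases eq_or_ne j i with rfl | hji
        · rw [Function.update_self]
          exact hx.homogeneous
        · rw [Function.update_of_ne hji]
          exact hv j
      change ℓ (n + 1) (Fin.snoc (Fin.init (v ∘ Equiv.swap i (Fin.last n))) x) =
        ℓ' (n + 1) (Fin.snoc (Fin.init (v ∘ Equiv.swap i (Fin.last n))) x)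
      rw [← hsn, hperm hg]
      refine ih _ hg fun j hj => ?_
      rcases eq_or_ne j i with rfl | hji
      · rwa [Function.update_self]
      · rw [Function.update_of_ne hji]
        exact hs j (by simp [hji, hj])
  exact key Finset.univ v hv fun i hi => absurd (Finset.mem_univ i) hi

/-- Brackets of generators vanish for degree reasons if three of them are of degree zero. -/
theorem IsPInfinity.eq_zero_of_three_fun (h : IsPInfinity (extDegree 𝕜 A (Fin d)) ℓ) {n : ℕ}
    (f g : A) {w : Fin n → ExteriorAlgebra A (Fin d → A)} (hw : ∀ i, IsGenerator (w i)) {k : Fin n}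
    {r : A} (hk : w k = algebraMap A _ r) :
    ℓ (n + 2) (Fin.cons (algebraMap A _ f) (Fin.cons (algebraMap A _ g) w)) = 0 := by
  classical
  have hdeg : ∀ i, ∃ m : ℤ, w i ∈ extDegree 𝕜 A (Fin d) m ∧ m ≤ if i = k then 0 else 1 := by
    intro i
    split_ifs with hi
    · exact ⟨0, by rw [hi, hk]; exact algebraMap_mem_extDegree r, le_rfl⟩
    · rcases hw i with ⟨f, hf⟩ | ⟨α, hα⟩
      · exact ⟨0, by rw [hf]; exact algebraMap_mem_extDegree f, zero_le_one⟩
      · exact ⟨1, by rw [hα]; exact ι_mem_extDegree α, le_rfl⟩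
  choose a ha hle using hdeg
  have hsum : ∑ i, a i ≤ n - 1 := by
    calc ∑ i, a i ≤ ∑ i, if i = k then 0 else 1 := Finset.sum_le_sum fun i _ => hle i
      _ = n - 1 := by
        have h1 : ∀ i : Fin n, (if i = k then 0 else 1 : ℤ) = 1 - if i = k then 1 else 0 := by
          intro i
          split_ifs <;> simp
        simp [h1, Finset.sum_sub_distrib]
  -- Two functions and the entry k have degree zero and the others at most one, so the total is at
  -- most 2 - (n + 2) + (n - 1) = -1.
  refine eq_zero_of_mem_extDegree_neg (𝕜 := 𝕜) (k := 2 - (n + 2 : ℕ) +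
    ∑ i, (Fin.cons 0 (Fin.cons 0 a : Fin (n + 1) → ℤ) : Fin (n + 2) → ℤ) i) ?_
    (h.lInfinity.degree _ _ _ fun i => ?_)
  · rw [Fin.sum_univ_succ, Fin.cons_zero]
    simp only [Fin.cons_succ]
    rw [Fin.sum_univ_succ, Fin.cons_zero]
    simp only [Fin.cons_succ]
    push_cast
    linarith
  · refine Fin.cases ?_ (fun i => ?_) i
    · exact algebraMap_mem_extDegree f
    · simp only [Fin.cons_succ]
      refine Fin.cases ?_ (fun i => ?_) i
      · exact algebraMap_mem_extDegree g
      · exact ha i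

theorem exists_ones_or_exists_fun {n : ℕ} {v : Fin n → ExteriorAlgebra A (Fin d → A)}
    (hv : ∀ i, IsGenerator (v i)) :
    (∃ α : Fin n → Fin d → A, v = fun i => ExteriorAlgebra.ι A (α i)) ∨
      ∃ i r, v i = algebraMap A _ r := by
  by_cases hf : ∃ i r, v i = algebraMap A _ r
  · exact Or.inr hf
  · push Not at hf
    have : ∀ i, ∃ α, v i = ExteriorAlgebra.ι A α := fun i =>
      (hv i).resolve_left fun ⟨r, hr⟩ => hf i r hr
    choose α hα using this
    exact Or.inl ⟨α, funext hα⟩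

/-- Two `P_∞`-structures on the exterior algebra agree if they agree on one-forms, on a function
and one-forms, and on two functions and one-forms. -/
theorem IsPInfinity.eq_of_ones (h : IsPInfinity (extDegree 𝕜 A (Fin d)) ℓ)
    (h' : IsPInfinity (extDegree 𝕜 A (Fin d)) ℓ')
    (H0 : ∀ (n : ℕ) (α : Fin n → Fin d → A),
      ℓ n (fun i => ExteriorAlgebra.ι A (α i)) = ℓ' n fun i => ExteriorAlgebra.ι A (α i))
    (H1 : ∀ (n : ℕ) (f : A) (α : Fin n → Fin d → A),
      ℓ (n + 1) (Fin.cons (algebraMap A _ f) fun i => ExteriorAlgebra.ι A (α i)) =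
        ℓ' (n + 1) (Fin.cons (algebraMap A _ f) fun i => ExteriorAlgebra.ι A (α i)))
    (H2 : ∀ (n : ℕ) (f g : A) (α : Fin n → Fin d → A),
      ℓ (n + 2) (Fin.cons (algebraMap A _ f) (Fin.cons (algebraMap A _ g)
          fun i => ExteriorAlgebra.ι A (α i))) =
        ℓ' (n + 2) (Fin.cons (algebraMap A _ f) (Fin.cons (algebraMap A _ g)
          fun i => ExteriorAlgebra.ι A (α i)))) : ℓ = ℓ' := by
  funext n
  refine h.eq_of_generators h' fun v hv => ?_
  rcases exists_ones_or_exists_fun hv with ⟨α, rfl⟩ | ⟨i, f, hi⟩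
  · exact H0 n α
  rcases n with _ | n
  · exact i.elim0
  -- The first function found is moved to the front; a second one, if present, is moved next to it
  -- below.
  rw [← h.lInfinity.eq_comp_perm_iff h'.lInfinity (fun i => (hv i).homogeneous) (Equiv.swap 0 i)]
  have hu : ∀ j, IsGenerator (Fin.tail (v ∘ Equiv.swap 0 i) j) := fun j => hv _
  have hvu : v ∘ Equiv.swap 0 i =
      Fin.cons (algebraMap A _ f) (Fin.tail (v ∘ Equiv.swap 0 i)) := by
    rw [← hi]
    conv_lhs => rw [← Fin.cons_self_tail (v ∘ Equiv.swap 0 i)]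
    simp
  rw [hvu]
  generalize Fin.tail (v ∘ Equiv.swap 0 i) = u at hu
  rcases exists_ones_or_exists_fun hu with ⟨α, rfl⟩ | ⟨j, g, hj⟩
  · exact H1 n f α
  rcases n with _ | n
  · exact j.elim0
  have hg : ∀ k, IsGenerator
      ((Fin.cons (algebraMap A _ f) u : Fin (n + 2) → ExteriorAlgebra A (Fin d → A)) k) :=
    fun k => Fin.cases (Or.inl ⟨f, rfl⟩) hu k
  rw [← h.lInfinity.eq_comp_perm_iff h'.lInfinity (fun i => (hg i).homogeneous)
    (Equiv.swap (Fin.succ 0) j.succ)]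
  have hw : ∀ k, IsGenerator (Fin.tail (u ∘ Equiv.swap 0 j) k) := fun k => hu _
  have hvw : (Fin.cons (algebraMap A _ f) u : Fin (n + 2) → ExteriorAlgebra A (Fin d → A)) ∘
      Equiv.swap (Fin.succ 0) j.succ =
      Fin.cons (algebraMap A _ f) (Fin.cons (algebraMap A _ g) (Fin.tail (u ∘ Equiv.swap 0 j))) := by
    have hc : Fin.cons (algebraMap A _ g) (Fin.tail (u ∘ Equiv.swap 0 j)) = u ∘ Equiv.swap 0 j := by
      rw [← hj]
      conv_rhs => rw [← Fin.cons_self_tail (u ∘ Equiv.swap 0 j)]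
      simp
    rw [hc]
    funext k
    refine Fin.cases ?_ (fun k => ?_) k
    · rw [Function.comp_apply, Equiv.swap_apply_of_ne_of_ne (Fin.succ_ne_zero _).symm
        (Fin.succ_ne_zero _).symm]
      rfl
    · rw [Function.comp_apply, (Fin.succ_injective _).swap_apply]
      rfl
  rw [hvw]
  generalize Fin.tail (u ∘ Equiv.swap 0 j) = w at hw
  rcases exists_ones_or_exists_fun hw with ⟨α, rfl⟩ | ⟨k, r, hk⟩
  · exact H2 n f g α
  · rw [h.eq_zero_of_three_fun f g hw hk, h'.eq_zero_of_three_fun f g hw hk]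

end Uniqueness

/-! ### Agreement of structures with the prescribed values -/

section Generators

variable {𝕜 : Type} [RCLike 𝕜] {d : ℕ} {U : TopologicalSpace.Opens (Fin d → ℝ)}
  {θ : AlmostPoisson 𝕜 U} {E : LocalSymplecticEmbedding θ}
  {ϱ ϱ' : (n : ℕ) → MultilinearMap 𝕜 (fun _ : Fin n => Forms 𝕜 U) (Forms 𝕜 U)}

theorem HasGeneratorBrackets.eq_ones (h : HasGeneratorBrackets E ϱ)
    (h' : HasGeneratorBrackets E ϱ') (h0 : ϱ 0 = ϱ' 0) (n : ℕ) (α : Fin n → OneForm 𝕜 U) :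
    ϱ n (fun i => ofOne (α i)) = ϱ' n fun i => ofOne (α i) := by
  match n, α with
  | 0, α => rw [h0]
  | 1, α =>
    have hv : (fun i => ofOne (α i) : Fin 1 → Forms 𝕜 U) = ![ofOne (α 0)] := by
      funext i
      fin_cases i
      rfl
    rw [hv, h.one_one, h'.one_one]
  | n + 2, α => rw [h.ones, h'.ones]

theorem HasGeneratorBrackets.eq_fun_ones (h : HasGeneratorBrackets E ϱ)
    (h' : HasGeneratorBrackets E ϱ') (n : ℕ) (f : SmoothFun 𝕜 U) (α : Fin n → OneForm 𝕜 U) :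
    ϱ (n + 1) (Fin.cons (ofFun f) fun i => ofOne (α i)) =
      ϱ' (n + 1) (Fin.cons (ofFun f) fun i => ofOne (α i)) := by
  match n, α with
  | 0, α =>
    have hv : (Fin.cons (ofFun f) fun i => ofOne (α i) : Fin 1 → Forms 𝕜 U) = ![ofFun f] := by
      funext i
      fin_cases i
      rfl
    rw [hv, h.one_fun, h'.one_fun]
  | 1, α =>
    have hv : (Fin.cons (ofFun f) fun i => ofOne (α i) : Fin 2 → Forms 𝕜 U) =
        ![ofFun f, ofOne (α 0)] := by
      funext i
      fin_cases i <;> rfl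
    rw [hv, h.two_fun_one, h'.two_fun_one]
  | n + 2, α => rw [h.fun_ones, h'.fun_ones]

theorem HasGeneratorBrackets.eq_fun_fun_ones (h : HasGeneratorBrackets E ϱ)
    (h' : HasGeneratorBrackets E ϱ') (n : ℕ) (f g : SmoothFun 𝕜 U) (α : Fin n → OneForm 𝕜 U) :
    ϱ (n + 2) (Fin.cons (ofFun f) (Fin.cons (ofFun g) fun i => ofOne (α i))) =
      ϱ' (n + 2) (Fin.cons (ofFun f) (Fin.cons (ofFun g) fun i => ofOne (α i))) := by
  match n, α with
  | 0, α =>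
    have hv : (Fin.cons (ofFun f) (Fin.cons (ofFun g) fun i => ofOne (α i)) :
        Fin 2 → Forms 𝕜 U) = ![ofFun f, ofFun g] := by
      funext i
      fin_cases i <;> rfl
    rw [hv, h.two_fun_fun, h'.two_fun_fun]
  | 1, α =>
    have hv : (Fin.cons (ofFun f) (Fin.cons (ofFun g) fun i => ofOne (α i)) :
        Fin 3 → Forms 𝕜 U) = ![ofFun f, ofFun g, ofOne (α 0)] := by
      funext i
      fin_cases i <;> rfl
    rw [hv, h.three_fun_fun_one, h'.three_fun_fun_one]
  | n + 2, α => rw [h.fun_fun_ones, h'.fun_fun_ones]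

end Generators

end PInftyForms

end

theorem proposition5p6 {𝕜 : Type} [RCLike 𝕜] {d : ℕ}
    (U : TopologicalSpace.Opens (Fin d → ℝ)) (θ : PInftyForms.AlmostPoisson 𝕜 U)
    (E : PInftyForms.LocalSymplecticEmbedding θ) :
    ∃! ϱ : (n : ℕ) → MultilinearMap 𝕜 (fun _ : Fin n => PInftyForms.Forms 𝕜 U)
        (PInftyForms.Forms 𝕜 U),
      PInftyForms.IsPInfinity (PInftyForms.formsOfDegree 𝕜 U) ϱ ∧
        PInftyForms.HasGeneratorBrackets E ϱ := by
  refine ⟨E.formBrackets, ⟨E.isPInfinity_formBrackets, E.hasGeneratorBrackets⟩, ?_⟩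
  rintro ϱ ⟨hϱ, hg⟩
  exact PInftyForms.IsPInfinity.eq_of_ones hϱ E.isPInfinity_formBrackets
    -- The nullary bracket is not among the prescribed values; flatness fixes it.
    (hg.eq_ones E.hasGeneratorBrackets (hϱ.lInfinity.flat.trans
      E.isPInfinity_formBrackets.lInfinity.flat.symm))
    (hg.eq_fun_ones E.hasGeneratorBrackets) (hg.eq_fun_fun_ones E.hasGeneratorBrackets)
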